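/- Work in the category of smooth ($C^\infty$) Banach manifolds without boundary and smooth Banach vector bundles. For a vector bundle $\tau:P\to N$ let $J^1\tau$ be the manifold of $1$-jets $j^1_n\sigma$ of local smooth sections of $\tau$; it is a vector bundle $\tau_1:J^1\tau\to N$ with $j^1_n\sigma+j^1_n\eta=j^1_n(\sigma+\eta)$, $\lambda\, j^1_n\sigma=j^1_n(\lambda\sigma)$, and $\tau_{10}(j^1_n\sigma)=\sigma(n)$ is the target projection. A connection on $\tau$ is a smooth section $h:P\to J^1\tau$ of $\tau_{10}$, with horizontal lift $\xi^H(p,v)=h(p)(v)$, where a jet $j^1_n\sigma$ is identified with the linear map $T_n\sigma$; it is linear if it is a vector bundle morphism from $\tau$ to $\tau_1$ over $\mathrm{id}_N$. Let $\pi:E\to M$ be a vector bundle. Write $\mathrm{Ver}(\pi)=\ker T\pi$, a vector bundle $\tau^V_E:\mathrm{Ver}(\pi)\to E$; let $\xi^V_\pi:\pi^*E\to\mathrm{Ver}(\pi)$, $\xi^V_\pi(a,b)=\frac{d}{ds}(a+sb)|_{s=0}$, be the vertical lift, $\nu_\pi=\mathrm{pr}_2\circ(\xi^V_\pi)^{-1}$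 the vertical projection, and $\mathfrak p_V:\mathrm{Ver}(\pi)\to M$ the vertical bundle regarded as a vector bundle over $M$, with $\xi^V_\pi(a,b)+\xi^V_\pi(a',b')=\xi^V_\pi(a+a',b+b')$ and $\lambda\,\xi^V_\pi(a,b)=\xi^V_\pi(\lambda a,\lambda b)$. Let $$\mathrm{vj}:\mathrm{Ver}(\pi_1)\to J^1\mathfrak p_V,\qquad \mathrm{vj}\Big(\tfrac{d}{ds}j^1_m\sigma_s\big|_{s=0}\Big)=j^1_m\Big(\tfrac{d}{ds}\sigma_s\big|_{s=0}\Big),$$ where $\sigma_s$ runs over the smooth one-parameter families of local sections of $\pi$. Let $h$ be a (possibly nonlinear) connection on $\pi$. On the one hand, let $\mathcal Fh:\pi^*E\to\pi_1^*(J^1\pi)$, $\mathcal Fh(a,b)=\big(h(a),\nu_{\pi_1}(Th(\xi^V_\pi(a,b)))\big)$, be the fibre derivative of $h$, let $\Psi:\pi_1^*(J^1\pi)\to J^1(\pi^*\pi)$, $\Psi(j^1_m\sigma,j^1_m\eta)=j^1_{\sigma(m)}\big(a\mapsto(a,\eta(\pi(a)))\big)$, and put $\bar h=\Psi\circ\mathcal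 Fh:\pi^*E\to J^1(\pi^*\pi)$. On the other hand, for $z=\xi^V_\pi(a,b)$ let $\mathcal Vh(z)=\mathrm{vj}\big(\frac{d}{ds}h(a+sb)|_{s=0}\big)\in J^1\mathfrak p_V$, let $\Psi_V:J^1\mathfrak p_V\to J^1\tau^V_E$, $\Psi_V(j^1_mZ)=j^1_{a_0}(\iota_V Z)$, where $a_0=\tau^V_E(Z(m))$ and $(\iota_VZ)(a)=\xi^V_\pi\big(a,\nu_\pi(Z(\pi(a)))\big)$, and put $\bar h_V=\Psi_V\circ\mathcal Vh:\mathrm{Ver}(\pi)\to J^1\tau^V_E$. Then: 1. Every vector of $\mathrm{Ver}(\pi_1)$ is of the form $\frac{d}{ds}j^1_m\sigma_s|_{s=0}$, and $\mathrm{vj}$ is well defined and bijective. 2. $\bar h_V$ is a linear connection on the vertical bundle $\tau^V_E:\mathrm{Ver}(\pi)\to E$. 3. $\bar h$ is a linear connection on $\pi^*\pi:\pi^*E\to E$, and it is the linearization of $h$: under $T(\pi^*E)\cong\{(w_1,w_2)\in TE\times TE:\ T\pi(w_1)=T\pi(w_2)\}$ its horizontal lift is $((a,b),w)\mapsto(w,B(a,b)w)$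 with $B(a,b)w=\nu_{T\pi}\big(\frac{d}{ds}\xi^H(a+sb,T\pi(w))|_{s=0}\big)$. Here $\xi^H$ is the horizontal lift of $h$, and $\nu_{T\pi}$ is the vertical projection of the vector bundle $T\pi:TE\to TM$, whose operations are $\dot\alpha(0)+\dot\beta(0)=\frac{d}{dt}(\alpha+\beta)(0)$ and $\lambda\,\dot\alpha(0)=\frac{d}{dt}(\lambda\alpha)(0)$, for curves $\alpha,\beta$ in $E$ with $\pi\circ\alpha=\pi\circ\beta$. 4. The two are related by $j^1\xi^V_{\pi,E}\circ\bar h=\bar h_V\circ\xi^V_\pi$, where $j^1\xi^V_{\pi,E}:J^1(\pi^*\pi)\to J^1\tau^V_E$, $j^1_a\sigma\mapsto j^1_a(\xi^V_\pi\circ\sigma)$, is the prolongation of $\xi^V_\pi$ fibred over $\mathrm{id}_E$. So $\bar h_V$ corresponds to the linearization of $h$ on the vertical bundle. -/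

import Mathlib

set_option linter.style.haveILetI false
set_option linter.unusedSectionVars false
open Manifold ContDiff Topology
open Bundle (TotalSpace Trivialization Pretrivialization zeroSection contMDiffAt_totalSpace mdifferentiableAt_proj
  contMDiff_proj contMDiffAt_proj contMDiff_zeroSection)

noncomputable section

section Transport

variable {B : Type*} {F : Type*} {E E' : B → Type*}
  [NormedAddCommGroup F] [NormedSpace ℝ F] [TopologicalSpace B]
  [∀ x, AddCommGroup (E x)] [∀ x, Module ℝ (E x)] [∀ x, TopologicalSpace (E x)]
  [TopologicalSpace (TotalSpace F E)] [FiberBundle F E] [VectorBundle ℝ F E]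
  [∀ x, AddCommGroup (E' x)] [∀ x, Module ℝ (E' x)]

variable (F) in
/-- The bijection of total spaces induced by fibrewise linear isomorphisms. -/
def totalEquiv (e : ∀ x, E' x ≃ₗ[ℝ] E x) : TotalSpace F E' ≃ TotalSpace F E where
  toFun p := ⟨p.proj, e p.proj p.2⟩
  invFun p := ⟨p.proj, (e p.proj).symm p.2⟩
  left_inv p := by simp
  right_inv p := by simp

/-- Fibre topology carried over by linear isomorphisms. -/
@[reducible] def transportFibreTopology (e : ∀ x, E' x ≃ₗ[ℝ] E x) (x : B) :
    TopologicalSpace (E' x) :=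
  TopologicalSpace.induced (e x) inferInstance

variable (F) in
/-- Total space topology carried over by fibrewise linear isomorphisms. -/
@[reducible] def transportTopology (e : ∀ x, E' x ≃ₗ[ℝ] E x) : TopologicalSpace (TotalSpace F E') :=
  TopologicalSpace.induced (totalEquiv F e) inferInstance

variable (F) in
/-- The homeomorphism of total spaces. -/
def transportHomeomorph (e : ∀ x, E' x ≃ₗ[ℝ] E x) :
    letI := transportTopology F e
    TotalSpace F E' ≃ₜ TotalSpace F E :=
  letI := transportTopology F e
  (totalEquiv F e).toHomeomorphOfIsInducing ⟨rfl⟩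

variable (F) in
/-- A local trivialization carried over by fibrewise linear isomorphisms. -/
def transportTriv (e : ∀ x, E' x ≃ₗ[ℝ] E x) (t : Trivialization F (TotalSpace.proj : TotalSpace F E → B)) :
    letI := transportTopology F e
    Trivialization F (TotalSpace.proj : TotalSpace F E' → B) :=
  letI := transportTopology F e
  t.compHomeomorph (transportHomeomorph F e)

variable (F) in
/-- The unique fibre bundle structure for which fibrewise linear isomorphisms onto a given
bundle form an isomorphism of bundles. -/
@[reducible] def transportFiberBundle (e : ∀ x, E' x ≃ₗ[ℝ] E x) :
    @FiberBundle B F _ _ E' (transportTopology F e) (transportFibreTopology e) :=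
  letI := transportTopology F e
  letI := transportFibreTopology e
  { totalSpaceMk_isInducing' := fun b => by
      have h1 : IsInducing (transportHomeomorph F e) := (transportHomeomorph F e).isInducing
      rw [← h1.of_comp_iff]
      exact (FiberBundle.totalSpaceMk_isInducing F E b).comp ⟨rfl⟩
    trivializationAtlas' := transportTriv F e '' trivializationAtlas F E
    trivializationAt' := fun b => transportTriv F e (trivializationAt F E b)
    mem_baseSet_trivializationAt' := fun b => mem_baseSet_trivializationAt F E b
    trivialization_mem_atlas' := fun b => ⟨_, trivialization_mem_atlas F E b, rfl⟩ }

theorem transportTriv_isLinear (e : ∀ x, E' x ≃ₗ[ℝ] E x) (t : Trivialization F (TotalSpace.proj : TotalSpace F E → B))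
    [t.IsLinear ℝ] :
    letI := transportTopology F e
    (transportTriv F e t).IsLinear ℝ :=
  letI := transportTopology F e
  { linear := fun b hb => by
      have := (Trivialization.linear (R := ℝ) t hb)
      constructor
      · intro v w
        change (t ⟨b, e b (v + w)⟩).2 = (t ⟨b, e b v⟩).2 + (t ⟨b, e b w⟩).2
        rw [map_add]; exact this.map_add _ _
      · intro c v
        change (t ⟨b, e b (c • v)⟩).2 = c • (t ⟨b, e b v⟩).2
        rw [map_smul]; exact this.map_smul _ _ }

theorem transport_coordChangeL (e : ∀ x, E' x ≃ₗ[ℝ] E x) (t t' : Trivialization F (TotalSpace.proj : TotalSpace F E → B))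
    [t.IsLinear ℝ] [t'.IsLinear ℝ] {b : B} (hb : b ∈ t.baseSet ∩ t'.baseSet) :
    letI := transportTopology F e
    letI := transportFibreTopology e
    letI := transportTriv_isLinear e t
    letI := transportTriv_isLinear e t'
    ((transportTriv F e t).coordChangeL ℝ (transportTriv F e t') b : F →L[ℝ] F) =
      t.coordChangeL ℝ t' b := by
  letI := transportTopology F e
  letI := transportFibreTopology e
  letI := transportTriv_isLinear e t
  letI := transportTriv_isLinear e t'
  ext v
  have h1 := Trivialization.coordChangeL_apply' (R := ℝ) (transportTriv F e t) (transportTriv F e t')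
    (b := b) hb v
  have h2 := Trivialization.coordChangeL_apply' (R := ℝ) t t' hb v
  refine h1.trans (Eq.trans ?_ h2.symm)
  change (t' (transportHomeomorph F e ((transportHomeomorph F e).symm
    (t.toOpenPartialHomeomorph.symm (b, v))))).2 = _
  rw [Homeomorph.apply_symm_apply]

theorem transportVectorBundle (e : ∀ x, E' x ≃ₗ[ℝ] E x) :
    letI := transportTopology F e
    letI := transportFibreTopology e
    letI := transportFiberBundle F e
    VectorBundle ℝ F E' :=
  letI := transportTopology F e
  letI := transportFibreTopology e
  letI := transportFiberBundle F e
  { trivialization_linear' := by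
      rintro _ ⟨t, ht, rfl⟩
      haveI : MemTrivializationAtlas t := ⟨ht⟩
      exact transportTriv_isLinear e t
    continuousOn_coordChange' := by
      rintro _ _ ⟨t, ht, rfl⟩ ⟨t', ht', rfl⟩
      haveI : MemTrivializationAtlas t := ⟨ht⟩
      haveI : MemTrivializationAtlas t' := ⟨ht'⟩
      exact (continuousOn_coordChange ℝ t t').congr fun b hb => transport_coordChangeL e t t' hb }

theorem transportContMDiffVectorBundle {EB : Type*} [NormedAddCommGroup EB] [NormedSpace ℝ EB]
    {HB : Type*} [TopologicalSpace HB] (I : ModelWithCorners ℝ EB HB) [ChartedSpace HB B]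
    [ContMDiffVectorBundle ∞ F E I] (e : ∀ x, E' x ≃ₗ[ℝ] E x) :
    letI := transportTopology F e
    letI := transportFibreTopology e
    letI := transportFiberBundle F e
    letI := transportVectorBundle (F := F) e
    ContMDiffVectorBundle ∞ F E' I :=
  letI := transportTopology F e
  letI := transportFibreTopology e
  letI := transportFiberBundle F e
  letI := transportVectorBundle (F := F) e
  { contMDiffOn_coordChangeL := by
      rintro _ _ ⟨t, ht, rfl⟩ ⟨t', ht', rfl⟩
      haveI : MemTrivializationAtlas t := ⟨ht⟩
      haveI : MemTrivializationAtlas t' := ⟨ht'⟩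
      exact (contMDiffOn_coordChangeL t t').congr fun b hb => transport_coordChangeL e t t' hb }

theorem contMDiff_totalEquiv {EB : Type*} [NormedAddCommGroup EB] [NormedSpace ℝ EB]
    {HB : Type*} [TopologicalSpace HB] (I : ModelWithCorners ℝ EB HB) [ChartedSpace HB B]
    (e : ∀ x, E' x ≃ₗ[ℝ] E x) :
    letI := transportTopology F e
    letI := transportFibreTopology e
    letI := transportFiberBundle F e
    ContMDiff (I.prod 𝓘(ℝ, F)) (I.prod 𝓘(ℝ, F)) ∞ (totalEquiv F e) := by
  letI := transportTopology F e
  letI := transportFibreTopology e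
  letI := transportFiberBundle F e
  intro p
  have h : ContMDiffAt (I.prod 𝓘(ℝ, F)) (I.prod 𝓘(ℝ, F)) ∞ (id : TotalSpace F E' → _) p :=
    contMDiffAt_id
  rw [contMDiffAt_totalSpace] at h ⊢
  exact h

theorem contMDiff_totalEquiv_symm {EB : Type*} [NormedAddCommGroup EB] [NormedSpace ℝ EB]
    {HB : Type*} [TopologicalSpace HB] (I : ModelWithCorners ℝ EB HB) [ChartedSpace HB B]
    (e : ∀ x, E' x ≃ₗ[ℝ] E x) :
    letI := transportTopology F e
    letI := transportFibreTopology e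
    letI := transportFiberBundle F e
    ContMDiff (I.prod 𝓘(ℝ, F)) (I.prod 𝓘(ℝ, F)) ∞ (totalEquiv F e).symm := by
  letI := transportTopology F e
  letI := transportFibreTopology e
  letI := transportFiberBundle F e
  intro p
  have h : ContMDiffAt (I.prod 𝓘(ℝ, F)) (I.prod 𝓘(ℝ, F)) ∞ (id : TotalSpace F E → _) p :=
    contMDiffAt_id
  rw [contMDiffAt_totalSpace] at h ⊢
  refine ⟨h.1, ?_⟩
  have key : ∀ q : TotalSpace F E,
      (trivializationAt F E' p.proj ((totalEquiv F e).symm q)).2 =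
        (trivializationAt F E p.proj q).2 := by
    intro q
    change (trivializationAt F E p.proj ((totalEquiv F e) ((totalEquiv F e).symm q))).2 = _
    rw [Equiv.apply_symm_apply]
  exact h.2.congr_of_eventuallyEq (Filter.Eventually.of_forall key)

end Transport

section Vertical

variable {EB : Type*} [NormedAddCommGroup EB] [NormedSpace ℝ EB]
  {HB : Type*} [TopologicalSpace HB] (I : ModelWithCorners ℝ EB HB)
  {B : Type*} [TopologicalSpace B] [ChartedSpace HB B]
  (F : Type*) [NormedAddCommGroup F] [NormedSpace ℝ F]
  (V : B → Type*) [∀ x, AddCommGroup (V x)] [∀ x, Module ℝ (V x)] [∀ x, TopologicalSpace (V x)]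
  [TopologicalSpace (TotalSpace F V)] [FiberBundle F V] [VectorBundle ℝ F V]

/-- The tangent map of a map into a vector bundle, in the preferred chart. -/
theorem mfderiv_into_totalSpace
    {EN : Type*} [NormedAddCommGroup EN] [NormedSpace ℝ EN]
    {HN : Type*} [TopologicalSpace HN] (J : ModelWithCorners ℝ EN HN)
    {N : Type*} [TopologicalSpace N] [ChartedSpace HN N]
    {f : N → TotalSpace F V} {x : N} (hf : MDifferentiableAt J (I.prod 𝓘(ℝ, F)) f x) :
    (mfderiv J (I.prod 𝓘(ℝ, F)) f x : EN →L[ℝ] EB × F) =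
      ContinuousLinearMap.prod (mfderiv J I (fun y => (f y).proj) x : EN →L[ℝ] EB)
        (mfderiv J 𝓘(ℝ, F) (fun y => (trivializationAt F V (f x).proj (f y)).2) x : EN →L[ℝ] F) := by
  have h12 := (mdifferentiableAt_totalSpace I f).1 hf
  obtain ⟨h1, h2⟩ := h12
  have e1 := h1.hasMFDerivAt
  have e2 := h2.hasMFDerivAt
  apply HasMFDerivAt.mfderiv
  refine ⟨hf.continuousAt, ?_⟩
  have := (e1.2).prodMk (e2.2)
  refine this.congr_of_eventuallyEq ?_ ?_
  · have hc : ContinuousAt f x := hf.continuousAt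
    have hn : f ⁻¹' (trivializationAt F V (f x).proj).source ∈ 𝓝 x :=
      hc.preimage_mem_nhds ((trivializationAt F V (f x).proj).open_source.mem_nhds
        (FiberBundle.mem_trivializationAt_proj_source))
    have hn3 : (extChartAt J x).symm ⁻¹' (f ⁻¹' (trivializationAt F V (f x).proj).source) ∈
        𝓝[Set.range J] (extChartAt J x x) :=
      mem_nhdsWithin_of_mem_nhds (extChartAt_preimage_mem_nhds hn)
    filter_upwards [hn3] with z hz
    simp only [writtenInExtChartAt, FiberBundle.extChartAt, Function.comp]
    simp only [mfld_simps] at hz ⊢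
    rw [Trivialization.coe_fst _ (by simpa using hz)]
    rfl
  · simp only [writtenInExtChartAt, FiberBundle.extChartAt, Function.comp]
    simp [mfld_simps]
    rfl

/-- In preferred charts the tangent map of the projection is the first projection. -/
theorem mfderiv_bundleProj (p : TotalSpace F V) :
    (mfderiv (I.prod 𝓘(ℝ, F)) I (TotalSpace.proj : TotalSpace F V → B) p : EB × F →L[ℝ] EB) =
      ContinuousLinearMap.fst ℝ EB F := by
  have h : (mfderiv (I.prod 𝓘(ℝ, F)) (I.prod 𝓘(ℝ, F)) (id : TotalSpace F V → _) p :
      EB × F →L[ℝ] EB × F) = _ :=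
    mfderiv_into_totalSpace I F V (I.prod 𝓘(ℝ, F)) (f := id) (x := p) mdifferentiableAt_id
  have h2 : (mfderiv (I.prod 𝓘(ℝ, F)) (I.prod 𝓘(ℝ, F)) (id : TotalSpace F V → _) p :
    EB × F →L[ℝ] EB × F) = ContinuousLinearMap.id ℝ (EB × F) := mfderiv_id
  rw [h2] at h
  have h3 := congrArg (fun L : EB × F →L[ℝ] EB × F => (ContinuousLinearMap.fst ℝ EB F).comp L) h
  exact h3.symm

/-- The vertical subspace `ker T_p π` of `T_p E`, where `E` is the total space of `V`. -/
def vertSub (p : TotalSpace F V) : Submodule ℝ (TangentSpace (I.prod 𝓘(ℝ, F)) p) :=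
  LinearMap.ker (mfderiv (I.prod 𝓘(ℝ, F)) I (TotalSpace.proj : TotalSpace F V → B) p).toLinearMap

/-- The fibres of the vertical bundle `τ_E^V : Ver π → E`. -/
def Vert (p : TotalSpace F V) : Type _ := vertSub I F V p

instance (p : TotalSpace F V) : AddCommGroup (Vert I F V p) :=
  inferInstanceAs (AddCommGroup (vertSub I F V p))

instance (p : TotalSpace F V) : Module ℝ (Vert I F V p) :=
  inferInstanceAs (Module ℝ (vertSub I F V p))

variable {F V}

/-- The velocity at time `0` of a curve in a manifold. -/
def velocity {EP : Type*} [NormedAddCommGroup EP] [NormedSpace ℝ EP]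
    {HP : Type*} [TopologicalSpace HP] (J : ModelWithCorners ℝ EP HP)
    {P : Type*} [TopologicalSpace P] [ChartedSpace HP P] (c : ℝ → P) : TangentSpace J (c 0) :=
  mfderiv 𝓘(ℝ, ℝ) J c 0 (1 : ℝ)

theorem velocity_mem_vertSub (c : ℝ → TotalSpace F V) (hc : ∀ s, (c s).proj = (c 0).proj) :
    velocity (I.prod 𝓘(ℝ, F)) c ∈ vertSub I F V (c 0) := by
  change mfderiv (I.prod 𝓘(ℝ, F)) I (TotalSpace.proj : TotalSpace F V → B) (c 0)
    (mfderiv 𝓘(ℝ, ℝ) (I.prod 𝓘(ℝ, F)) c 0 (1 : ℝ)) = 0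
  by_cases h : MDifferentiableAt 𝓘(ℝ, ℝ) (I.prod 𝓘(ℝ, F)) c 0
  · have h1 : MDifferentiableAt (I.prod 𝓘(ℝ, F)) I (TotalSpace.proj : TotalSpace F V → B) (c 0) :=
      mdifferentiableAt_proj V
    refine (mfderiv_comp_apply (x := (0 : ℝ)) h1 h (1 : ℝ)).symm.trans ?_
    have : (TotalSpace.proj : TotalSpace F V → B) ∘ c = fun _ => (c 0).proj := funext hc
    rw [this, mfderiv_const]
    rfl
  · rw [mfderiv_zero_of_not_mdifferentiableAt h]
    exact map_zero _

/-- The velocity at time `0` of a curve contained in one fibre of `V`, as a point of the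
vertical bundle. -/
def vertVelocity (c : ℝ → TotalSpace F V) (hc : ∀ s, (c s).proj = (c 0).proj) :
    TotalSpace F (Vert I F V) :=
  ⟨c 0, ⟨velocity (I.prod 𝓘(ℝ, F)) c, velocity_mem_vertSub I c hc⟩⟩

/-- The line `s ↦ a + s b` in the fibre of `V` through `a = p`. -/
def fibreLine (p : TotalSpace F V) (b : V p.proj) (s : ℝ) : TotalSpace F V :=
  ⟨p.proj, p.2 + s • b⟩

theorem velocity_fibreLine (p : TotalSpace F V) (b : V p.proj) :
    (velocity (I.prod 𝓘(ℝ, F)) (fibreLine p b) : EB × F) =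
      (0, (trivializationAt F V p.proj).continuousLinearEquivAt ℝ p.proj
        (mem_baseSet_trivializationAt F V p.proj) b) := by
  set L := (trivializationAt F V p.proj).continuousLinearEquivAt ℝ p.proj
        (mem_baseSet_trivializationAt F V p.proj) with hL
  have hv : ∀ c : V p.proj, (trivializationAt F V p.proj ⟨p.proj, c⟩).2 = L c := fun c => rfl
  have hline : ∀ s, (trivializationAt F V p.proj (fibreLine p b s)).2 = L p.2 + s • L b := by
    intro s
    rw [fibreLine, hv, map_add, map_smul]
  have hd : HasMFDerivAt 𝓘(ℝ, ℝ) 𝓘(ℝ, F)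
      (fun s => (trivializationAt F V p.proj (fibreLine p b s)).2) (0 : ℝ)
      (ContinuousLinearMap.toSpanSingleton ℝ (L b)) := by
    rw [show (fun s => (trivializationAt F V p.proj (fibreLine p b s)).2) =
      fun s => L p.2 + s • L b from funext hline]
    apply HasFDerivAt.hasMFDerivAt
    have : HasDerivAt (fun s : ℝ => L p.2 + s • L b) ((1 : ℝ) • L b) 0 :=
      ((hasDerivAt_id (0 : ℝ)).smul_const (L b)).const_add _
    rw [one_smul] at this
    exact this.hasFDerivAt
  have hf : MDifferentiableAt 𝓘(ℝ, ℝ) (I.prod 𝓘(ℝ, F)) (fibreLine p b) 0 := by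
    rw [mdifferentiableAt_totalSpace]
    exact ⟨mdifferentiableAt_const, hd.mdifferentiableAt⟩
  have h := mfderiv_into_totalSpace I F V 𝓘(ℝ, ℝ) hf
  have h1 : (mfderiv 𝓘(ℝ, ℝ) I (fun y => (fibreLine p b y).proj) (0 : ℝ) : ℝ →L[ℝ] EB) = 0 :=
    mfderiv_const
  have h2 : (mfderiv 𝓘(ℝ, ℝ) 𝓘(ℝ, F)
      (fun y => (trivializationAt F V (fibreLine p b 0).proj (fibreLine p b y)).2) (0 : ℝ) :
      ℝ →L[ℝ] F) = ContinuousLinearMap.toSpanSingleton ℝ (L b) := hd.mfderiv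
  have h3 := congrArg (fun T : ℝ →L[ℝ] EB × F => T 1) h
  refine h3.trans ?_
  change ((mfderiv 𝓘(ℝ, ℝ) I (fun y => (fibreLine p b y).proj) (0 : ℝ) : ℝ →L[ℝ] EB) 1,
    (mfderiv 𝓘(ℝ, ℝ) 𝓘(ℝ, F)
      (fun y => (trivializationAt F V (fibreLine p b 0).proj (fibreLine p b y)).2) (0 : ℝ) :
      ℝ →L[ℝ] F) 1) = _
  rw [h1, h2]
  refine Prod.ext rfl ?_
  exact one_smul ℝ (L b)

variable (F V)

theorem velocity_fibreLine_mem (p : TotalSpace F V) (b : V p.proj) :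
    (velocity (I.prod 𝓘(ℝ, F)) (fibreLine p b) : TangentSpace (I.prod 𝓘(ℝ, F)) p) ∈
      vertSub I F V p :=
  (congrArg (fun T : EB × F →L[ℝ] EB => T (velocity (I.prod 𝓘(ℝ, F)) (fibreLine p b) : EB × F))
    (mfderiv_bundleProj I F V p)).trans (congrArg Prod.fst (velocity_fibreLine I p b))

/-- The vertical lifting map, as a map of sets. -/
def vertLiftFun (p : TotalSpace F V) (b : V p.proj) : Vert I F V p :=
  ⟨velocity (I.prod 𝓘(ℝ, F)) (fibreLine p b), velocity_fibreLine_mem I F V p b⟩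

/-- The model coordinates of a vertical vector in the preferred chart. -/
def vertCoord (p : TotalSpace F V) (z : Vert I F V p) : EB × F := z.1

theorem vertCoord_vertLiftFun (p : TotalSpace F V) (b : V p.proj) :
    vertCoord I F V p (vertLiftFun I F V p b) =
      (0, (trivializationAt F V p.proj).continuousLinearEquivAt ℝ p.proj
        (mem_baseSet_trivializationAt F V p.proj) b) := velocity_fibreLine I p b

theorem vertCoord_add (p : TotalSpace F V) (z w : Vert I F V p) :
    vertCoord I F V p (z + w) = vertCoord I F V p z + vertCoord I F V p w := rfl

theorem vertCoord_smul (p : TotalSpace F V) (r : ℝ) (z : Vert I F V p) :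
    vertCoord I F V p (r • z) = r • vertCoord I F V p z := rfl

theorem vertCoord_injective (p : TotalSpace F V) : Function.Injective (vertCoord I F V p) :=
  fun _ _ h => Subtype.ext h

theorem vertCoord_fst (p : TotalSpace F V) (z : Vert I F V p) : (vertCoord I F V p z).1 = 0 :=
  (congrArg (fun T : EB × F →L[ℝ] EB => T (vertCoord I F V p z))
    (mfderiv_bundleProj I F V p)).symm.trans z.2

/-- The vertical lifting map `ξ_π(a, b) = d/ds (a + s b)|_{s=0}`, as a linear isomorphism
from the fibre of `V` onto the vertical subspace at `a`. (The velocity lives in the tangent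
space at `a + 0 b`, which is the same point as `a`; in Mathlib the tangent space is the
same type there.) -/
def vertLift (p : TotalSpace F V) : V p.proj ≃ₗ[ℝ] Vert I F V p :=
  LinearEquiv.ofBijective
    ({ toFun := vertLiftFun I F V p
       map_add' := fun b c => vertCoord_injective I F V p <| by
        rw [vertCoord_add, vertCoord_vertLiftFun, vertCoord_vertLiftFun, vertCoord_vertLiftFun,
          map_add, Prod.mk_add_mk, add_zero]
       map_smul' := fun r b => vertCoord_injective I F V p <| by
        rw [RingHom.id_apply, vertCoord_smul, vertCoord_vertLiftFun, vertCoord_vertLiftFun,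
          map_smul, Prod.smul_mk, smul_zero] } : V p.proj →ₗ[ℝ] Vert I F V p)
    ⟨by
      intro b c h
      have h1 := congrArg (vertCoord I F V p) h
      simp only [LinearMap.coe_mk, AddHom.coe_mk] at h1
      rw [vertCoord_vertLiftFun, vertCoord_vertLiftFun] at h1
      exact ContinuousLinearEquiv.injective _ (Prod.ext_iff.1 h1).2,
     by
      intro z
      let L := (trivializationAt F V p.proj).continuousLinearEquivAt ℝ p.proj
        (mem_baseSet_trivializationAt F V p.proj)
      refine ⟨L.symm (vertCoord I F V p z).2, vertCoord_injective I F V p ?_⟩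
      refine (vertCoord_vertLiftFun I F V p _).trans (Prod.ext (vertCoord_fst I F V p z).symm ?_)
      exact L.apply_symm_apply _⟩

theorem vertLift_apply (p : TotalSpace F V) (b : V p.proj) :
    vertLift I F V p b = vertLiftFun I F V p b := rfl

/-- The projection `π : E → B` as a smooth map. -/
def projMap : ContMDiffMap (I.prod 𝓘(ℝ, F)) I (TotalSpace F V) B ∞ :=
  ⟨TotalSpace.proj, contMDiff_proj V⟩

/-- The fibres of the pullback bundle `π^*π : π^*E → E`. -/
abbrev PB : TotalSpace F V → Type _ := (projMap I F V : TotalSpace F V → B) *ᵖ V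

instance (p : TotalSpace F V) : AddCommGroup (PB I F V p) :=
  inferInstanceAs (AddCommGroup (V p.proj))

/-- The vertical lift as an isomorphism from the vertical bundle to the pullback bundle. -/
def vertEquivPB (p : TotalSpace F V) : Vert I F V p ≃ₗ[ℝ] PB I F V p :=
  (vertLift I F V p).symm

/-- The vertical bundle is a vector bundle over `E`: as a subbundle of `TE` it is isomorphic to
`π^*E` through the vertical lift, and this is how we introduce its topology and charts. -/
instance (p : TotalSpace F V) : TopologicalSpace (Vert I F V p) :=
  transportFibreTopology (vertEquivPB I F V) p

instance : TopologicalSpace (TotalSpace F (Vert I F V)) :=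
  transportTopology F (vertEquivPB I F V)

instance : FiberBundle F (Vert I F V) := transportFiberBundle F (vertEquivPB I F V)

instance : VectorBundle ℝ F (Vert I F V) := transportVectorBundle (F := F) (vertEquivPB I F V)

instance [ContMDiffVectorBundle ∞ F V I] :
    ContMDiffVectorBundle ∞ F (Vert I F V) (I.prod 𝓘(ℝ, F)) :=
  transportContMDiffVectorBundle (F := F) (I.prod 𝓘(ℝ, F)) (vertEquivPB I F V)

/-- The fibres of the vertical bundle regarded as a bundle `𝔭_V : Ver π → B`: the fibre over
`m` consists of the vertical vectors at all points `a` of the fibre of `E` over `m`. -/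
def VertM (m : B) : Type _ := Σ a : V m, Vert I F V ⟨m, a⟩

/-- `(a, b) ↦ ξ_π(a, b)` identifies the fibre of `𝔭_V` over `m` with `E_m × E_m`. -/
def vertMEquivProd (m : B) : VertM I F V m ≃ V m × V m where
  toFun z := (z.1, (vertLift I F V ⟨m, z.1⟩).symm z.2)
  invFun ab := ⟨ab.1, vertLift I F V ⟨m, ab.1⟩ ab.2⟩
  left_inv z := by
    rcases z with ⟨a, z⟩
    exact congrArg (Sigma.mk a) (LinearEquiv.apply_symm_apply _ _)
  right_inv ab := Prod.ext rfl (LinearEquiv.symm_apply_apply (vertLift I F V ⟨m, ab.1⟩) _)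

/-- The vector space structure on the fibres of `𝔭_V : Ver π → B`, given by
`ξ_π(a, b) + ξ_π(a', b') = ξ_π(a + a', b + b')` and `λ ξ_π(a, b) = ξ_π(λ a, λ b)`. -/
instance (m : B) : AddCommGroup (VertM I F V m) := (vertMEquivProd I F V m).addCommGroup

instance (m : B) : Module ℝ (VertM I F V m) := (vertMEquivProd I F V m).module ℝ

/-- The fibrewise linear isomorphism from `𝔭_V : Ver π → B` to `E ×_B E → B`. -/
def vertMEquiv (m : B) : VertM I F V m ≃ₗ[ℝ] (V ×ᵇ V) m := (vertMEquivProd I F V m).linearEquiv ℝ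

instance (m : B) : TopologicalSpace (VertM I F V m) := transportFibreTopology (vertMEquiv I F V) m

instance : TopologicalSpace (TotalSpace (F × F) (VertM I F V)) :=
  transportTopology (F × F) (vertMEquiv I F V)

instance : FiberBundle (F × F) (VertM I F V) := transportFiberBundle (F × F) (vertMEquiv I F V)

instance : VectorBundle ℝ (F × F) (VertM I F V) :=
  transportVectorBundle (F := F × F) (vertMEquiv I F V)

instance [IsManifold I ∞ B] [ContMDiffVectorBundle ∞ F V I] :
    ContMDiffVectorBundle ∞ (F × F) (VertM I F V) I :=
  transportContMDiffVectorBundle (F := F × F) I (vertMEquiv I F V)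

/-- `ξ_π : π^*E → Ver π` is smooth. -/
theorem contMDiff_vertLift :
    ContMDiff ((I.prod 𝓘(ℝ, F)).prod 𝓘(ℝ, F)) ((I.prod 𝓘(ℝ, F)).prod 𝓘(ℝ, F)) ∞
      (fun q : TotalSpace F (PB I F V) =>
        (⟨q.proj, vertLift I F V q.proj q.2⟩ : TotalSpace F (Vert I F V))) :=
  contMDiff_totalEquiv_symm (I.prod 𝓘(ℝ, F)) (vertEquivPB I F V)

/-- The vertical projection `ν_π : Ver π → E` on the fibres of `𝔭_V`. -/
def vertMSnd (m : B) : VertM I F V m →ₗ[ℝ] V m :=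
  (LinearMap.snd ℝ (V m) (V m)).comp (vertMEquiv I F V m).toLinearMap

/-- The vertical projection `ν_π : Ver π → E` is smooth. -/
theorem contMDiff_vertMSnd :
    ContMDiff (I.prod 𝓘(ℝ, F × F)) (I.prod 𝓘(ℝ, F)) ∞
      (fun q : TotalSpace (F × F) (VertM I F V) =>
        (⟨q.proj, vertMSnd I F V q.proj q.2⟩ : TotalSpace F V)) := by
  have h := contMDiff_totalEquiv (F := F × F) I (vertMEquiv I F V)
  intro q
  have h1 := (contMDiffAt_totalSpace (F := F × F)).1 (h q)
  rw [contMDiffAt_totalSpace]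
  refine ⟨h1.1, ?_⟩
  have h2 : ContMDiff 𝓘(ℝ, F × F) 𝓘(ℝ, F) ∞ (Prod.snd : F × F → F) := contDiff_snd.contMDiff
  have h3 := h2.contMDiffAt.comp q h1.2
  exact h3.congr_of_eventuallyEq (Filter.Eventually.of_forall fun x => rfl)

end Vertical

theorem contDiffOn_clm_flip {X Y Z W : Type*} [NormedAddCommGroup X] [NormedSpace ℝ X]
    [NormedAddCommGroup Y] [NormedSpace ℝ Y] [NormedAddCommGroup Z] [NormedSpace ℝ Z]
    [NormedAddCommGroup W] [NormedSpace ℝ W] {f : W → X →L[ℝ] Y →L[ℝ] Z} {s : Set W}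
    (hf : ContDiffOn ℝ ∞ f s) : ContDiffOn ℝ ∞ (fun z => (f z).flip) s := by
  have h : ContDiff ℝ ∞ (fun T : X →L[ℝ] Y →L[ℝ] Z => T.flip) :=
    IsBoundedLinearMap.contDiff (E := X →L[ℝ] Y →L[ℝ] Z) (F := Y →L[ℝ] X →L[ℝ] Z)
      ⟨⟨fun _ _ => rfl, fun _ _ => rfl⟩, 1, one_pos, fun T => by
        rw [ContinuousLinearMap.opNorm_flip, one_mul]⟩
  exact h.comp_contDiffOn hf

theorem contDiffOn_clm_conj {X Y W : Type*} [NormedAddCommGroup X] [NormedSpace ℝ X]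
    [NormedAddCommGroup Y] [NormedSpace ℝ Y] [NormedAddCommGroup W] [NormedSpace ℝ W]
    {f : W → Y →L[ℝ] Y} {g : W → X →L[ℝ] X} {s : Set W}
    (hf : ContDiffOn ℝ ∞ f s) (hg : ContDiffOn ℝ ∞ g s) :
    ContDiffOn ℝ ∞ (fun z => (ContinuousLinearMap.compL ℝ X Y Y (f z)).comp
      ((ContinuousLinearMap.compL ℝ X X Y).flip (g z))) s := by
  fun_prop

theorem contDiffOn_clm_prodMk {X Y Z W : Type*} [NormedAddCommGroup X] [NormedSpace ℝ X]
    [NormedAddCommGroup Y] [NormedSpace ℝ Y] [NormedAddCommGroup Z] [NormedSpace ℝ Z]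
    [NormedAddCommGroup W] [NormedSpace ℝ W] {f : W → X →L[ℝ] Y} {g : W → X →L[ℝ] Z} {s : Set W}
    (hf : ContDiffOn ℝ ∞ f s) (hg : ContDiffOn ℝ ∞ g s) :
    ContDiffOn ℝ ∞ (fun z => (f z).prod (g z)) s := by
  have h : ContDiffOn ℝ ∞ (fun z => (ContinuousLinearMap.inl ℝ Y Z).comp (f z) +
    (ContinuousLinearMap.inr ℝ Y Z).comp (g z)) s := by fun_prop
  exact h.congr fun z _ => by ext <;> simp

section Jets

variable {EB : Type*} [NormedAddCommGroup EB] [NormedSpace ℝ EB]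
  {HB : Type*} [TopologicalSpace HB] (I : ModelWithCorners ℝ EB HB) [I.Boundaryless]
  {B : Type*} [TopologicalSpace B] [ChartedSpace HB B] [IsManifold I ∞ B]
  (F : Type*) [NormedAddCommGroup F] [NormedSpace ℝ F]
  (V : B → Type*) [∀ x, AddCommGroup (V x)] [∀ x, Module ℝ (V x)] [∀ x, TopologicalSpace (V x)]
  [TopologicalSpace (TotalSpace F V)] [FiberBundle F V] [VectorBundle ℝ F V]
  [ContMDiffVectorBundle ∞ F V I]

/-- The local smooth sections of `V` defined near `m` (extended arbitrarily to all of `B`). -/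
def localSections (m : B) : Submodule ℝ (∀ x, V x) where
  carrier := {s | ∀ᶠ x in 𝓝 m,
    ContMDiffAt I (I.prod 𝓘(ℝ, F)) ∞ (fun y => TotalSpace.mk' F y (s y)) x}
  add_mem' hs ht := by
    filter_upwards [hs, ht] with x h1 h2 using h1.add_section h2
  zero_mem' := Filter.Eventually.of_forall fun x => contMDiff_zeroSection ℝ V x
  smul_mem' c s hs := by
    filter_upwards [hs] with x h1 using h1.const_smul_section

/-- Two sections have the same `1`-jet at `m` if they have the same value and the same tangent
map at `m`. -/
def SameJet (m : B) (s t : ∀ x, V x) : Prop :=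
  s m = t m ∧
    mfderiv I (I.prod 𝓘(ℝ, F)) (fun y => TotalSpace.mk' F y (s y)) m =
      mfderiv I (I.prod 𝓘(ℝ, F)) (fun y => TotalSpace.mk' F y (t y)) m

/-- Domain of the jet coordinates with index `i`. -/
def jetBase (i : B) : Set B := (trivializationAt F V i).baseSet ∩ (chartAt HB i).source

/-- Local representative of a section in the chart and the trivialization with index `i`. -/
def localRep (i : B) (s : ∀ x, V x) (z : EB) : F :=
  (trivializationAt F V i ⟨(extChartAt I i).symm z, s ((extChartAt I i).symm z)⟩).2

variable {F V}

theorem localRep_contDiffAt {i m : B} (hm : m ∈ jetBase (HB := HB) F V i) {s : ∀ x, V x}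
    (hs : s ∈ localSections I F V m) : ContDiffAt ℝ ∞ (localRep I F V i s) (extChartAt I i m) := by
  have h1 : ContMDiffAt I (I.prod 𝓘(ℝ, F)) ∞ (fun y => TotalSpace.mk' F y (s y)) m :=
    hs.self_of_nhds
  have h2 := ((trivializationAt F V i).contMDiffAt_section_iff hm.1).1 h1
  have hsrc : m ∈ (extChartAt I i).source := by rw [extChartAt_source]; exact hm.2
  have ht : extChartAt I i m ∈ (extChartAt I i).target := (extChartAt I i).map_source hsrc
  have h3 : ContMDiffAt 𝓘(ℝ, EB) I ∞ (extChartAt I i).symm (extChartAt I i m) :=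
    (contMDiffOn_extChartAt_symm i).contMDiffAt ((isOpen_extChartAt_target i).mem_nhds ht)
  have h4 : (extChartAt I i).symm (extChartAt I i m) = m := (extChartAt I i).left_inv hsrc
  rw [← contMDiffAt_iff_contDiffAt]
  exact ContMDiffAt.comp_of_eq (g := fun x => (trivializationAt F V i ⟨x, s x⟩).2) h2 h3 h4

theorem eventually_jetBase {i m : B} (hm : m ∈ jetBase (HB := HB) F V i) :
    ∀ᶠ z in 𝓝 (extChartAt I i m), (extChartAt I i).symm z ∈ jetBase (HB := HB) F V i ∧
      z ∈ (extChartAt I i).target := by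
  have hsrc : m ∈ (extChartAt I i).source := by rw [extChartAt_source]; exact hm.2
  have ht : extChartAt I i m ∈ (extChartAt I i).target := (extChartAt I i).map_source hsrc
  have h4 : (extChartAt I i).symm (extChartAt I i m) = m := (extChartAt I i).left_inv hsrc
  have hc : ContinuousAt (extChartAt I i).symm (extChartAt I i m) :=
    (continuousOn_extChartAt_symm i).continuousAt ((isOpen_extChartAt_target i).mem_nhds ht)
  have ho : IsOpen (jetBase (HB := HB) F V i) :=
    (trivializationAt F V i).open_baseSet.inter (chartAt HB i).open_source
  refine Filter.Eventually.and ?_ ((isOpen_extChartAt_target i).mem_nhds ht)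
  exact hc.preimage_mem_nhds (ho.mem_nhds (by rw [h4]; exact hm))

theorem localRep_eq {i : B} {z : EB} (hz : (extChartAt I i).symm z ∈ jetBase (HB := HB) F V i)
    (s : ∀ x, V x) :
    localRep I F V i s z = (trivializationAt F V i).continuousLinearEquivAt ℝ
      ((extChartAt I i).symm z) hz.1 (s ((extChartAt I i).symm z)) := rfl

theorem localRep_add {i m : B} (hm : m ∈ jetBase (HB := HB) F V i) (s t : ∀ x, V x) :
    localRep I F V i (s + t) =ᶠ[𝓝 (extChartAt I i m)] localRep I F V i s + localRep I F V i t := by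
  filter_upwards [eventually_jetBase I hm] with z hz
  rw [Pi.add_apply, localRep_eq I hz.1, localRep_eq I hz.1, localRep_eq I hz.1, Pi.add_apply,
    map_add]

theorem localRep_smul {i m : B} (hm : m ∈ jetBase (HB := HB) F V i) (c : ℝ) (s : ∀ x, V x) :
    localRep I F V i (c • s) =ᶠ[𝓝 (extChartAt I i m)] c • localRep I F V i s := by
  filter_upwards [eventually_jetBase I hm] with z hz
  rw [Pi.smul_apply, localRep_eq I hz.1, localRep_eq I hz.1, Pi.smul_apply, map_smul]

/-- The first order Taylor coefficients at `m` of a section in the coordinates with index `i`. -/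
def jetLin {i m : B} (hm : m ∈ jetBase (HB := HB) F V i) :
    localSections I F V m →ₗ[ℝ] F × (EB →L[ℝ] F) where
  toFun s := (localRep I F V i s.1 (extChartAt I i m),
    fderiv ℝ (localRep I F V i s.1) (extChartAt I i m))
  map_add' s t := by
    have h := localRep_add I hm s.1 t.1
    have hs := (localRep_contDiffAt I hm s.2).differentiableAt (by simp)
    have ht := (localRep_contDiffAt I hm t.2).differentiableAt (by simp)
    refine Prod.ext h.self_of_nhds ?_
    exact h.fderiv_eq.trans (fderiv_add hs ht)
  map_smul' c s := by
    have h := localRep_smul I hm c s.1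
    have hs := (localRep_contDiffAt I hm s.2).differentiableAt (by simp)
    refine Prod.ext h.self_of_nhds ?_
    exact h.fderiv_eq.trans (fderiv_const_smul hs c)

theorem mem_jetBase_self (m : B) : m ∈ jetBase (HB := HB) F V m :=
  ⟨mem_baseSet_trivializationAt F V m, mem_chart_source HB m⟩

theorem mfderiv_section {m : B} {s : ∀ x, V x} (hs : s ∈ localSections I F V m) :
    (mfderiv I (I.prod 𝓘(ℝ, F)) (fun y => TotalSpace.mk' F y (s y)) m : EB →L[ℝ] EB × F) =
      ContinuousLinearMap.prod (ContinuousLinearMap.id ℝ EB)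
        (fderiv ℝ (localRep I F V m s) (extChartAt I m m)) := by
  have h0 : ContMDiffAt I (I.prod 𝓘(ℝ, F)) ∞ (fun y => TotalSpace.mk' F y (s y)) m :=
    hs.self_of_nhds
  have h1 : MDifferentiableAt I (I.prod 𝓘(ℝ, F)) (fun y => TotalSpace.mk' F y (s y)) m :=
    h0.mdifferentiableAt (by simp)
  refine (mfderiv_into_totalSpace I F V I h1).trans ?_
  have h2 : (mfderiv I I (fun y => (TotalSpace.mk' F y (s y)).proj) m : EB →L[ℝ] EB) =
    ContinuousLinearMap.id ℝ EB := mfderiv_id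
  have h4 := (mdifferentiableAt_totalSpace I _).1 h1
  have h3 : (mfderiv I 𝓘(ℝ, F) (fun y =>
      (trivializationAt F V (TotalSpace.mk' F m (s m)).proj (TotalSpace.mk' F y (s y))).2) m :
        EB →L[ℝ] F) = fderiv ℝ (localRep I F V m s) (extChartAt I m m) := by
    rw [h4.2.mfderiv, ModelWithCorners.range_eq_univ, fderivWithin_univ]
    rfl
  rw [h2, h3]
  rfl

/-- Two sections have the same `1`-jet if and only if their jet coordinates agree. -/
theorem sameJet_iff {m : B} (s t : localSections I F V m) :
    SameJet I F V m s.1 t.1 ↔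
      jetLin I (mem_jetBase_self m) s = jetLin I (mem_jetBase_self m) t := by
  have h4 : (extChartAt I m).symm (extChartAt I m m) = m := extChartAt_to_inv m
  have hv : ∀ u : ∀ x, V x, localRep I F V m u (extChartAt I m m) =
      (trivializationAt F V m).continuousLinearEquivAt ℝ m
        (mem_baseSet_trivializationAt F V m) (u m) := by
    intro u
    rw [localRep, h4]
    rfl
  constructor
  · rintro ⟨h1, h2⟩
    have h3 := ((mfderiv_section I s.2).symm.trans h2).trans (mfderiv_section I t.2)
    refine Prod.ext ?_ ?_
    · change localRep I F V m s.1 (extChartAt I m m) = localRep I F V m t.1 (extChartAt I m m)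
      rw [hv, hv, h1]
    · exact congrArg (fun L => (ContinuousLinearMap.snd ℝ EB F).comp L) h3
  · intro h
    have h1 : localRep I F V m s.1 (extChartAt I m m) = localRep I F V m t.1 (extChartAt I m m) :=
      congrArg Prod.fst h
    have h2 : fderiv ℝ (localRep I F V m s.1) (extChartAt I m m) =
      fderiv ℝ (localRep I F V m t.1) (extChartAt I m m) := congrArg Prod.snd h
    rw [hv, hv] at h1
    refine ⟨ContinuousLinearEquiv.injective _ h1, ?_⟩
    refine (mfderiv_section I s.2).trans (Eq.trans ?_ (mfderiv_section I t.2).symm)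
    rw [h2]

variable (F V)

/-- The local sections with vanishing `1`-jet at `m`. -/
def zeroJets (m : B) : Submodule ℝ (localSections I F V m) where
  carrier := {s | SameJet I F V m s.1 0}
  add_mem' {s t} hs ht := by
    have h1 := (sameJet_iff I s 0).1 hs
    have h2 := (sameJet_iff I t 0).1 ht
    exact (sameJet_iff I (s + t) 0).2 (by rw [map_add, h1, h2, map_zero, add_zero])
  zero_mem' := ⟨rfl, rfl⟩
  smul_mem' c s hs := by
    have h1 := (sameJet_iff I s 0).1 hs
    exact (sameJet_iff I (c • s) 0).2 (by rw [map_smul, h1, map_zero, smul_zero])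

/-- The fibre over `m` of the first jet bundle `J^1 V → B`: local smooth sections near `m`,
modulo those with vanishing `1`-jet at `m`. In particular
`j^1 σ + j^1 η = j^1 (σ + η)` and `λ j^1 σ = j^1 (λ σ)`. -/
def J1 (m : B) : Type _ := localSections I F V m ⧸ zeroJets I F V m

instance (m : B) : AddCommGroup (J1 I F V m) :=
  inferInstanceAs (AddCommGroup (localSections I F V m ⧸ zeroJets I F V m))

instance (m : B) : Module ℝ (J1 I F V m) :=
  inferInstanceAs (Module ℝ (localSections I F V m ⧸ zeroJets I F V m))

/-- The `1`-jet at `m` as a linear map on local sections. -/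
def jetMk (m : B) : localSections I F V m →ₗ[ℝ] J1 I F V m := (zeroJets I F V m).mkQ

variable {F V}

theorem jetMk_eq_iff {m : B} (s t : localSections I F V m) :
    jetMk I F V m s = jetMk I F V m t ↔ SameJet I F V m s.1 t.1 := by
  rw [sameJet_iff, ← sub_eq_zero (a := jetLin I _ s), ← map_sub]
  refine (Submodule.Quotient.eq _).trans ?_
  have := sameJet_iff I (s - t) 0
  rw [map_zero] at this
  exact this

variable (F V) in
/-- Change of trivialization read in a chart. -/
def coordG (i j : B) (z : EB) : F →L[ℝ] F :=
  (trivializationAt F V i).coordChangeL ℝ (trivializationAt F V j) ((extChartAt I j).symm z)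

/-- Change of charts. -/
def coordT (i j : B) (z : EB) : EB := extChartAt I i ((extChartAt I j).symm z)

variable (F V) in
/-- Change of jet coordinates
`(y, A) ↦ (G y, (D G) y + G ∘ A ∘ D T)` read in a chart. -/
def coordC (i j : B) (z : EB) : (F × (EB →L[ℝ] F)) →L[ℝ] (F × (EB →L[ℝ] F)) :=
  ((coordG I F V i j z).comp (ContinuousLinearMap.fst ℝ F (EB →L[ℝ] F))).prod
    (((fderiv ℝ (coordG I F V i j) z).flip).comp
        (ContinuousLinearMap.fst ℝ F (EB →L[ℝ] F)) +
      ((ContinuousLinearMap.compL ℝ EB F F (coordG I F V i j z)).comp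
        ((ContinuousLinearMap.compL ℝ EB EB F).flip (fderiv ℝ (coordT I i j) z))).comp
        (ContinuousLinearMap.snd ℝ F (EB →L[ℝ] F)))

variable (F V) in
/-- The domain of the change of jet coordinates, read in a chart. -/
def coordDom (i j : B) : Set EB :=
  (extChartAt I j).target ∩ (extChartAt I j).symm ⁻¹'
    (jetBase (HB := HB) F V i ∩ jetBase (HB := HB) F V j)

theorem isOpen_coordDom (i j : B) : IsOpen (coordDom I F V i j) := by
  refine (continuousOn_extChartAt_symm j).isOpen_inter_preimage (isOpen_extChartAt_target j) ?_
  exact ((trivializationAt F V i).open_baseSet.inter (chartAt HB i).open_source).inter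
    ((trivializationAt F V j).open_baseSet.inter (chartAt HB j).open_source)

theorem contDiffOn_coordG (i j : B) : ContDiffOn ℝ ∞ (coordG I F V i j) (coordDom I F V i j) := by
  rw [← contMDiffOn_iff_contDiffOn]
  exact (contMDiffOn_coordChangeL (trivializationAt F V i) (trivializationAt F V j)).comp
    ((contMDiffOn_extChartAt_symm j).mono Set.inter_subset_left)
    fun z hz => ⟨hz.2.1.1, hz.2.2.1⟩

theorem contDiffOn_coordT (i j : B) : ContDiffOn ℝ ∞ (coordT I i j) (coordDom I F V i j) := by
  rw [← contMDiffOn_iff_contDiffOn]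
  exact (contMDiffOn_extChartAt (x := i)).comp
    ((contMDiffOn_extChartAt_symm j).mono Set.inter_subset_left)
    fun z hz => hz.2.1.2

theorem contDiffOn_coordC (i j : B) : ContDiffOn ℝ ∞ (coordC I F V i j) (coordDom I F V i j) := by
  have hG := contDiffOn_coordG I (F := F) (V := V) i j
  have hT := contDiffOn_coordT I (F := F) (V := V) i j
  have ho := isOpen_coordDom I (F := F) (V := V) i j
  have hG' : ContDiffOn ℝ ∞ (fderiv ℝ (coordG I F V i j)) (coordDom I F V i j) :=
    hG.fderiv_of_isOpen ho (by simp)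
  have hT' : ContDiffOn ℝ ∞ (fderiv ℝ (coordT I i j)) (coordDom I F V i j) :=
    hT.fderiv_of_isOpen ho (by simp)
  exact contDiffOn_clm_prodMk (hG.clm_comp contDiffOn_const)
    (((contDiffOn_clm_flip hG').clm_comp contDiffOn_const).add
      ((contDiffOn_clm_conj hG hT').clm_comp contDiffOn_const))

theorem mem_coordDom {i j m : B} (hi : m ∈ jetBase (HB := HB) F V i)
    (hj : m ∈ jetBase (HB := HB) F V j) : extChartAt I j m ∈ coordDom I F V i j := by
  have hsrc : m ∈ (extChartAt I j).source := by rw [extChartAt_source]; exact hj.2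
  refine ⟨(extChartAt I j).map_source hsrc, ?_⟩
  rw [Set.mem_preimage, (extChartAt I j).left_inv hsrc]
  exact ⟨hi, hj⟩

theorem localRep_change {i j : B} (s : ∀ x, V x) {z : EB} (hz : z ∈ coordDom I F V i j) :
    localRep I F V j s z = coordG I F V i j z (localRep I F V i s (coordT I i j z)) := by
  have hx := hz.2
  set x := (extChartAt I j).symm z with hxdef
  have hsrc : x ∈ (extChartAt I i).source := by rw [extChartAt_source]; exact hx.1.2
  have h1 : (extChartAt I i).symm (coordT I i j z) = x := (extChartAt I i).left_inv hsrc
  have h2 : localRep I F V i s (coordT I i j z) = (trivializationAt F V i ⟨x, s x⟩).2 := by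
    rw [localRep, h1]
  have h3 : localRep I F V j s z = (trivializationAt F V j ⟨x, s x⟩).2 := rfl
  have h4 : coordG I F V i j z = (trivializationAt F V i).coordChangeL ℝ
    (trivializationAt F V j) x := rfl
  rw [h2, h3, h4]
  have h5 := Trivialization.coordChangeL_apply (R := ℝ) (trivializationAt F V i)
    (trivializationAt F V j) (b := x) ⟨hx.1.1, hx.2.1⟩ (trivializationAt F V i ⟨x, s x⟩).2
  refine Eq.trans ?_ h5.symm
  rw [Trivialization.symm_apply_apply_mk _ hx.1.1]

/-- Transformation of jet coordinates. -/
theorem jetLin_change {i j m : B} (hi : m ∈ jetBase (HB := HB) F V i)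
    (hj : m ∈ jetBase (HB := HB) F V j) (s : localSections I F V m) :
    jetLin I hj s = coordC I F V i j (extChartAt I j m) (jetLin I hi s) := by
  have hz := mem_coordDom I hi hj
  have ho := (isOpen_coordDom I (F := F) (V := V) i j).mem_nhds hz
  have hG : DifferentiableAt ℝ (coordG I F V i j) (extChartAt I j m) :=
    ((contDiffOn_coordG I i j).contDiffAt ho).differentiableAt (by simp)
  have hT : DifferentiableAt ℝ (coordT I i j) (extChartAt I j m) :=
    ((contDiffOn_coordT I (F := F) (V := V) i j).contDiffAt ho).differentiableAt (by simp)
  have hsrc : m ∈ (extChartAt I j).source := by rw [extChartAt_source]; exact hj.2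
  have hTm : coordT I i j (extChartAt I j m) = extChartAt I i m := by
    rw [coordT, (extChartAt I j).left_inv hsrc]
  have hr : DifferentiableAt ℝ (localRep I F V i s.1) (coordT I i j (extChartAt I j m)) := by
    rw [hTm]
    exact (localRep_contDiffAt I hi s.2).differentiableAt (by simp)
  have hev : localRep I F V j s.1 =ᶠ[𝓝 (extChartAt I j m)]
      fun z => coordG I F V i j z (localRep I F V i s.1 (coordT I i j z)) := by
    filter_upwards [ho] with z hz using localRep_change I s.1 hz
  have hd := (hG.hasFDerivAt.clm_apply (hr.hasFDerivAt.comp _ hT.hasFDerivAt)).fderiv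
  refine Prod.ext ?_ ?_
  · refine hev.self_of_nhds.trans ?_
    change coordG I F V i j _ (localRep I F V i s.1 (coordT I i j (extChartAt I j m))) = _
    rw [hTm]
    rfl
  · refine hev.fderiv_eq.trans (hd.trans ?_)
    rw [Function.comp_apply, hTm, add_comm]
    rfl

theorem ker_jetLin {i m : B} (hi : m ∈ jetBase (HB := HB) F V i) :
    zeroJets I F V m = LinearMap.ker (jetLin I hi) := by
  ext s
  have hm := mem_jetBase_self (HB := HB) (F := F) (V := V) m
  have h0 : s ∈ zeroJets I F V m ↔ jetLin I hm s = 0 := by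
    refine (sameJet_iff I s 0).trans ?_
    rw [map_zero]
  rw [h0, LinearMap.mem_ker]
  constructor
  · intro h
    rw [jetLin_change I hm hi, h, map_zero]
  · intro h
    rw [jetLin_change I hi hm, h, map_zero]

/-- The section with affine local representative. -/
def affineSection (i m : B) (yA : F × (EB →L[ℝ] F)) (x : B) : V x :=
  (trivializationAt F V i).symm x (yA.1 + yA.2 (extChartAt I i x - extChartAt I i m))

theorem affineSection_mem {i m : B} (hi : m ∈ jetBase (HB := HB) F V i)
    (yA : F × (EB →L[ℝ] F)) : affineSection I i m yA ∈ localSections I F V m := by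
  have ho : IsOpen (jetBase (HB := HB) F V i) :=
    (trivializationAt F V i).open_baseSet.inter (chartAt HB i).open_source
  change ∀ᶠ x in 𝓝 m, ContMDiffAt I (I.prod 𝓘(ℝ, F)) ∞
    (fun y => TotalSpace.mk' F y (affineSection I i m yA y)) x
  filter_upwards [ho.mem_nhds hi] with x hx
  rw [(trivializationAt F V i).contMDiffAt_section_iff hx.1]
  have h1 : ContMDiffAt I 𝓘(ℝ, EB) ∞ (extChartAt I i) x := contMDiffAt_extChartAt' hx.2
  have h2 : ContDiff ℝ ∞ (fun z : EB => yA.1 + yA.2 (z - extChartAt I i m)) := by fun_prop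
  have h3 := (h2.contMDiff.contMDiffAt (x := extChartAt I i x)).comp x h1
  refine h3.congr_of_eventuallyEq ?_
  filter_upwards [(trivializationAt F V i).open_baseSet.mem_nhds hx.1] with y hy
  rw [affineSection, Trivialization.apply_mk_symm _ hy]
  rfl

theorem jetLin_affineSection {i m : B} (hi : m ∈ jetBase (HB := HB) F V i)
    (yA : F × (EB →L[ℝ] F)) :
    jetLin I hi ⟨affineSection I i m yA, affineSection_mem I hi yA⟩ = yA := by
  have hev : localRep I F V i (affineSection I i m yA) =ᶠ[𝓝 (extChartAt I i m)]
      fun z => yA.1 + yA.2 (z - extChartAt I i m) := by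
    filter_upwards [eventually_jetBase I hi] with z hz
    rw [localRep, affineSection, Trivialization.apply_mk_symm _ hz.1.1,
      (extChartAt I i).right_inv hz.2]
  have hd : HasFDerivAt (fun z => yA.1 + yA.2 (z - extChartAt I i m)) yA.2 (extChartAt I i m) :=
    (yA.2.hasFDerivAt.comp (extChartAt I i m)
      ((hasFDerivAt_id (extChartAt I i m)).sub_const (extChartAt I i m))).const_add yA.1
  refine Prod.ext ?_ ?_
  · refine hev.self_of_nhds.trans ?_
    simp
  · exact hev.fderiv_eq.trans hd.fderiv

/-- Jet coordinates on a fibre of `J^1 V`. -/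
def jetEquiv {i m : B} (hi : m ∈ jetBase (HB := HB) F V i) :
    J1 I F V m ≃ₗ[ℝ] F × (EB →L[ℝ] F) :=
  (Submodule.quotEquivOfEq _ _ (ker_jetLin I hi)).trans
    ((jetLin I hi).quotKerEquivOfSurjective fun yA => ⟨_, jetLin_affineSection I hi yA⟩)

theorem jetEquiv_jetMk {i m : B} (hi : m ∈ jetBase (HB := HB) F V i) (s : localSections I F V m) :
    jetEquiv I hi (jetMk I F V m s) = jetLin I hi s := rfl

theorem jetMk_surjective (m : B) : Function.Surjective (jetMk I F V m) :=
  Submodule.mkQ_surjective _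

theorem jetEquiv_change {i j m : B} (hi : m ∈ jetBase (HB := HB) F V i)
    (hj : m ∈ jetBase (HB := HB) F V j) (ζ : J1 I F V m) :
    jetEquiv I hj ζ = coordC I F V i j (extChartAt I j m) (jetEquiv I hi ζ) := by
  obtain ⟨s, rfl⟩ := jetMk_surjective I m ζ
  exact jetLin_change I hi hj s

variable (F V)

/-- The vector bundle with the transition functions of jet coordinates. -/
def jetCore : VectorBundleCore ℝ B (F × (EB →L[ℝ] F)) B where
  baseSet := jetBase (HB := HB) F V
  isOpen_baseSet i := (trivializationAt F V i).open_baseSet.inter (chartAt HB i).open_source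
  indexAt m := m
  mem_baseSet_at m := mem_jetBase_self m
  coordChange i j m := coordC I F V i j (extChartAt I j m)
  coordChange_self i m hm v := by
    obtain ⟨ζ, rfl⟩ := (jetEquiv I hm).surjective v
    exact (jetEquiv_change I hm hm ζ).symm
  continuousOn_coordChange i j := by
    refine (contDiffOn_coordC I (F := F) (V := V) i j).continuousOn.comp
      ((continuousOn_extChartAt j).mono ?_) fun m hm => mem_coordDom I hm.1 hm.2
    intro m hm
    rw [extChartAt_source]
    exact hm.2.2
  coordChange_comp i j k m hm v := by
    obtain ⟨ζ, rfl⟩ := (jetEquiv I hm.1.1).surjective v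
    rw [← jetEquiv_change I hm.1.1 hm.1.2, ← jetEquiv_change I hm.1.2 hm.2,
      ← jetEquiv_change I hm.1.1 hm.2]

instance : (jetCore I F V).IsContMDiff I ∞ where
  contMDiffOn_coordChange i j := by
    refine (contDiffOn_coordC I (F := F) (V := V) i j).contMDiffOn.comp
      ((contMDiffOn_extChartAt (x := j)).mono fun m hm => hm.2.2)
      fun m hm => mem_coordDom I hm.1 hm.2

/-- Jet coordinates with index `m` over the point `m`. -/
def jetCoreEquiv (m : B) : J1 I F V m ≃ₗ[ℝ] (jetCore I F V).Fiber m :=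
  jetEquiv I (mem_jetBase_self (HB := HB) (F := F) (V := V) m)

instance (m : B) : TopologicalSpace (J1 I F V m) := transportFibreTopology (jetCoreEquiv I F V) m

/-- The topology and the local trivializations of `J^1 V → B` come from jet coordinates. -/
instance : TopologicalSpace (TotalSpace (F × (EB →L[ℝ] F)) (J1 I F V)) :=
  transportTopology (F × (EB →L[ℝ] F)) (jetCoreEquiv I F V)

instance : FiberBundle (F × (EB →L[ℝ] F)) (J1 I F V) := transportFiberBundle _ (jetCoreEquiv I F V)

instance : VectorBundle ℝ (F × (EB →L[ℝ] F)) (J1 I F V) :=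
  transportVectorBundle (F := F × (EB →L[ℝ] F)) (jetCoreEquiv I F V)

instance : ContMDiffVectorBundle ∞ (F × (EB →L[ℝ] F)) (J1 I F V) I :=
  transportContMDiffVectorBundle (F := F × (EB →L[ℝ] F)) I (jetCoreEquiv I F V)

/-- In the preferred trivialization of `J^1 V` around `i`, jets have the expected coordinates. -/
theorem trivializationAt_J1 (i m : B) (hm : m ∈ jetBase (HB := HB) F V i) (ζ : J1 I F V m) :
    (trivializationAt (F × (EB →L[ℝ] F)) (J1 I F V) i ⟨m, ζ⟩).2 = jetEquiv I hm ζ :=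
  (jetEquiv_change I (mem_jetBase_self m) hm ζ).symm

end Jets

section JetMaps

variable {EB : Type*} [NormedAddCommGroup EB] [NormedSpace ℝ EB]
  {HB : Type*} [TopologicalSpace HB] (I : ModelWithCorners ℝ EB HB) [I.Boundaryless]
  {B : Type*} [TopologicalSpace B] [ChartedSpace HB B] [IsManifold I ∞ B]
  (F : Type*) [NormedAddCommGroup F] [NormedSpace ℝ F]
  (V : B → Type*) [∀ x, AddCommGroup (V x)] [∀ x, Module ℝ (V x)] [∀ x, TopologicalSpace (V x)]
  [TopologicalSpace (TotalSpace F V)] [FiberBundle F V] [VectorBundle ℝ F V]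
  [ContMDiffVectorBundle ∞ F V I]

open Classical in
/-- The `1`-jet `j^1_m s` of a local section `s` (and `0` if `s` is not smooth near `m`). -/
def jet1 (m : B) (s : ∀ x, V x) : J1 I F V m :=
  if h : s ∈ localSections I F V m then jetMk I F V m ⟨s, h⟩ else 0

/-- The target projection `j^1_m s ↦ s m`. -/
def target (m : B) : J1 I F V m →ₗ[ℝ] V m :=
  (zeroJets I F V m).liftQ ((LinearMap.proj m).comp (localSections I F V m).subtype)
    fun _ hs => hs.1

theorem target_jetMk (m : B) (s : localSections I F V m) :
    target I F V m (jetMk I F V m s) = s.1 m := rfl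

/-- A `1`-jet `j^1_m s` regarded as the linear map `T_m s : T_m B → T_{s m} E`. -/
def jetMap (m : B) (j : J1 I F V m) :
    TangentSpace I m →L[ℝ]
      TangentSpace (I.prod 𝓘(ℝ, F)) (⟨m, target I F V m j⟩ : TotalSpace F V) :=
  mfderiv I (I.prod 𝓘(ℝ, F))
    (fun y => TotalSpace.mk' F y ((Function.surjInv (jetMk_surjective I m) j).1 y)) m

theorem jetMap_jetMk (m : B) (s : localSections I F V m) :
    jetMap I F V m (jetMk I F V m s) =
      mfderiv I (I.prod 𝓘(ℝ, F)) (fun y => TotalSpace.mk' F y (s.1 y)) m :=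
  ((jetMk_eq_iff I _ s).1 (Function.surjInv_eq (jetMk_surjective I m) (jetMk I F V m s))).2

/-- A connection on the vector bundle `V`, as a smooth section of the target projection
`J^1 V → E`, where `E` is the total space of `V`. -/
structure Connection where
  /-- The `1`-jet at a point of `E`. -/
  toFun : ∀ p : TotalSpace F V, J1 I F V p.proj
  target_toFun : ∀ p, target I F V p.proj (toFun p) = p.2
  contMDiff_toFun : ContMDiff (I.prod 𝓘(ℝ, F)) (I.prod 𝓘(ℝ, F × (EB →L[ℝ] F))) ∞
    (fun p => (⟨p.proj, toFun p⟩ : TotalSpace (F × (EB →L[ℝ] F)) (J1 I F V)))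

variable {I F V} in
/-- A connection is linear if it is a morphism of vector bundles `E → J^1 V` over the identity. -/
def Connection.IsLinear (h : Connection I F V) : Prop :=
  ∀ m : B, ∃ L : V m →L[ℝ] J1 I F V m, ∀ b : V m, h.toFun ⟨m, b⟩ = L b

theorem sameJet_zero_iff {m : B} (s : localSections I F V m) :
    SameJet I F V m s.1 0 ↔ s.1 m = 0 ∧
      (mfderiv I 𝓘(ℝ, F) (fun y => (trivializationAt F V m ⟨y, s.1 y⟩).2) m : EB →L[ℝ] F) = 0 := by
  have hd : ∀ t : localSections I F V m,
      (mfderiv I 𝓘(ℝ, F) (fun y => (trivializationAt F V m ⟨y, t.1 y⟩).2) m : EB →L[ℝ] F) =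
        fderiv ℝ (localRep I F V m t.1) (extChartAt I m m) := by
    intro t
    have h0 : ContMDiffAt I (I.prod 𝓘(ℝ, F)) ∞ (fun y => TotalSpace.mk' F y (t.1 y)) m :=
      t.2.self_of_nhds
    have h4 := (mdifferentiableAt_totalSpace I _).1 (h0.mdifferentiableAt (by simp))
    refine h4.2.mfderiv.trans ?_
    rw [ModelWithCorners.range_eq_univ, fderivWithin_univ]
    rfl
  have h4 : (extChartAt I m).symm (extChartAt I m m) = m := extChartAt_to_inv m
  have hv : ∀ u : ∀ x, V x, localRep I F V m u (extChartAt I m m) =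
      (trivializationAt F V m).continuousLinearEquivAt ℝ m
        (mem_baseSet_trivializationAt F V m) (u m) := by
    intro u
    rw [localRep, h4]
    rfl
  refine (sameJet_iff I s 0).trans ?_
  rw [map_zero, hd]
  constructor
  · intro h
    have h1 : localRep I F V m s.1 (extChartAt I m m) = 0 := congrArg Prod.fst h
    rw [hv] at h1
    exact ⟨(ContinuousLinearEquiv.map_eq_zero_iff _).1 h1, congrArg Prod.snd h⟩
  · rintro ⟨h1, h2⟩
    refine Prod.ext ?_ h2
    refine (hv s.1).trans ?_
    rw [h1, map_zero]
    rfl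

section Prolongation

variable {F V}
variable {F' : Type*} [NormedAddCommGroup F'] [NormedSpace ℝ F']
  {W : B → Type*} [∀ x, AddCommGroup (W x)] [∀ x, Module ℝ (W x)] [∀ x, TopologicalSpace (W x)]
  [TopologicalSpace (TotalSpace F' W)] [FiberBundle F' W] [VectorBundle ℝ F' W]
  [ContMDiffVectorBundle ∞ F' W I]

/-- Composition of local sections with a fibrewise linear bundle map `ψ` over the identity. -/
def sectionMap (ψ : ∀ x, V x →ₗ[ℝ] W x)
    (hψ : ContMDiff (I.prod 𝓘(ℝ, F)) (I.prod 𝓘(ℝ, F')) ∞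
      (fun q : TotalSpace F V => (⟨q.proj, ψ q.proj q.2⟩ : TotalSpace F' W))) (m : B) :
    localSections I F V m →ₗ[ℝ] localSections I F' W m where
  toFun s := ⟨fun x => ψ x (s.1 x), by
    have hs := s.2
    change ∀ᶠ x in 𝓝 m, ContMDiffAt I (I.prod 𝓘(ℝ, F')) ∞
      (fun y => TotalSpace.mk' F' y (ψ y (s.1 y))) x
    filter_upwards [show ∀ᶠ x in 𝓝 m, ContMDiffAt I (I.prod 𝓘(ℝ, F)) ∞
      (fun y => TotalSpace.mk' F y (s.1 y)) x from hs] with x hx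
    exact (hψ.contMDiffAt (x := TotalSpace.mk' F x (s.1 x))).comp x hx⟩
  map_add' s t := Subtype.ext (funext fun x => map_add (ψ x) (s.1 x) (t.1 x))
  map_smul' c s := Subtype.ext (funext fun x => map_smul (ψ x) c (s.1 x))

/-- The prolongation `j^1 ψ : J^1 V → J^1 W`, `j^1_m s ↦ j^1_m (ψ ∘ s)`, of a fibrewise linear
bundle map `ψ` over the identity. -/
def jetProlong (ψ : ∀ x, V x →ₗ[ℝ] W x)
    (hψ : ContMDiff (I.prod 𝓘(ℝ, F)) (I.prod 𝓘(ℝ, F')) ∞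
      (fun q : TotalSpace F V => (⟨q.proj, ψ q.proj q.2⟩ : TotalSpace F' W))) (m : B) :
    J1 I F V m →ₗ[ℝ] J1 I F' W m :=
  (zeroJets I F V m).mapQ (zeroJets I F' W m) (sectionMap I ψ hψ m) (by
    intro s hs
    have hs' : SameJet I F V m s.1 0 := hs
    have hcomp : ∀ t : localSections I F V m,
        (mfderiv I (I.prod 𝓘(ℝ, F')) (fun y => TotalSpace.mk' F' y (ψ y (t.1 y))) m :
          EB →L[ℝ] EB × F') =
        (mfderiv (I.prod 𝓘(ℝ, F)) (I.prod 𝓘(ℝ, F'))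
          (fun q : TotalSpace F V => (⟨q.proj, ψ q.proj q.2⟩ : TotalSpace F' W))
            (TotalSpace.mk' F m (t.1 m)) : EB × F →L[ℝ] EB × F').comp
          (mfderiv I (I.prod 𝓘(ℝ, F)) (fun y => TotalSpace.mk' F y (t.1 y)) m :
            EB →L[ℝ] EB × F) := by
      intro t
      have h0 : ContMDiffAt I (I.prod 𝓘(ℝ, F)) ∞ (fun y => TotalSpace.mk' F y (t.1 y)) m :=
        t.2.self_of_nhds
      exact mfderiv_comp m
        ((hψ.contMDiffAt (x := TotalSpace.mk' F m (t.1 m))).mdifferentiableAt (by simp))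
        (h0.mdifferentiableAt (by simp))
    have h1 := hcomp s
    have h2 := hcomp 0
    have hm : s.1 m = (0 : ∀ x, V x) m := hs'.1
    have e2 := hs'.2
    have e3 : (fun y => TotalSpace.mk' F' y (ψ y ((0 : localSections I F V m).1 y))) =
        fun y => TotalSpace.mk' F' y ((0 : ∀ x, W x) y) :=
      funext fun y => congrArg (TotalSpace.mk' F' y) (map_zero (ψ y))
    refine ⟨?_, ?_⟩
    · change ψ m (s.1 m) = 0
      rw [hm]
      exact map_zero _
    · change (mfderiv I (I.prod 𝓘(ℝ, F')) (fun y => TotalSpace.mk' F' y (ψ y (s.1 y))) m :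
          EB →L[ℝ] EB × F') = _
      rw [h1]
      rw [e3] at h2
      refine Eq.trans ?_ h2.symm
      change ContinuousLinearMap.comp _ _ = ContinuousLinearMap.comp _ _
      congr 1
      rw [hm]
      rfl)

theorem jetProlong_jetMk (ψ : ∀ x, V x →ₗ[ℝ] W x)
    (hψ : ContMDiff (I.prod 𝓘(ℝ, F)) (I.prod 𝓘(ℝ, F')) ∞
      (fun q : TotalSpace F V => (⟨q.proj, ψ q.proj q.2⟩ : TotalSpace F' W))) (m : B)
    (s : localSections I F V m) :
    jetProlong I ψ hψ m (jetMk I F V m s) = jetMk I F' W m (sectionMap I ψ hψ m s) := rfl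

end Prolongation

/-- The map `ι` from local sections of `V` to local sections of `π^*V → E`,
`ι(s)(a) = (a, s (π a))`. -/
def iotaSec (p : TotalSpace F V) :
    localSections I F V p.proj →ₗ[ℝ] localSections (I.prod 𝓘(ℝ, F)) F (PB I F V) p where
  toFun s := ⟨fun a => s.1 a.proj, by
    have hs : ∀ᶠ x in 𝓝 p.proj, ContMDiffAt I (I.prod 𝓘(ℝ, F)) ∞
      (fun y => TotalSpace.mk' F y (s.1 y)) x := s.2
    have hc : ContinuousAt (TotalSpace.proj : TotalSpace F V → B) p :=
      (FiberBundle.continuous_proj F V).continuousAt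
    change ∀ᶠ a in 𝓝 p, ContMDiffAt (I.prod 𝓘(ℝ, F)) ((I.prod 𝓘(ℝ, F)).prod 𝓘(ℝ, F)) ∞
      (fun y : TotalSpace F V => (⟨y, s.1 y.proj⟩ : TotalSpace F (PB I F V))) a
    filter_upwards [hc.eventually hs] with a ha
    rw [contMDiffAt_totalSpace] at ha ⊢
    exact ⟨contMDiffAt_id, ha.2.comp a (contMDiffAt_proj V)⟩⟩
  map_add' _ _ := rfl
  map_smul' _ _ := rfl

/-- The canonical immersion `Υ(a, j^1_m s) = j^1_a (ι s)`, with `m = π a`. -/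
def upsilon (p : TotalSpace F V) :
    J1 I F V p.proj →ₗ[ℝ] J1 (I.prod 𝓘(ℝ, F)) F (PB I F V) p :=
  (zeroJets I F V p.proj).mapQ (zeroJets (I.prod 𝓘(ℝ, F)) F (PB I F V) p) (iotaSec I F V p) (by
    intro s hs
    have h1 := (sameJet_zero_iff I F V s).1 hs
    refine (sameJet_zero_iff (I.prod 𝓘(ℝ, F)) F (PB I F V) (iotaSec I F V p s)).2 ⟨h1.1, ?_⟩
    have h0 : ContMDiffAt I (I.prod 𝓘(ℝ, F)) ∞ (fun y => TotalSpace.mk' F y (s.1 y)) p.proj :=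
      s.2.self_of_nhds
    have h2 : MDifferentiableAt I 𝓘(ℝ, F)
        (fun y => (trivializationAt F V p.proj ⟨y, s.1 y⟩).2) p.proj :=
      ((mdifferentiableAt_totalSpace I _).1 (h0.mdifferentiableAt (by simp))).2
    have h3 := mfderiv_comp p h2 (mdifferentiableAt_proj V (p := p) (IB := I))
    refine h3.trans ?_
    have h4 := congrArg (fun L : EB →L[ℝ] F => L.comp
      (mfderiv (I.prod 𝓘(ℝ, F)) I (TotalSpace.proj : TotalSpace F V → B) p :
        EB × F →L[ℝ] EB)) h1.2
    exact h4.trans (ContinuousLinearMap.zero_comp _))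

theorem upsilon_jetMk (p : TotalSpace F V) (s : localSections I F V p.proj) :
    upsilon I F V p (jetMk I F V p.proj s) =
      jetMk (I.prod 𝓘(ℝ, F)) F (PB I F V) p (iotaSec I F V p s) := rfl

end JetMaps

section FibreDerivative

variable {EB : Type*} [NormedAddCommGroup EB] [NormedSpace ℝ EB]
  {HB : Type*} [TopologicalSpace HB] (I : ModelWithCorners ℝ EB HB)
  {B : Type*} [TopologicalSpace B] [ChartedSpace HB B]
  {F : Type*} [NormedAddCommGroup F] [NormedSpace ℝ F]
  {V : B → Type*} [∀ x, AddCommGroup (V x)] [∀ x, Module ℝ (V x)] [∀ x, TopologicalSpace (V x)]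
  [TopologicalSpace (TotalSpace F V)] [FiberBundle F V] [VectorBundle ℝ F V]
  {F' : Type*} [NormedAddCommGroup F'] [NormedSpace ℝ F']
  {W : B → Type*} [∀ x, AddCommGroup (W x)] [∀ x, Module ℝ (W x)] [∀ x, TopologicalSpace (W x)]
  [TopologicalSpace (TotalSpace F' W)] [FiberBundle F' W] [VectorBundle ℝ F' W]

/-- The map of total spaces, fibred over the identity, given by (possibly nonlinear) maps of the
fibres. -/
def fibredMap (F' : Type*) (φ : ∀ p : TotalSpace F V, W p.proj) (p : TotalSpace F V) :
    TotalSpace F' W := ⟨p.proj, φ p⟩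

theorem mfderiv_fibredMap_mem (φ : ∀ p : TotalSpace F V, W p.proj) (p : TotalSpace F V)
    (z : Vert I F V p) :
    mfderiv (I.prod 𝓘(ℝ, F)) (I.prod 𝓘(ℝ, F')) (fibredMap F' φ) p z.1 ∈
      vertSub I F' W (fibredMap F' φ p) := by
  change mfderiv (I.prod 𝓘(ℝ, F')) I (TotalSpace.proj : TotalSpace F' W → B) (fibredMap F' φ p)
    (mfderiv (I.prod 𝓘(ℝ, F)) (I.prod 𝓘(ℝ, F')) (fibredMap F' φ) p z.1) = 0
  by_cases h : MDifferentiableAt (I.prod 𝓘(ℝ, F)) (I.prod 𝓘(ℝ, F')) (fibredMap F' φ) p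
  · have h1 : MDifferentiableAt (I.prod 𝓘(ℝ, F')) I (TotalSpace.proj : TotalSpace F' W → B)
      (fibredMap F' φ p) := mdifferentiableAt_proj W
    exact (mfderiv_comp_apply (x := p) h1 h z.1).symm.trans z.2
  · rw [mfderiv_zero_of_not_mdifferentiableAt h]
    exact map_zero _

/-- The tangent map of a fibred map, restricted to vertical vectors. -/
def tangentVert (φ : ∀ p : TotalSpace F V, W p.proj) (p : TotalSpace F V) (z : Vert I F V p) :
    Vert I F' W (fibredMap F' φ p) :=
  ⟨mfderiv (I.prod 𝓘(ℝ, F)) (I.prod 𝓘(ℝ, F')) (fibredMap F' φ) p z.1,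
    mfderiv_fibredMap_mem I φ p z⟩

/-- The fibre derivative `𝓕φ : π^*V → τ^*W`, `𝓕φ(a, b) = (φ a, ν_τ (Tφ (ξ_π (a, b))))`, of a map
`φ` fibred over the identity from the bundle `π` of the `V x` to the bundle `τ` of the `W x`. -/
def fibreDeriv (φ : ∀ p : TotalSpace F V, W p.proj) (q : TotalSpace F (PB I F V)) :
    TotalSpace F' (PB I F' W) :=
  ⟨fibredMap F' φ q.proj, (vertLift I F' W (fibredMap F' φ q.proj)).symm
    (tangentVert I φ q.proj (vertLift I F V q.proj q.2))⟩

end FibreDerivative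

section Linearization

variable {EB : Type*} [NormedAddCommGroup EB] [NormedSpace ℝ EB]
  {HB : Type*} [TopologicalSpace HB] (I : ModelWithCorners ℝ EB HB) [I.Boundaryless]
  {B : Type*} [TopologicalSpace B] [ChartedSpace HB B] [IsManifold I ∞ B]
  (F : Type*) [NormedAddCommGroup F] [NormedSpace ℝ F]
  (V : B → Type*) [∀ x, AddCommGroup (V x)] [∀ x, Module ℝ (V x)] [∀ x, TopologicalSpace (V x)]
  [TopologicalSpace (TotalSpace F V)] [FiberBundle F V] [VectorBundle ℝ F V]
  [ContMDiffVectorBundle ∞ F V I]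

/-- The map `Ψ : π_1^*(J^1 π) → J^1(π^*π)`, `Ψ(j^1_m σ, j^1_m η) = Υ(σ m, j^1_m η)`. -/
def psi (q : TotalSpace (F × (EB →L[ℝ] F)) (PB I (F × (EB →L[ℝ] F)) (J1 I F V))) :
    TotalSpace (F × (EB × F →L[ℝ] F)) (J1 (I.prod 𝓘(ℝ, F)) F (PB I F V)) :=
  ⟨⟨q.proj.proj, target I F V q.proj.proj q.proj.2⟩,
    upsilon I F V ⟨q.proj.proj, target I F V q.proj.proj q.proj.2⟩ q.2⟩

/-- The map `ξ_π : π^*E → Ver π` on total spaces. -/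
def xi (q : TotalSpace F (PB I F V)) : TotalSpace F (Vert I F V) :=
  ⟨q.proj, vertLift I F V q.proj q.2⟩

/-- The prolongation `j^1 ξ_π : J^1(π^*π) → J^1 τ_E^V` of `ξ_π` fibred over the identity of `E`. -/
def jetXi (q : TotalSpace (F × (EB × F →L[ℝ] F)) (J1 (I.prod 𝓘(ℝ, F)) F (PB I F V))) :
    TotalSpace (F × (EB × F →L[ℝ] F)) (J1 (I.prod 𝓘(ℝ, F)) F (Vert I F V)) :=
  ⟨q.proj, jetProlong (I.prod 𝓘(ℝ, F)) (V := PB I F V) (W := Vert I F V)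
    (fun a => (vertLift I F V a).toLinearMap) (contMDiff_vertLift I F V) q.proj q.2⟩

/-- The map `ι_V` from local sections of `𝔭_V : Ver π → B` to local sections of
`τ_E^V : Ver π → E`, `ι_V(Z)(a) = ξ_π(a, ν_π(Z(π a)))`. -/
def iotaVertSec (p : TotalSpace F V) : localSections I (F × F) (VertM I F V) p.proj →ₗ[ℝ]
    localSections (I.prod 𝓘(ℝ, F)) F (Vert I F V) p :=
  (sectionMap (I.prod 𝓘(ℝ, F)) (V := PB I F V) (W := Vert I F V)
      (fun a => (vertLift I F V a).toLinearMap) (contMDiff_vertLift I F V) p).comp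
    ((iotaSec I F V p).comp
      (sectionMap I (vertMSnd I F V) (contMDiff_vertMSnd I F V) p.proj))

theorem iotaVertSec_apply (p : TotalSpace F V) (Z : localSections I (F × F) (VertM I F V) p.proj)
    (a : TotalSpace F V) :
    (iotaVertSec I F V p Z).1 a = vertLift I F V a (vertMSnd I F V a.proj (Z.1 a.proj)) := rfl

/-- The map `j^1_m Z ↦ j^1_p(ι_V Z)`, where `p` is a point of `E` over `m`. -/
def iotaVertJet (p : TotalSpace F V) : J1 I (F × F) (VertM I F V) p.proj →ₗ[ℝ]
    J1 (I.prod 𝓘(ℝ, F)) F (Vert I F V) p :=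
  (jetProlong (I.prod 𝓘(ℝ, F)) (V := PB I F V) (W := Vert I F V)
      (fun a => (vertLift I F V a).toLinearMap) (contMDiff_vertLift I F V) p).comp
    ((upsilon I F V p).comp
      (jetProlong I (vertMSnd I F V) (contMDiff_vertMSnd I F V) p.proj))

theorem iotaVertJet_jetMk (p : TotalSpace F V)
    (Z : localSections I (F × F) (VertM I F V) p.proj) :
    iotaVertJet I F V p (jetMk I (F × F) (VertM I F V) p.proj Z) =
      jetMk (I.prod 𝓘(ℝ, F)) F (Vert I F V) p (iotaVertSec I F V p Z) := rfl

/-- The map `Ψ_V : J^1 𝔭_V → J^1 τ_E^V`, `Ψ_V(j^1_m Z) = j^1_a(ι_V Z)`, where `a` is the point of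
`E` at which the vertical vector `Z m` is attached. -/
def psiVert (ϑ : TotalSpace ((F × F) × (EB →L[ℝ] F × F)) (J1 I (F × F) (VertM I F V))) :
    TotalSpace (F × (EB × F →L[ℝ] F)) (J1 (I.prod 𝓘(ℝ, F)) F (Vert I F V)) :=
  ⟨⟨ϑ.proj, (target I (F × F) (VertM I F V) ϑ.proj ϑ.2).1⟩,
    iotaVertJet I F V ⟨ϑ.proj, (target I (F × F) (VertM I F V) ϑ.proj ϑ.2).1⟩ ϑ.2⟩

variable {V}

/-- Smooth one parameter families `σ_s` of local sections of `V` near `m`. -/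
def IsSmoothFamily (m : B) (σ : ℝ → ∀ x, V x) : Prop :=
  ∀ᶠ q : ℝ × B in 𝓝 ((0 : ℝ), m), ContMDiffAt (𝓘(ℝ, ℝ).prod I) (I.prod 𝓘(ℝ, F)) ∞
    (fun q : ℝ × B => TotalSpace.mk' F q.2 (σ q.1 q.2)) q

/-- The vertical vector `d/ds j^1_m σ_s |_{s=0}` on `J^1 V`. -/
def jetVelocity (m : B) (σ : ℝ → ∀ x, V x) :
    TotalSpace (F × (EB →L[ℝ] F)) (Vert I (F × (EB →L[ℝ] F)) (J1 I F V)) :=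
  vertVelocity I (fun s => (⟨m, jet1 I F V m (σ s)⟩ : TotalSpace (F × (EB →L[ℝ] F)) (J1 I F V)))
    fun _ => rfl

/-- The section `d/ds σ_s |_{s=0}` of `𝔭_V : Ver π → B`. -/
def velocitySec (σ : ℝ → ∀ x, V x) (x : B) : VertM I F V x :=
  ⟨σ 0 x, (vertVelocity I (fun s => TotalSpace.mk' F x (σ s x)) fun _ => rfl).2⟩

/-- The jet `j^1_m (d/ds σ_s |_{s=0})`. -/
def jetVelocitySec (m : B) (σ : ℝ → ∀ x, V x) :
    TotalSpace ((F × F) × (EB →L[ℝ] F × F)) (J1 I (F × F) (VertM I F V)) :=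
  ⟨m, jet1 I (F × F) (VertM I F V) m (velocitySec I F σ)⟩

/-- The canonical map `vj : Ver π_1 → J^1 𝔭_V`,
`vj (d/ds j^1_m σ_s |_{s=0}) = j^1_m (d/ds σ_s |_{s=0})`, where `σ_s` is any smooth family of
local sections of `V` which represents the given vector. -/
def vj (ζ : TotalSpace (F × (EB →L[ℝ] F)) (Vert I (F × (EB →L[ℝ] F)) (J1 I F V))) :
    TotalSpace ((F × F) × (EB →L[ℝ] F × F)) (J1 I (F × F) (VertM I F V)) :=
  Classical.epsilon (h := ⟨⟨ζ.proj.proj, 0⟩⟩) fun ϑ =>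
    ∃ (m : B) (σ : ℝ → ∀ x, V x), IsSmoothFamily I F m σ ∧ jetVelocity I F m σ = ζ ∧
      jetVelocitySec I F m σ = ϑ

variable {F}
variable {I}

/-- The map `h̄ = Ψ ∘ 𝓕h : π^*E → J^1(π^*π)`. -/
def hbar (h : Connection I F V) (q : TotalSpace F (PB I F V)) :
    TotalSpace (F × (EB × F →L[ℝ] F)) (J1 (I.prod 𝓘(ℝ, F)) F (PB I F V)) :=
  psi I F V (fibreDeriv I (F' := F × (EB →L[ℝ] F)) (W := J1 I F V) h.toFun q)

/-- The map `𝓥h : Ver π → J^1 𝔭_V`, `𝓥h(z) = vj (d/ds h(a + s b) |_{s=0})` for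
`z = ξ_π(a, b)`. -/
def vertProlong (h : Connection I F V) (z : TotalSpace F (Vert I F V)) :
    TotalSpace ((F × F) × (EB →L[ℝ] F × F)) (J1 I (F × F) (VertM I F V)) :=
  vj I F (vertVelocity I (fun s => (⟨z.proj.proj, h.toFun
      (fibreLine z.proj ((vertLift I F V z.proj).symm z.2) s)⟩ :
        TotalSpace (F × (EB →L[ℝ] F)) (J1 I F V))) fun _ => rfl)

/-- The map `h̄_V = Ψ_V ∘ 𝓥h : Ver π → J^1 τ_E^V`. -/
def hbarVert (h : Connection I F V) (z : TotalSpace F (Vert I F V)) :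
    TotalSpace (F × (EB × F →L[ℝ] F)) (J1 (I.prod 𝓘(ℝ, F)) F (Vert I F V)) :=
  psiVert I F V (vertProlong h z)

/-- The velocity at time `0` of a curve, as a point of the tangent bundle. -/
def velocityPoint {EP : Type*} [NormedAddCommGroup EP] [NormedSpace ℝ EP]
    {HP : Type*} [TopologicalSpace HP] (J : ModelWithCorners ℝ EP HP)
    {P : Type*} [TopologicalSpace P] [ChartedSpace HP P] (c : ℝ → P) : TangentBundle J P :=
  ⟨c 0, velocity J c⟩

/-- The horizontal lift `ξ^H(p, w) = h(p)(w)` of a connection, as a point of `TE`. -/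
def horLift (h : Connection I F V) (p : TotalSpace F V) (w : TangentSpace I p.proj) :
    TangentBundle (I.prod 𝓘(ℝ, F)) (TotalSpace F V) :=
  ⟨⟨p.proj, target I F V p.proj (h.toFun p)⟩, jetMap I F V p.proj (h.toFun p) w⟩

variable (I F)

/-- For the vector bundle `Tπ : TE → TB`, whose operations are
`λ • α'(0) = (λ α)'(0)` and `α'(0) + β'(0) = (α + β)'(0)` (for curves `α`, `β` in `E` over the same
curve in `B`), this is the relation `ζ = d/ds (v + s • u) |_{s=0}` between a vector `ζ` tangent to
the manifold `TE` and points `v`, `u` of the same fibre of `Tπ`; that is, `ζ` is the vertical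
lift of `u` at `v`, or `u = ν_{Tπ} ζ` for the vertical vector `ζ` at `v`. -/
def IsTangentVertLift (v u : TangentBundle (I.prod 𝓘(ℝ, F)) (TotalSpace F V))
    (ζ : TangentBundle (I.prod 𝓘(ℝ, F)).tangent
      (TangentBundle (I.prod 𝓘(ℝ, F)) (TotalSpace F V))) : Prop :=
  ∃ (x : ℝ → B) (α β : ∀ t, V (x t)),
    ContMDiffAt 𝓘(ℝ, ℝ) (I.prod 𝓘(ℝ, F)) ∞ (fun t => TotalSpace.mk' F (x t) (α t)) 0 ∧
    ContMDiffAt 𝓘(ℝ, ℝ) (I.prod 𝓘(ℝ, F)) ∞ (fun t => TotalSpace.mk' F (x t) (β t)) 0 ∧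
    velocityPoint (I.prod 𝓘(ℝ, F)) (fun t => TotalSpace.mk' F (x t) (α t)) = v ∧
    velocityPoint (I.prod 𝓘(ℝ, F)) (fun t => TotalSpace.mk' F (x t) (β t)) = u ∧
    velocityPoint (I.prod 𝓘(ℝ, F)).tangent (fun s => velocityPoint (I.prod 𝓘(ℝ, F))
      (fun t => TotalSpace.mk' F (x t) (α t + s • β t))) = ζ

variable {I F}

/-- A connection on `π^*E → E` is the linearization of the connection `h` on `E` if its horizontal
lift is `((a, b), w) ↦ (w, B(a, b) w)`, where `B(a, b) w` is the image under `ν_{Tπ}` of the vector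
`d/ds ξ^H(a + s b, Tπ w) |_{s=0}`. The second component of a vector tangent to `π^*E` is its image
under the tangent map of `(a, b) ↦ b`. -/
def IsLinearization (h : Connection I F V)
    (H : Connection (I.prod 𝓘(ℝ, F)) F (PB I F V)) : Prop :=
  ∀ (q : TotalSpace F (PB I F V)) (w : TangentSpace (I.prod 𝓘(ℝ, F)) q.proj),
    IsTangentVertLift I F
      (horLift h q.proj
        (mfderiv (I.prod 𝓘(ℝ, F)) I (TotalSpace.proj : TotalSpace F V → B) q.proj w))
      (tangentMap ((I.prod 𝓘(ℝ, F)).prod 𝓘(ℝ, F)) (I.prod 𝓘(ℝ, F))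
        (fun q' : TotalSpace F (PB I F V) => TotalSpace.mk' F q'.proj.proj q'.2)
        (horLift H q w))
      (velocityPoint (I.prod 𝓘(ℝ, F)).tangent fun s => horLift h (fibreLine q.proj q.2 s)
        (mfderiv (I.prod 𝓘(ℝ, F)) I (TotalSpace.proj : TotalSpace F V → B) q.proj w))

end Linearization

end

/-! ### Charts of the total space and coordinates of vertical vectors -/

section VerticalCoordinates

variable {EB : Type*} [NormedAddCommGroup EB] [NormedSpace ℝ EB]
  {HB : Type*} [TopologicalSpace HB] (I : ModelWithCorners ℝ EB HB)
  {B : Type*} [TopologicalSpace B] [ChartedSpace HB B]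
  (F : Type*) [NormedAddCommGroup F] [NormedSpace ℝ F]
  (V : B → Type*) [∀ x, AddCommGroup (V x)] [∀ x, Module ℝ (V x)] [∀ x, TopologicalSpace (V x)]
  [TopologicalSpace (TotalSpace F V)] [FiberBundle F V] [VectorBundle ℝ F V]

/-! The vertical lift identifies `Ver π` with `E ×_M E`, and through it both constructions come down
to one jet, `k = d/ds h(a + s b)` at `s = 0`, which is an element of the vector space `J^1_m π`.

A section of `𝔭_V` is a pair of sections of `π`, so a jet of such a section is a pair of jets `(j,
k)`. A vertical vector of `π_1` at `j` is likewise the vertical lift of a unique jet `k`. This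
yields an explicit bijection `vjInv : J^1 𝔭_V → Ver π_1` that involves no families of sections. That
it inverts `vj` is the interchange of `d/ds` with `j^1`: if `f(s, z)` represents a family, the
velocity of its jets has coordinates `(∂_s f, ∂_s ∂_z f)`, while the jet of its velocity has
vertical part `(∂_s f, ∂_z ∂_s f)`. Symmetry of the second derivative makes these equal
(`IsSmoothFamily.hasDerivAt_jet`, `IsSmoothFamily.jetProlong_vertMSnd`,
`IsSmoothFamily.vjInv_jetVelocitySec`). Every vertical vector comes from an affine family `s + t η`,
because the fibres of `J^1 π` are vector spaces.

For the pullback bundle, `h̄(a, b) = Υ(a, k)`. Differentiating `target (h(a + s b)) = a + s b` shows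
that `k` has target `b` (`target_fibreDerivSnd`), so `h̄` is a section of the target projection. It
is linear in `b` since the tangent map and `Υ` are linear, and smooth since in jet coordinates `Υ`
is `(y, A) ↦ (y, A ∘ pr₁)` (`jetEquiv_upsilon`).

For the vertical bundle, `𝓥h(ξ_π(a, b))` corresponds to the pair `(h(a), k)`. `Ψ_V` retains only the
point `a` and the jet `k`, and sends them to `j^1 ξ_π (Υ(a, k))`. Hence `h̄_V` is the transport of
`h̄` by `ξ_π`, which gives at once its linearity and the compatibility relation.

For the linearization formula, `ξ^H(a + s b, w)` reads `(w, A(s) w)` in the preferred chart, and its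
derivative at `0` has fibre part `A'(0) w`, which is the second coordinate of `k` applied to `w`.
Curves that are affine in the chart realise this as a vertical lift for `Tπ`. -/

theorem extChartAt_totalSpace_apply (e p : TotalSpace F V)
    (hp : p.proj ∈ (trivializationAt F V e.proj).baseSet) :
    extChartAt (I.prod 𝓘(ℝ, F)) e p =
      (extChartAt I e.proj p.proj, (trivializationAt F V e.proj p).2) := by
  rw [FiberBundle.extChartAt]
  simp only [mfld_simps]
  rw [Trivialization.coe_fst _ ((Trivialization.mem_source _).2 hp)]

theorem mem_target_extChartAt_totalSpace (e : TotalSpace F V) (z : EB × F) :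
    z ∈ (extChartAt (I.prod 𝓘(ℝ, F)) e).target ↔ z.1 ∈ (extChartAt I e.proj).target ∧
      (extChartAt I e.proj).symm z.1 ∈ (trivializationAt F V e.proj).baseSet := by
  rw [FiberBundle.extChartAt_target]
  simp [mfld_simps]

theorem extChartAt_totalSpace_symm (e : TotalSpace F V) {z : EB × F}
    (hz : z ∈ (extChartAt (I.prod 𝓘(ℝ, F)) e).target) :
    (extChartAt (I.prod 𝓘(ℝ, F)) e).symm z =
      ⟨(extChartAt I e.proj).symm z.1,
        (trivializationAt F V e.proj).symm ((extChartAt I e.proj).symm z.1) z.2⟩ := by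
  have h := (mem_target_extChartAt_totalSpace I F V e z).1 hz
  rw [FiberBundle.extChartAt]
  refine Eq.trans ?_ (Trivialization.mk_symm (trivializationAt F V e.proj) h.2 z.2).symm
  rfl

theorem extChartAt_totalSpace_symm_proj (e : TotalSpace F V) {z : EB × F}
    (hz : z ∈ (extChartAt (I.prod 𝓘(ℝ, F)) e).target) :
    ((extChartAt (I.prod 𝓘(ℝ, F)) e).symm z).proj = (extChartAt I e.proj).symm z.1 := by
  rw [extChartAt_totalSpace_symm I F V e hz]

variable {F V}

/-- Chart domains upstairs are saturated by fibres. Conditions on a point of the total space thus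
reduce to conditions on its base point, and `jetBase` serves for all the bundles over `E` at once.
-/
theorem mem_chartAt_source_totalSpace (e p : TotalSpace F V) :
    p ∈ (chartAt (ModelProd HB F) e).source ↔ p.proj ∈ jetBase (HB := HB) F V e.proj := by
  rw [FiberBundle.chartedSpace_chartAt]
  simp only [mfld_simps, jetBase, Set.mem_inter_iff]
  rw [Trivialization.mem_source]
  refine and_congr_right fun hp => ?_
  rw [Trivialization.coe_fst _ ((Trivialization.mem_source _).2 hp)]

theorem trivializationAt_smul_add (i m : B) (hm : m ∈ (trivializationAt F V i).baseSet)
    (a b : V m) (s : ℝ) :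
    (trivializationAt F V i ⟨m, a + s • b⟩).2 =
      (trivializationAt F V i ⟨m, a⟩).2 + s • (trivializationAt F V i ⟨m, b⟩).2 := by
  have h := (trivializationAt F V i).linear ℝ hm
  rw [h.map_add, h.map_smul]

theorem trivializationAt_injective {i m : B} (hm : m ∈ (trivializationAt F V i).baseSet)
    {a b : V m} (h : (trivializationAt F V i ⟨m, a⟩).2 = (trivializationAt F V i ⟨m, b⟩).2) :
    a = b :=
  ((trivializationAt F V i).continuousLinearEquivAt ℝ m hm).injective h

/-- A curve in a fibre is differentiated in any trivialization. -/
theorem hasDerivAt_trivializationAt_change {i j m : B}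
    (hi : m ∈ (trivializationAt F V i).baseSet) (hj : m ∈ (trivializationAt F V j).baseSet)
    {c : ℝ → V m} {k : V m} {t : ℝ}
    (h : HasDerivAt (fun s => (trivializationAt F V i ⟨m, c s⟩).2)
      (trivializationAt F V i ⟨m, k⟩).2 t) :
    HasDerivAt (fun s => (trivializationAt F V j ⟨m, c s⟩).2)
      (trivializationAt F V j ⟨m, k⟩).2 t := by
  -- Both trivializations are linear on the fixed fibre, so the transition is a single continuous
  -- linear map, independent of the curve parameter.
  have key : ∀ v : V m, (trivializationAt F V j ⟨m, v⟩).2 =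
      (((trivializationAt F V i).continuousLinearEquivAt ℝ m hi).symm.trans
        ((trivializationAt F V j).continuousLinearEquivAt ℝ m hj) : F →L[ℝ] F)
        (trivializationAt F V i ⟨m, v⟩).2 := by
    intro v
    change (trivializationAt F V j ⟨m, v⟩).2 =
      (trivializationAt F V j).continuousLinearEquivAt ℝ m hj
        (((trivializationAt F V i).continuousLinearEquivAt ℝ m hi).symm
          ((trivializationAt F V i).continuousLinearEquivAt ℝ m hi v))
    rw [ContinuousLinearEquiv.symm_apply_apply]
    rfl
  simp only [key]
  exact (ContinuousLinearMap.hasFDerivAt _).comp_hasDerivAt t h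

/-- The vertical projection of the velocity of a curve in a fibre is its derivative. -/
theorem trivializationAt_vertLift_symm_vertVelocity {i m : B}
    (hi : m ∈ (trivializationAt F V i).baseSet) {c : ℝ → V m} {d : F}
    (h : HasDerivAt (fun s => (trivializationAt F V i ⟨m, c s⟩).2) d 0) :
    (trivializationAt F V i ⟨m, (vertLift I F V ⟨m, c 0⟩).symm
      (vertVelocity I (fun s => TotalSpace.mk' F m (c s)) fun _ => rfl).2⟩).2 = d := by
  -- Replacing `d` by an intrinsic vector `k` frees the claim from the index `i`; it can then be
  -- checked in the preferred trivialization at `m`, where `mfderiv` is computed.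
  obtain ⟨k, rfl⟩ : ∃ k : V m, (trivializationAt F V i ⟨m, k⟩).2 = d :=
    ((trivializationAt F V i).continuousLinearEquivAt ℝ m hi).surjective d
  have hm := mem_baseSet_trivializationAt F V m
  have h' := hasDerivAt_trivializationAt_change hi hm h
  suffices hk : vertLift I F V ⟨m, c 0⟩ k =
      (vertVelocity I (fun s => TotalSpace.mk' F m (c s)) fun _ => rfl).2 by
    rw [← hk]
    exact congrArg (fun v => (trivializationAt F V i ⟨m, v⟩).2)
      (LinearEquiv.symm_apply_apply (vertLift I F V ⟨m, c 0⟩) k)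
  -- In model coordinates `EB × F` the base component vanishes on both sides, since the curve stays
  -- in one fibre.
  apply vertCoord_injective
  refine (vertCoord_vertLiftFun I F V ⟨m, c 0⟩ k).trans ?_
  have hd : HasMFDerivAt 𝓘(ℝ, ℝ) 𝓘(ℝ, F) (fun s => (trivializationAt F V m ⟨m, c s⟩).2) (0 : ℝ)
      (ContinuousLinearMap.toSpanSingleton ℝ (trivializationAt F V m ⟨m, k⟩).2) :=
    HasFDerivAt.hasMFDerivAt h'.hasFDerivAt
  have hf : MDifferentiableAt 𝓘(ℝ, ℝ) (I.prod 𝓘(ℝ, F)) (fun s => TotalSpace.mk' F m (c s)) 0 := by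
    rw [mdifferentiableAt_totalSpace]
    exact ⟨mdifferentiableAt_const, hd.mdifferentiableAt⟩
  have h1 := congrArg (fun T : ℝ →L[ℝ] EB × F => T 1) (mfderiv_into_totalSpace I F V 𝓘(ℝ, ℝ) hf)
  refine Eq.trans ?_ h1.symm
  have h2 : (mfderiv 𝓘(ℝ, ℝ) I (fun s => (TotalSpace.mk' F m (c s)).proj) (0 : ℝ) : ℝ →L[ℝ] EB)
    = 0 := mfderiv_const
  have h3 := hd.mfderiv
  refine Prod.ext ?_ ?_
  · exact (congrArg (fun T : ℝ →L[ℝ] EB => T 1) h2).symm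
  · refine Eq.trans ?_ (congrArg (fun T : ℝ →L[ℝ] F => T 1) h3).symm
    exact (one_smul ℝ _).symm

variable (F V) in
/-- The bundle projection `Ver π → E` on the fibres of `𝔭_V`. -/
noncomputable def vertMFst (m : B) : VertM I F V m →ₗ[ℝ] V m :=
  (LinearMap.fst ℝ (V m) (V m)).comp (vertMEquiv I F V m).toLinearMap

-- The charts of `𝔭_V` are transported from `V ×ᵇ V`, so in preferred trivializations this map is
-- the first projection `F × F → F`.
variable (F V) in
theorem contMDiff_vertMFst :
    ContMDiff (I.prod 𝓘(ℝ, F × F)) (I.prod 𝓘(ℝ, F)) ∞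
      (fun q : TotalSpace (F × F) (VertM I F V) =>
        (⟨q.proj, vertMFst I F V q.proj q.2⟩ : TotalSpace F V)) := by
  have h := contMDiff_totalEquiv (F := F × F) I (vertMEquiv I F V)
  intro q
  have h1 := (contMDiffAt_totalSpace (F := F × F)).1 (h q)
  rw [contMDiffAt_totalSpace]
  refine ⟨h1.1, ?_⟩
  have h2 : ContMDiff 𝓘(ℝ, F × F) 𝓘(ℝ, F) ∞ (Prod.fst : F × F → F) := contDiff_fst.contMDiff
  have h3 := h2.contMDiffAt.comp q h1.2
  exact h3.congr_of_eventuallyEq (Filter.Eventually.of_forall fun x => rfl)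

end VerticalCoordinates

/-! ### Jet coordinates of the natural maps, and the inverse of `vj` -/

section JetCoordinates

variable {EB : Type*} [NormedAddCommGroup EB] [NormedSpace ℝ EB]
  {HB : Type*} [TopologicalSpace HB] (I : ModelWithCorners ℝ EB HB) [I.Boundaryless]
  {B : Type*} [TopologicalSpace B] [ChartedSpace HB B] [IsManifold I ∞ B]
  {F : Type*} [NormedAddCommGroup F] [NormedSpace ℝ F]
  {V : B → Type*} [∀ x, AddCommGroup (V x)] [∀ x, Module ℝ (V x)] [∀ x, TopologicalSpace (V x)]
  [TopologicalSpace (TotalSpace F V)] [FiberBundle F V] [VectorBundle ℝ F V]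
  [ContMDiffVectorBundle ∞ F V I]

theorem jet1_eq_jetMk {m : B} {s : ∀ x, V x} (hs : s ∈ localSections I F V m) :
    jet1 I F V m s = jetMk I F V m ⟨s, hs⟩ := dif_pos hs

theorem trivializationAt_target {i m : B} (hm : m ∈ jetBase (HB := HB) F V i) (j : J1 I F V m) :
    (trivializationAt F V i ⟨m, target I F V m j⟩).2 = (jetEquiv I hm j).1 := by
  obtain ⟨s, rfl⟩ := jetMk_surjective I m j
  have hsrc : m ∈ (extChartAt I i).source := by rw [extChartAt_source]; exact hm.2
  rw [jetEquiv_jetMk, target_jetMk]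
  change _ = localRep I F V i s.1 (extChartAt I i m)
  rw [localRep, (extChartAt I i).left_inv hsrc]

/-- The pullback trivialization with index `e` is that of `V` with index `e.proj`, so `hp.1` already
is membership in its base set. The same holds for `Vert`, whose trivializations are transported from
`PB`. -/
theorem mem_jetBase_PB {e p : TotalSpace F V} (hp : p.proj ∈ jetBase (HB := HB) F V e.proj) :
    p ∈ jetBase (HB := ModelProd HB F) F (PB I F V) e :=
  ⟨hp.1, (mem_chartAt_source_totalSpace e p).2 hp⟩

theorem mem_jetBase_Vert {e p : TotalSpace F V} (hp : p.proj ∈ jetBase (HB := HB) F V e.proj) :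
    p ∈ jetBase (HB := ModelProd HB F) F (Vert I F V) e :=
  ⟨hp.1, (mem_chartAt_source_totalSpace e p).2 hp⟩

theorem mem_jetBase_VertM {i m : B} (hm : m ∈ jetBase (HB := HB) F V i) :
    m ∈ jetBase (HB := HB) (F × F) (VertM I F V) i :=
  ⟨⟨hm.1, hm.1⟩, hm.2⟩

theorem extChartAt_mem_target {e p : TotalSpace F V}
    (hp : p.proj ∈ jetBase (HB := HB) F V e.proj) :
    extChartAt (I.prod 𝓘(ℝ, F)) e p ∈ (extChartAt (I.prod 𝓘(ℝ, F)) e).target := by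
  refine (extChartAt (I.prod 𝓘(ℝ, F)) e).map_source ?_
  rw [extChartAt_source]
  exact (mem_chartAt_source_totalSpace e p).2 hp

/-- In jet coordinates `Υ` is `(y, A) ↦ (y, A ∘ pr₁)`. -/
theorem jetEquiv_upsilon {e p : TotalSpace F V} (hp : p.proj ∈ jetBase (HB := HB) F V e.proj)
    (j : J1 I F V p.proj) :
    jetEquiv (I.prod 𝓘(ℝ, F)) (mem_jetBase_PB I hp) (upsilon I F V p j) =
      ((jetEquiv I hp j).1, (jetEquiv I hp j).2.comp (ContinuousLinearMap.fst ℝ EB F)) := by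
  obtain ⟨s, rfl⟩ := jetMk_surjective I p.proj j
  rw [upsilon_jetMk, jetEquiv_jetMk, jetEquiv_jetMk]
  -- The pulled back section is constant along fibres, so its representative depends only on the
  -- base coordinate `z.1`; its derivative factors through `pr₁`.
  have hev : localRep (I.prod 𝓘(ℝ, F)) F (PB I F V) e (iotaSec I F V p s).1
      =ᶠ[𝓝 (extChartAt (I.prod 𝓘(ℝ, F)) e p)] fun z => localRep I F V e.proj s.1 z.1 := by
    filter_upwards [(isOpen_extChartAt_target e).mem_nhds (extChartAt_mem_target I hp)] with z hz
    exact congrArg (fun x => (trivializationAt F V e.proj ⟨x, s.1 x⟩).2)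
      (extChartAt_totalSpace_symm_proj I F V e hz)
  have h1 : (extChartAt (I.prod 𝓘(ℝ, F)) e p).1 = extChartAt I e.proj p.proj := by
    rw [extChartAt_totalSpace_apply I F V e p hp.1]
  have hd := ((localRep_contDiffAt I hp s.2).differentiableAt (by simp)).hasFDerivAt
  rw [← h1] at hd
  refine Prod.ext ?_ ?_
  · refine hev.self_of_nhds.trans ?_
    exact congrArg (localRep I F V e.proj s.1) h1
  · refine hev.fderiv_eq.trans
      ((hd.comp (extChartAt (I.prod 𝓘(ℝ, F)) e p) hasFDerivAt_fst).fderiv.trans ?_)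
    rw [h1]
    rfl

section

variable {F' : Type*} [NormedAddCommGroup F'] [NormedSpace ℝ F']
  {W : B → Type*} [∀ x, AddCommGroup (W x)] [∀ x, Module ℝ (W x)] [∀ x, TopologicalSpace (W x)]
  [TopologicalSpace (TotalSpace F' W)] [FiberBundle F' W] [VectorBundle ℝ F' W]
  [ContMDiffVectorBundle ∞ F' W I]

theorem target_jetProlong (ψ : ∀ x, V x →ₗ[ℝ] W x)
    (hψ : ContMDiff (I.prod 𝓘(ℝ, F)) (I.prod 𝓘(ℝ, F')) ∞
      (fun q : TotalSpace F V => (⟨q.proj, ψ q.proj q.2⟩ : TotalSpace F' W))) (m : B)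
    (j : J1 I F V m) :
    target I F' W m (jetProlong I ψ hψ m j) = ψ m (target I F V m j) := by
  obtain ⟨s, rfl⟩ := jetMk_surjective I m j
  rfl

/-- Jet coordinates of the prolongation of a bundle map which is constant in the
trivializations with index `i`. -/
theorem jetEquiv_jetProlong (ψ : ∀ x, V x →ₗ[ℝ] W x)
    (hψ : ContMDiff (I.prod 𝓘(ℝ, F)) (I.prod 𝓘(ℝ, F')) ∞
      (fun q : TotalSpace F V => (⟨q.proj, ψ q.proj q.2⟩ : TotalSpace F' W))) {i m : B}
    (hm : m ∈ jetBase (HB := HB) F V i) (hm' : m ∈ jetBase (HB := HB) F' W i) (C : F →L[ℝ] F')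
    (hC : ∀ (x : B) (v : V x),
      (trivializationAt F' W i ⟨x, ψ x v⟩).2 = C (trivializationAt F V i ⟨x, v⟩).2)
    (j : J1 I F V m) :
    jetEquiv I hm' (jetProlong I ψ hψ m j) =
      (C (jetEquiv I hm j).1, C.comp (jetEquiv I hm j).2) := by
  obtain ⟨s, rfl⟩ := jetMk_surjective I m j
  rw [jetProlong_jetMk, jetEquiv_jetMk, jetEquiv_jetMk]
  have hrep : localRep I F' W i (sectionMap I ψ hψ m s).1 = fun z => C (localRep I F V i s.1 z) :=
    funext fun z => hC _ _
  have hd := C.hasFDerivAt.comp (extChartAt I i m)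
    ((localRep_contDiffAt I hm s.2).differentiableAt (by simp)).hasFDerivAt
  refine Prod.ext (congrFun hrep _) ?_
  change fderiv ℝ (localRep I F' W i (sectionMap I ψ hψ m s).1) _ = _
  rw [hrep]
  exact hd.fderiv

end

/-- The trivializations of `Vert` are those of `PB` carried over by the vertical lift, so in them
the vertical lift is the identity of `F`. -/
theorem jetEquiv_jetProlong_vertLift {e p : TotalSpace F V}
    (hp : p.proj ∈ jetBase (HB := HB) F V e.proj) (j : J1 (I.prod 𝓘(ℝ, F)) F (PB I F V) p) :
    jetEquiv (I.prod 𝓘(ℝ, F)) (mem_jetBase_Vert I hp)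
      (jetProlong (I.prod 𝓘(ℝ, F)) (V := PB I F V) (W := Vert I F V)
        (fun a => (vertLift I F V a).toLinearMap) (contMDiff_vertLift I F V) p j) =
      jetEquiv (I.prod 𝓘(ℝ, F)) (mem_jetBase_PB I hp) j := by
  refine (jetEquiv_jetProlong (I.prod 𝓘(ℝ, F)) _ (contMDiff_vertLift I F V) (mem_jetBase_PB I hp)
    (mem_jetBase_Vert I hp) (ContinuousLinearMap.id ℝ F) ?_ j).trans rfl
  intro a v
  exact congrArg (fun w => (trivializationAt F V e.proj ⟨a.proj, w⟩).2)
    (LinearEquiv.symm_apply_apply (vertLift I F V a) v)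

theorem jetEquiv_jetProlong_vertMFst {i m : B} (hm : m ∈ jetBase (HB := HB) F V i)
    (j : J1 I (F × F) (VertM I F V) m) :
    jetEquiv I hm (jetProlong I (vertMFst I F V) (contMDiff_vertMFst I F V) m j) =
      ((jetEquiv I (mem_jetBase_VertM I hm) j).1.1,
        (ContinuousLinearMap.fst ℝ F F).comp (jetEquiv I (mem_jetBase_VertM I hm) j).2) :=
  jetEquiv_jetProlong I _ (contMDiff_vertMFst I F V) (mem_jetBase_VertM I hm) hm
    (ContinuousLinearMap.fst ℝ F F) (fun _ _ => rfl) j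

theorem jetEquiv_jetProlong_vertMSnd {i m : B} (hm : m ∈ jetBase (HB := HB) F V i)
    (j : J1 I (F × F) (VertM I F V) m) :
    jetEquiv I hm (jetProlong I (vertMSnd I F V) (contMDiff_vertMSnd I F V) m j) =
      ((jetEquiv I (mem_jetBase_VertM I hm) j).1.2,
        (ContinuousLinearMap.snd ℝ F F).comp (jetEquiv I (mem_jetBase_VertM I hm) j).2) :=
  jetEquiv_jetProlong I _ (contMDiff_vertMSnd I F V) (mem_jetBase_VertM I hm) hm
    (ContinuousLinearMap.snd ℝ F F) (fun _ _ => rfl) j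

/-- The inverse of `vj`: a jet of a section of `𝔭_V` consists of a jet of its base section and of
a jet of its vertical part. -/
noncomputable def vjInv (ϑ : TotalSpace ((F × F) × (EB →L[ℝ] F × F)) (J1 I (F × F) (VertM I F V))) :
    TotalSpace (F × (EB →L[ℝ] F)) (Vert I (F × (EB →L[ℝ] F)) (J1 I F V)) :=
  ⟨⟨ϑ.proj, jetProlong I (vertMFst I F V) (contMDiff_vertMFst I F V) ϑ.proj ϑ.2⟩,
    vertLift I (F × (EB →L[ℝ] F)) (J1 I F V) ⟨ϑ.proj, _⟩
      (jetProlong I (vertMSnd I F V) (contMDiff_vertMSnd I F V) ϑ.proj ϑ.2)⟩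

/-- In jet coordinates the two prolongations are the components of an element of `(F × F) × (EB
→L[ℝ] F × F)`, and these determine it. -/
theorem jetProlong_vertM_injective {m : B} {j j' : J1 I (F × F) (VertM I F V) m}
    (h1 : jetProlong I (vertMFst I F V) (contMDiff_vertMFst I F V) m j =
      jetProlong I (vertMFst I F V) (contMDiff_vertMFst I F V) m j')
    (h2 : jetProlong I (vertMSnd I F V) (contMDiff_vertMSnd I F V) m j =
      jetProlong I (vertMSnd I F V) (contMDiff_vertMSnd I F V) m j') : j = j' := by
  have hm := mem_jetBase_self (HB := HB) (F := F) (V := V) m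
  have e1 := congrArg (jetEquiv I hm) h1
  have e2 := congrArg (jetEquiv I hm) h2
  rw [jetEquiv_jetProlong_vertMFst, jetEquiv_jetProlong_vertMFst] at e1
  rw [jetEquiv_jetProlong_vertMSnd, jetEquiv_jetProlong_vertMSnd] at e2
  apply (jetEquiv I (mem_jetBase_VertM I hm)).injective
  refine Prod.ext (Prod.ext ?_ ?_) ?_
  · exact congrArg (fun T => T.1) e1
  · exact congrArg (fun T => T.1) e2
  ext v
  · exact congrArg (fun T => T.2 v) e1
  · exact congrArg (fun T => T.2 v) e2

/-- Two jets of `V` over the same point are paired componentwise in jet coordinates; no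
compatibility between them is required. -/
theorem exists_jetProlong_vertM {m : B} (j k : J1 I F V m) :
    ∃ ϑ : J1 I (F × F) (VertM I F V) m,
      jetProlong I (vertMFst I F V) (contMDiff_vertMFst I F V) m ϑ = j ∧
      jetProlong I (vertMSnd I F V) (contMDiff_vertMSnd I F V) m ϑ = k := by
  have hm := mem_jetBase_self (HB := HB) (F := F) (V := V) m
  refine ⟨(jetEquiv I (mem_jetBase_VertM I hm)).symm
    (((jetEquiv I hm j).1, (jetEquiv I hm k).1),
      (jetEquiv I hm j).2.prod (jetEquiv I hm k).2), ?_, ?_⟩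
  · apply (jetEquiv I hm).injective
    rw [jetEquiv_jetProlong_vertMFst, LinearEquiv.apply_symm_apply]
    exact Prod.ext rfl (ContinuousLinearMap.ext fun v => rfl)
  · apply (jetEquiv I hm).injective
    rw [jetEquiv_jetProlong_vertMSnd, LinearEquiv.apply_symm_apply]
    exact Prod.ext rfl (ContinuousLinearMap.ext fun v => rfl)

/-- Both sides are fibrewise `J^1_m V × J^1_m V`: the source by splitting a jet of a pair into a
pair of jets, the target by the vertical lift of `J^1 V`. -/
theorem vjInv_bijective : Function.Bijective (vjInv I (F := F) (V := V)) := by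
  constructor
  · rintro ⟨m, j⟩ ⟨m', j'⟩ h
    obtain rfl : m = m' := congrArg (fun ζ => ζ.proj.proj) h
    -- The base jets are matched first: the vertical vectors lie over them, and belong to the same
    -- space only once `h1` has been used.
    have h1 := eq_of_heq (TotalSpace.mk.inj (TotalSpace.mk.inj h).1).2
    refine congrArg (TotalSpace.mk m) (jetProlong_vertM_injective I h1 ?_)
    simp only [vjInv] at h
    rw [h1] at h
    exact (vertLift I _ (J1 I F V) ⟨m, _⟩).injective (eq_of_heq (TotalSpace.mk.inj h).2)
  · rintro ⟨⟨m, j⟩, z⟩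
    obtain ⟨ϑ, rfl, h2⟩ := exists_jetProlong_vertM I j ((vertLift I _ (J1 I F V) ⟨m, j⟩).symm z)
    refine ⟨⟨m, ϑ⟩, ?_⟩
    simp only [vjInv]
    rw [h2, LinearEquiv.apply_symm_apply]

end JetCoordinates

/-! ### Velocities of curves in a fibre -/

section Velocities

variable {EB : Type*} [NormedAddCommGroup EB] [NormedSpace ℝ EB]
  {HB : Type*} [TopologicalSpace HB] (I : ModelWithCorners ℝ EB HB)
  {B : Type*} [TopologicalSpace B] [ChartedSpace HB B]
  {F : Type*} [NormedAddCommGroup F] [NormedSpace ℝ F]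
  {V : B → Type*} [∀ x, AddCommGroup (V x)] [∀ x, Module ℝ (V x)] [∀ x, TopologicalSpace (V x)]
  [TopologicalSpace (TotalSpace F V)] [FiberBundle F V] [VectorBundle ℝ F V]

/-- The starting point enters through the equation `ha` because `c 0` is often equal to the intended
point only after simplification, as with `a + 0 • b`, and the vertical fibre depends on it. -/
theorem vertVelocity_eq {i m : B} (hi : m ∈ (trivializationAt F V i).baseSet) {c : ℝ → V m}
    {a k : V m} (ha : c 0 = a)
    (h : HasDerivAt (fun s => (trivializationAt F V i ⟨m, c s⟩).2)
      (trivializationAt F V i ⟨m, k⟩).2 0) :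
    vertVelocity I (fun s => TotalSpace.mk' F m (c s)) (fun _ => rfl) =
      ⟨⟨m, a⟩, vertLift I F V ⟨m, a⟩ k⟩ := by
  subst ha
  have h1 := trivializationAt_injective hi (trivializationAt_vertLift_symm_vertVelocity I hi h)
  refine congrArg (TotalSpace.mk (⟨m, c 0⟩ : TotalSpace F V)) ?_
  exact ((vertLift I F V ⟨m, c 0⟩).symm_apply_eq).1 h1

theorem vertVelocity_fibreLine (p : TotalSpace F V) (b : V p.proj) :
    vertVelocity I (fibreLine p b) (fun _ => rfl) = ⟨p, vertLift I F V p b⟩ := by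
  have hm := mem_baseSet_trivializationAt F V p.proj
  refine vertVelocity_eq I hm (c := fun s => p.2 + s • b) (by rw [zero_smul, add_zero]) ?_
  simp only [trivializationAt_smul_add p.proj p.proj hm]
  have h := ((hasDerivAt_id (0 : ℝ)).smul_const (trivializationAt F V p.proj ⟨p.proj, b⟩).2).const_add
    (trivializationAt F V p.proj ⟨p.proj, p.2⟩).2
  rw [one_smul] at h
  exact h

end Velocities

/-! ### One parameter families of sections and the bijectivity of `vj` -/

section Families

variable {EB : Type*} [NormedAddCommGroup EB] [NormedSpace ℝ EB]
  {HB : Type*} [TopologicalSpace HB] (I : ModelWithCorners ℝ EB HB) [I.Boundaryless]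
  {B : Type*} [TopologicalSpace B] [ChartedSpace HB B] [IsManifold I ∞ B]
  {F : Type*} [NormedAddCommGroup F] [NormedSpace ℝ F]
  {V : B → Type*} [∀ x, AddCommGroup (V x)] [∀ x, Module ℝ (V x)] [∀ x, TopologicalSpace (V x)]
  [TopologicalSpace (TotalSpace F V)] [FiberBundle F V] [VectorBundle ℝ F V]
  [ContMDiffVectorBundle ∞ F V I]

variable (F) in
/-- Local representative of a one parameter family of sections. -/
noncomputable def familyRep (i : B) (σ : ℝ → ∀ x, V x) (q : ℝ × EB) : F := localRep I F V i (σ q.1) q.2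

theorem familyRep_extChartAt {i x : B} (hx : x ∈ (chartAt HB i).source) (σ : ℝ → ∀ x, V x)
    (s : ℝ) : familyRep I F i σ (s, extChartAt I i x) = (trivializationAt F V i ⟨x, σ s x⟩).2 := by
  have hsrc : x ∈ (extChartAt I i).source := by rwa [extChartAt_source]
  rw [familyRep, localRep, (extChartAt I i).left_inv hsrc]

theorem vertMSnd_velocitySec (σ : ℝ → ∀ x, V x) (x : B) :
    vertMSnd I F V x (velocitySec I F σ x) = (vertLift I F V ⟨x, σ 0 x⟩).symm
      (vertVelocity I (fun s => TotalSpace.mk' F x (σ s x)) fun _ => rfl).2 := rfl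

variable {I}

/-- Smoothness is joint in the parameter and the base coordinate; this is what permits exchanging
the two derivatives later. -/
theorem IsSmoothFamily.contDiffAt_familyRep {i m : B} (hm : m ∈ jetBase (HB := HB) F V i)
    {σ : ℝ → ∀ x, V x} (hσ : IsSmoothFamily I F m σ) :
    ContDiffAt ℝ ∞ (familyRep I F i σ) (0, extChartAt I i m) := by
  have h1 : ContMDiffAt (𝓘(ℝ, ℝ).prod I) (I.prod 𝓘(ℝ, F)) ∞
    (fun q : ℝ × B => TotalSpace.mk' F q.2 (σ q.1 q.2)) (0, m) := hσ.self_of_nhds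
  have h2 := ((trivializationAt F V i).contMDiffAt_iff
    ((Trivialization.mem_source _).2 hm.1)).1 h1
  have hsrc : m ∈ (extChartAt I i).source := by rw [extChartAt_source]; exact hm.2
  have ht : extChartAt I i m ∈ (extChartAt I i).target := (extChartAt I i).map_source hsrc
  have h3 : ContMDiffAt 𝓘(ℝ, ℝ × EB) I ∞ (fun q : ℝ × EB => (extChartAt I i).symm q.2)
      (0, extChartAt I i m) :=
    ((contMDiffOn_extChartAt_symm i).contMDiffAt ((isOpen_extChartAt_target i).mem_nhds ht)).comp
      (0, extChartAt I i m) contDiff_snd.contMDiff.contMDiffAt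
  have h4 : (extChartAt I i).symm (extChartAt I i m) = m := (extChartAt I i).left_inv hsrc
  have h5 : ContMDiffAt 𝓘(ℝ, ℝ × EB) (𝓘(ℝ, ℝ).prod I) ∞
      (fun q : ℝ × EB => (q.1, (extChartAt I i).symm q.2)) (0, extChartAt I i m) :=
    (contDiff_fst.contMDiff.contMDiffAt).prodMk h3
  rw [← contMDiffAt_iff_contDiffAt]
  exact ContMDiffAt.comp_of_eq (g := fun q : ℝ × B =>
    (trivializationAt F V i (TotalSpace.mk' F q.2 (σ q.1 q.2))).2) h2.2 h5 (by rw [h4])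

/-- Formulas proved at `m` therefore hold on a neighbourhood of `m`, and so can be differentiated in
the base direction. -/
theorem IsSmoothFamily.eventually {m : B} {σ : ℝ → ∀ x, V x} (hσ : IsSmoothFamily I F m σ) :
    ∀ᶠ x in 𝓝 m, IsSmoothFamily I F x σ := by
  have h := hσ.eventually_nhds
  have hc : ContinuousAt (fun x : B => ((0 : ℝ), x)) m := by fun_prop
  exact hc.eventually h

theorem IsSmoothFamily.eventually_mem_localSections {m : B} {σ : ℝ → ∀ x, V x}
    (hσ : IsSmoothFamily I F m σ) : ∀ᶠ s in 𝓝 (0 : ℝ), σ s ∈ localSections I F V m := by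
  have h : ∀ᶠ q : ℝ × B in 𝓝 (0 : ℝ) ×ˢ 𝓝 m,
      ContMDiffAt (𝓘(ℝ, ℝ).prod I) (I.prod 𝓘(ℝ, F)) ∞
        (fun q : ℝ × B => TotalSpace.mk' F q.2 (σ q.1 q.2)) q := by
    rw [← nhds_prod_eq]; exact hσ
  -- A property holding near `(0, m)` holds, for each `s` near `0`, for all `x` near `m`; the
  -- neighbourhood of `m` may depend on `s`.
  filter_upwards [h.curry] with s hs
  change ∀ᶠ x in 𝓝 m, ContMDiffAt I (I.prod 𝓘(ℝ, F)) ∞ (fun y => TotalSpace.mk' F y (σ s y)) x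
  filter_upwards [hs] with x hx
  exact ContMDiffAt.comp (g := fun q : ℝ × B => TotalSpace.mk' F q.2 (σ q.1 q.2)) x hx
    (contMDiffAt_const.prodMk contMDiffAt_id)

theorem IsSmoothFamily.hasDerivAt_section {i m : B} (hm : m ∈ jetBase (HB := HB) F V i)
    {σ : ℝ → ∀ x, V x} (hσ : IsSmoothFamily I F m σ) :
    HasDerivAt (fun s => (trivializationAt F V i ⟨m, σ s m⟩).2)
      (fderiv ℝ (familyRep I F i σ) (0, extChartAt I i m) (1, 0)) 0 := by
  have h := ((hσ.contDiffAt_familyRep hm).differentiableAt (by simp)).hasFDerivAt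
  have h1 := h.comp_hasDerivAt (0 : ℝ)
    ((hasDerivAt_id (0 : ℝ)).prodMk (hasDerivAt_const (0 : ℝ) (extChartAt I i m)))
  refine h1.congr_of_eventuallyEq (Filter.Eventually.of_forall fun s => ?_)
  exact (familyRep_extChartAt I hm.2 σ s).symm

theorem IsSmoothFamily.trivializationAt_velocitySec {i m : B}
    (hm : m ∈ jetBase (HB := HB) F V i) {σ : ℝ → ∀ x, V x} (hσ : IsSmoothFamily I F m σ) :
    (trivializationAt F V i ⟨m, vertMSnd I F V m (velocitySec I F σ m)⟩).2 =
      fderiv ℝ (familyRep I F i σ) (0, extChartAt I i m) (1, 0) := by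
  refine Eq.trans ?_ (trivializationAt_vertLift_symm_vertVelocity I (m := m) hm.1
    (c := fun s => σ s m) (hσ.hasDerivAt_section hm))
  exact congrArg (fun v => (trivializationAt F V i ⟨m, v⟩).2)
    (vertMSnd_velocitySec I σ m)

/-- With `f` the local representative of the family, the velocity section reads `z ↦ (f(0, z), ∂_s
f(0, z))`, which is smooth along with `f`. -/
theorem IsSmoothFamily.contMDiffAt_velocitySec {m : B} {σ : ℝ → ∀ x, V x}
    (hσ : IsSmoothFamily I F m σ) :
    ContMDiffAt I (I.prod 𝓘(ℝ, F × F)) ∞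
      (fun y => TotalSpace.mk' (F × F) y (velocitySec I F σ y)) m := by
  have hm := mem_jetBase_self (HB := HB) (F := F) (V := V) m
  rw [(trivializationAt (F × F) (VertM I F V) m).contMDiffAt_section_iff
    (mem_jetBase_VertM I hm).1]
  have hf := hσ.contDiffAt_familyRep hm
  have hp : ContDiff ℝ ∞ (fun z : EB => ((0 : ℝ), z)) := by fun_prop
  have hf0 : ContDiffAt ℝ ∞ (fun z => familyRep I F m σ (0, z)) (extChartAt I m m) :=
    hf.comp (extChartAt I m m) hp.contDiffAt
  have hf1 : ContDiffAt ℝ ∞ (fun z => fderiv ℝ (familyRep I F m σ) (0, z) (1, 0))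
      (extChartAt I m m) :=
    ((hf.fderiv_right (m := ∞) (by simp)).comp (extChartAt I m m) hp.contDiffAt).clm_apply
      contDiffAt_const
  have h1 := ((hf0.prodMk hf1).contMDiffAt).comp m (contMDiffAt_extChartAt (I := I) (x := m))
  refine h1.congr_of_eventuallyEq ?_
  have ho : IsOpen (jetBase (HB := HB) F V m) :=
    (trivializationAt F V m).open_baseSet.inter (chartAt HB m).open_source
  filter_upwards [hσ.eventually, ho.mem_nhds hm] with x hx hxm
  exact Prod.ext (familyRep_extChartAt I hxm.2 σ 0).symm (hx.trivializationAt_velocitySec hxm)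

theorem IsSmoothFamily.velocitySec_mem {m : B} {σ : ℝ → ∀ x, V x}
    (hσ : IsSmoothFamily I F m σ) : velocitySec I F σ ∈ localSections I (F × F) (VertM I F V) m :=
  hσ.eventually.mono fun _ hx => hx.contMDiffAt_velocitySec

/-- Derivative in the parameter of the jet coordinates of a family of sections. -/
theorem IsSmoothFamily.hasDerivAt_jet {m : B} {σ : ℝ → ∀ x, V x} (hσ : IsSmoothFamily I F m σ) :
    HasDerivAt (fun s => (trivializationAt (F × (EB →L[ℝ] F)) (J1 I F V) m
        ⟨m, jet1 I F V m (σ s)⟩).2)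
      (fderiv ℝ (familyRep I F m σ) (0, extChartAt I m m) (1, 0),
        (fderiv ℝ (fderiv ℝ (familyRep I F m σ)) (0, extChartAt I m m) (1, 0)).comp
          (ContinuousLinearMap.inr ℝ ℝ EB)) 0 := by
  have hm := mem_jetBase_self (HB := HB) (F := F) (V := V) m
  have hf := hσ.contDiffAt_familyRep hm
  have hcurve : HasDerivAt (fun s : ℝ => (s, extChartAt I m m)) ((1 : ℝ), (0 : EB)) 0 :=
    (hasDerivAt_id (0 : ℝ)).prodMk (hasDerivAt_const (0 : ℝ) (extChartAt I m m))
  have h1 := (hf.differentiableAt (by simp)).hasFDerivAt.comp_hasDerivAt (0 : ℝ) hcurve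
  have h2 := ((hf.fderiv_right (m := 1) (by norm_cast)).differentiableAt
    (by simp)).hasFDerivAt.comp_hasDerivAt (0 : ℝ) hcurve
  -- Precomposition with `inr` extracts from the full derivative its part in the base direction;
  -- being continuous and linear, it commutes with `d/ds`.
  have h3 := ((ContinuousLinearMap.compL ℝ EB (ℝ × EB) F).flip
    (ContinuousLinearMap.inr ℝ ℝ EB)).hasFDerivAt.comp_hasDerivAt (0 : ℝ) h2
  refine (h1.prodMk h3).congr_of_eventuallyEq ?_
  have hd : ∀ᶠ q in 𝓝 ((0 : ℝ), extChartAt I m m), DifferentiableAt ℝ (familyRep I F m σ) q :=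
    ((hf.of_le (m := 1) (by norm_cast)).eventually (by simp)).mono
      fun q hq => hq.differentiableAt (by simp)
  -- Only `s` near `0` can be treated: `jet1` takes the default value `0` unless `σ s` is a local
  -- section, and the chain rule needs differentiability at `(s, z)`, not just at `(0, z)`.
  filter_upwards [hσ.eventually_mem_localSections, hcurve.continuousAt.eventually hd] with s hs hds
  rw [trivializationAt_J1 I F V m m hm, jet1_eq_jetMk I hs, jetEquiv_jetMk]
  refine Prod.ext rfl ?_
  have hz : HasFDerivAt (fun z : EB => (s, z)) (ContinuousLinearMap.inr ℝ ℝ EB)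
    (extChartAt I m m) := hasFDerivAt_prodMk_right s (extChartAt I m m)
  exact (hds.hasFDerivAt.comp (extChartAt I m m) hz).fderiv

/-- Here the parameter derivative is taken first and the base derivative second. The right side is
written exactly as in `IsSmoothFamily.hasDerivAt_jet`, where the order is opposite. -/
theorem IsSmoothFamily.jetProlong_vertMSnd {m : B} {σ : ℝ → ∀ x, V x}
    (hσ : IsSmoothFamily I F m σ) :
    (trivializationAt (F × (EB →L[ℝ] F)) (J1 I F V) m
      ⟨m, jetProlong I (vertMSnd I F V) (contMDiff_vertMSnd I F V) m
        (jetMk I (F × F) (VertM I F V) m ⟨velocitySec I F σ, hσ.velocitySec_mem⟩)⟩).2 =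
      (fderiv ℝ (familyRep I F m σ) (0, extChartAt I m m) (1, 0),
        (fderiv ℝ (fderiv ℝ (familyRep I F m σ)) (0, extChartAt I m m) (1, 0)).comp
          (ContinuousLinearMap.inr ℝ ℝ EB)) := by
  have hm := mem_jetBase_self (HB := HB) (F := F) (V := V) m
  have hf := hσ.contDiffAt_familyRep hm
  rw [trivializationAt_J1 I F V m m hm, jetProlong_jetMk, jetEquiv_jetMk]
  have h4 : (extChartAt I m).symm (extChartAt I m m) = m := extChartAt_to_inv m
  have hc : ContinuousAt (extChartAt I m).symm (extChartAt I m m) :=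
    (continuousOn_extChartAt_symm m).continuousAt
      ((isOpen_extChartAt_target m).mem_nhds (mem_extChartAt_target m))
  have hev : localRep I F V m (sectionMap I (vertMSnd I F V) (contMDiff_vertMSnd I F V) m
      ⟨velocitySec I F σ, hσ.velocitySec_mem⟩).1 =ᶠ[𝓝 (extChartAt I m m)]
      fun z => fderiv ℝ (familyRep I F m σ) (0, z) (1, 0) := by
    have h5 : ∀ᶠ z in 𝓝 (extChartAt I m m), IsSmoothFamily I F ((extChartAt I m).symm z) σ :=
      hc.eventually (by rw [h4]; exact hσ.eventually)
    filter_upwards [h5, eventually_jetBase I hm] with z hz hzm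
    refine (hz.trivializationAt_velocitySec hzm.1).trans ?_
    rw [(extChartAt I m).right_inv hzm.2]
  have h2 := ((hf.fderiv_right (m := 1) (by norm_cast)).differentiableAt (by simp)).hasFDerivAt.comp
    (extChartAt I m m) (hasFDerivAt_prodMk_right (0 : ℝ) (extChartAt I m m))
  have h3 := (ContinuousLinearMap.apply ℝ F ((1 : ℝ), (0 : EB))).hasFDerivAt.comp
    (extChartAt I m m) h2
  refine Prod.ext hev.self_of_nhds (hev.fderiv_eq.trans (h3.fderiv.trans ?_))
  ext v
  -- The mixed partial derivatives in the directions `(0, v)` and `(1, 0)` agree; over `ℝ`, class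
  -- `C^2` suffices.
  exact (hf.isSymmSndFDerivAt (by rw [minSmoothness_of_isRCLikeNormedField]; norm_cast)).eq (0, v) (1, 0)

/-- Taking jets commutes with `d/ds`: the base part is `j^1 σ_0`, and the vertical parts agree by
the two preceding coordinate computations. Since `vjInv` is injective, the jet of the velocity
depends only on the vector that the family represents, which is the well-definedness of `vj`. -/
theorem IsSmoothFamily.vjInv_jetVelocitySec {m : B} {σ : ℝ → ∀ x, V x}
    (hσ : IsSmoothFamily I F m σ) : vjInv I (jetVelocitySec I F m σ) = jetVelocity I F m σ := by
  have hm := mem_jetBase_self (HB := HB) (F := F) (V := V) m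
  have hs : σ 0 ∈ localSections I F V m := hσ.eventually_mem_localSections.self_of_nhds
  have h1 : jetVelocitySec I F m σ =
      ⟨m, jetMk I (F × F) (VertM I F V) m ⟨velocitySec I F σ, hσ.velocitySec_mem⟩⟩ :=
    congrArg (TotalSpace.mk m) (jet1_eq_jetMk I hσ.velocitySec_mem)
  rw [h1]
  refine (vertVelocity_eq I (F := F × (EB →L[ℝ] F)) (V := J1 I F V) (i := m) (m := m) hm
    (c := fun s => jet1 I F V m (σ s)) ?_ ?_).symm
  · exact jet1_eq_jetMk I hs
  · rw [hσ.jetProlong_vertMSnd]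
    exact hσ.hasDerivAt_jet

variable (I)

theorem isSmoothFamily_add_smul {m : B} {s η : ∀ x, V x} (hs : s ∈ localSections I F V m)
    (hη : η ∈ localSections I F V m) : IsSmoothFamily I F m (fun t => s + t • η) := by
  have h : ∀ᶠ x in 𝓝 m, ContMDiffAt I (I.prod 𝓘(ℝ, F)) ∞ (fun y => TotalSpace.mk' F y (s y)) x ∧
      ContMDiffAt I (I.prod 𝓘(ℝ, F)) ∞ (fun y => TotalSpace.mk' F y (η y)) x :=
    Filter.Eventually.and hs hη
  filter_upwards [(continuous_snd (X := ℝ) (Y := B)).continuousAt.eventually h] with q hq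
  have h1 := (contMDiffAt_totalSpace (F := F)).1
    (hq.1.comp q (contMDiffAt_snd (I := 𝓘(ℝ, ℝ)) (J := I)))
  have h2 := (contMDiffAt_totalSpace (F := F)).1
    (hq.2.comp q (contMDiffAt_snd (I := 𝓘(ℝ, ℝ)) (J := I)))
  rw [contMDiffAt_totalSpace]
  refine ⟨contMDiffAt_snd, (h1.2.add (contMDiffAt_fst.smul h2.2)).congr_of_eventuallyEq ?_⟩
  have hb := ((trivializationAt F V q.2).open_baseSet.preimage
    (continuous_snd (X := ℝ) (Y := B))).mem_nhds (mem_baseSet_trivializationAt F V q.2)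
  filter_upwards [hb] with r hr
  exact trivializationAt_smul_add q.2 r.2 hr (s r.2) (η r.2) r.1

/-- A vertical vector at a jet `j` is the lift of a jet `k`. If `s` and `η` represent `j` and `k`,
the jets of `s + t η` form the line `j + t k`, whose velocity is that lift. -/
theorem exists_isSmoothFamily
    (ζ : TotalSpace (F × (EB →L[ℝ] F)) (Vert I (F × (EB →L[ℝ] F)) (J1 I F V))) :
    ∃ (m : B) (σ : ℝ → ∀ x, V x), IsSmoothFamily I F m σ ∧ jetVelocity I F m σ = ζ := by
  obtain ⟨⟨m, j⟩, z⟩ := ζ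
  obtain ⟨k, rfl⟩ := (vertLift I (F × (EB →L[ℝ] F)) (J1 I F V) ⟨m, j⟩).surjective z
  obtain ⟨s, rfl⟩ := jetMk_surjective I m j
  obtain ⟨η, rfl⟩ := jetMk_surjective I m k
  refine ⟨m, fun t => s.1 + t • η.1, isSmoothFamily_add_smul I s.2 η.2, ?_⟩
  refine Eq.trans ?_ (vertVelocity_fibreLine I (F := F × (EB →L[ℝ] F)) (V := J1 I F V)
    ⟨m, jetMk I F V m s⟩ (jetMk I F V m η))
  have h : ∀ t : ℝ, jet1 I F V m (s.1 + t • η.1) = jetMk I F V m s + t • jetMk I F V m η := by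
    intro t
    rw [← map_smul, ← map_add]
    exact jet1_eq_jetMk I (s + t • η).2
  simp only [jetVelocity, h]
  rfl

/-- Whichever family the choice in `vj` selects, `vjInv` sends the jet of its velocity back to `ζ`;
the existence of one family makes the choice meaningful. -/
theorem vjInv_vj (ζ : TotalSpace (F × (EB →L[ℝ] F)) (Vert I (F × (EB →L[ℝ] F)) (J1 I F V))) :
    vjInv I (vj I F ζ) = ζ := by
  obtain ⟨m, σ, hσ, h⟩ := exists_isSmoothFamily I ζ
  have hex : ∃ ϑ, ∃ (m : B) (σ : ℝ → ∀ x, V x), IsSmoothFamily I F m σ ∧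
      jetVelocity I F m σ = ζ ∧ jetVelocitySec I F m σ = ϑ := ⟨_, m, σ, hσ, h, rfl⟩
  obtain ⟨m', σ', hσ', h1, h2⟩ := Classical.epsilon_spec hex
  have h3 : jetVelocitySec I F m' σ' = vj I F ζ := h2
  rw [← h3, hσ'.vjInv_jetVelocitySec, h1]

theorem vj_vjInv (ϑ : TotalSpace ((F × F) × (EB →L[ℝ] F × F)) (J1 I (F × F) (VertM I F V))) :
    vj I F (vjInv I ϑ) = ϑ :=
  (vjInv_bijective I).1 (vjInv_vj I _)

theorem vj_jetVelocity {m : B} {σ : ℝ → ∀ x, V x} (hσ : IsSmoothFamily I F m σ) :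
    vj I F (jetVelocity I F m σ) = jetVelocitySec I F m σ := by
  rw [← hσ.vjInv_jetVelocitySec, vj_vjInv]

theorem vj_bijective : Function.Bijective (vj I F (V := V)) :=
  Function.bijective_iff_has_inverse.2 ⟨vjInv I, vjInv_vj I, vj_vjInv I⟩

end Families

/-! ### Fibre derivatives of nonlinear fibred maps -/

section FibreDerivatives

variable {EB : Type*} [NormedAddCommGroup EB] [NormedSpace ℝ EB]
  {HB : Type*} [TopologicalSpace HB] (I : ModelWithCorners ℝ EB HB)
  {B : Type*} [TopologicalSpace B] [ChartedSpace HB B]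
  {F : Type*} [NormedAddCommGroup F] [NormedSpace ℝ F]
  {V : B → Type*} [∀ x, AddCommGroup (V x)] [∀ x, Module ℝ (V x)] [∀ x, TopologicalSpace (V x)]
  [TopologicalSpace (TotalSpace F V)] [FiberBundle F V] [VectorBundle ℝ F V]


variable {F' : Type*} [NormedAddCommGroup F'] [NormedSpace ℝ F']
  {W : B → Type*} [∀ x, AddCommGroup (W x)] [∀ x, Module ℝ (W x)] [∀ x, TopologicalSpace (W x)]
  [TopologicalSpace (TotalSpace F' W)] [FiberBundle F' W] [VectorBundle ℝ F' W]

variable (F') in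
/-- The fibre component of the fibre derivative of a map fibred over the identity. -/
noncomputable def fibreDerivSnd (φ : ∀ p : TotalSpace F V, W p.proj) (p : TotalSpace F V) (b : V p.proj) :
    W p.proj :=
  (vertLift I F' W (fibredMap F' φ p)).symm (tangentVert I φ p (vertLift I F V p b))

variable (F') in
/-- Local representative of a fibred map in the chart of the total space with index `e`. -/
noncomputable def fibreRep (e : TotalSpace F V) (φ : ∀ p : TotalSpace F V, W p.proj) (z : EB × F) : F' :=
  (trivializationAt F' W e.proj (fibredMap F' φ ((extChartAt (I.prod 𝓘(ℝ, F)) e).symm z))).2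

theorem fibreRep_extChartAt {e p : TotalSpace F V}
    (hp : p.proj ∈ jetBase (HB := HB) F V e.proj) (φ : ∀ p : TotalSpace F V, W p.proj) :
    fibreRep I F' e φ (extChartAt (I.prod 𝓘(ℝ, F)) e p) =
      (trivializationAt F' W e.proj ⟨p.proj, φ p⟩).2 := by
  rw [fibreRep, (extChartAt (I.prod 𝓘(ℝ, F)) e).left_inv]
  · rfl
  · rw [extChartAt_source]
    exact (mem_chartAt_source_totalSpace e p).2 hp

/-- The charts of the total space are linear on fibres, so fibre lines are straight lines in the
direction `(0, b)`. -/
theorem extChartAt_fibreLine {e p : TotalSpace F V}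
    (hp : p.proj ∈ (trivializationAt F V e.proj).baseSet) (b : V p.proj) (s : ℝ) :
    extChartAt (I.prod 𝓘(ℝ, F)) e (fibreLine p b s) =
      extChartAt (I.prod 𝓘(ℝ, F)) e p + s • ((0 : EB), (trivializationAt F V e.proj ⟨p.proj, b⟩).2) := by
  rw [extChartAt_totalSpace_apply I F V e _ (show (fibreLine p b s).proj ∈ _ from hp),
    extChartAt_totalSpace_apply I F V e p hp]
  refine Prod.ext ?_ (trivializationAt_smul_add e.proj p.proj hp p.2 b s)
  simp [fibreLine]

theorem hasDerivAt_extChartAt_fibreLine {e p : TotalSpace F V}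
    (hp : p.proj ∈ (trivializationAt F V e.proj).baseSet) (b : V p.proj) :
    HasDerivAt (fun s => extChartAt (I.prod 𝓘(ℝ, F)) e (fibreLine p b s))
      ((0 : EB), (trivializationAt F V e.proj ⟨p.proj, b⟩).2) 0 := by
  simp only [extChartAt_fibreLine I hp]
  have h := ((hasDerivAt_id (0 : ℝ)).smul_const
    ((0 : EB), (trivializationAt F V e.proj ⟨p.proj, b⟩).2)).const_add
      (extChartAt (I.prod 𝓘(ℝ, F)) e p)
  rw [one_smul] at h
  exact h

theorem hasDerivAt_fibreLine_of_fibreRep {e p : TotalSpace F V}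
    (hp : p.proj ∈ jetBase (HB := HB) F V e.proj) (φ : ∀ p : TotalSpace F V, W p.proj)
    (hφ : DifferentiableAt ℝ (fibreRep I F' e φ) (extChartAt (I.prod 𝓘(ℝ, F)) e p))
    (b : V p.proj) :
    HasDerivAt (fun s => (trivializationAt F' W e.proj ⟨p.proj, φ (fibreLine p b s)⟩).2)
      (fderiv ℝ (fibreRep I F' e φ) (extChartAt (I.prod 𝓘(ℝ, F)) e p)
        (0, (trivializationAt F V e.proj ⟨p.proj, b⟩).2)) 0 := by
  have h0 : extChartAt (I.prod 𝓘(ℝ, F)) e p =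
      extChartAt (I.prod 𝓘(ℝ, F)) e (fibreLine p b 0) := by
    rw [extChartAt_fibreLine I hp.1, zero_smul, add_zero]
  have h := (hφ.hasFDerivAt.comp_hasDerivAt_of_eq (0 : ℝ)
    (hasDerivAt_extChartAt_fibreLine I hp.1 b) h0)
  refine h.congr_of_eventuallyEq (Filter.Eventually.of_forall fun s => ?_)
  exact (fibreRep_extChartAt I (p := fibreLine p b s) hp φ).symm

variable [I.Boundaryless]

/-- At the centre `p` of its preferred chart, `mfderiv` is by definition the derivative of the chart
representative, and the vertical lift of `b` is the vector `(0, b)`; the fibre component of the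
tangent map can then be read off. -/
theorem trivializationAt_fibreDerivSnd_self {φ : ∀ p : TotalSpace F V, W p.proj}
    {p : TotalSpace F V}
    (hφ : MDifferentiableAt (I.prod 𝓘(ℝ, F)) (I.prod 𝓘(ℝ, F')) (fibredMap F' φ) p)
    (b : V p.proj) :
    (trivializationAt F' W p.proj ⟨p.proj, fibreDerivSnd I F' φ p b⟩).2 =
      fderiv ℝ (fibreRep I F' p φ) (extChartAt (I.prod 𝓘(ℝ, F)) p p)
        (0, (trivializationAt F V p.proj ⟨p.proj, b⟩).2) := by
  have h1 : vertCoord I F' W (fibredMap F' φ p)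
      (vertLift I F' W (fibredMap F' φ p) (fibreDerivSnd I F' φ p b)) =
      vertCoord I F' W (fibredMap F' φ p) (tangentVert I φ p (vertLift I F V p b)) :=
    congrArg _ (LinearEquiv.apply_symm_apply (vertLift I F' W (fibredMap F' φ p)) _)
  have h2 := (vertCoord_vertLiftFun I F' W (fibredMap F' φ p) (fibreDerivSnd I F' φ p b)).symm.trans
    h1
  have h3 := (congrArg (fun T : EB × F →L[ℝ] EB × F' => T (vertCoord I F V p (vertLift I F V p b)))
    (mfderiv_into_totalSpace I F' W (I.prod 𝓘(ℝ, F)) hφ))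
  have h4 := congrArg Prod.snd (h2.trans h3)
  refine h4.trans ?_
  have h5 : (mfderiv (I.prod 𝓘(ℝ, F)) 𝓘(ℝ, F') (fun y => (trivializationAt F' W
      (fibredMap F' φ p).proj (fibredMap F' φ y)).2) p : EB × F →L[ℝ] F') =
      fderiv ℝ (fibreRep I F' p φ) (extChartAt (I.prod 𝓘(ℝ, F)) p p) := by
    rw [((mdifferentiableAt_totalSpace I _).1 hφ).2.mfderiv, ModelWithCorners.range_eq_univ,
      fderivWithin_univ]
    rfl
  have h6 : vertCoord I F V p (vertLift I F V p b) =
      (0, (trivializationAt F V p.proj ⟨p.proj, b⟩).2) := vertCoord_vertLiftFun I F V p b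
  rw [h6]
  exact congrArg (fun T : EB × F →L[ℝ] F' => T (0, (trivializationAt F V p.proj ⟨p.proj, b⟩).2)) h5

variable [IsManifold I ∞ B] [ContMDiffVectorBundle ∞ F V I] [ContMDiffVectorBundle ∞ F' W I]

theorem contDiffAt_fibreRep {φ : ∀ p : TotalSpace F V, W p.proj}
    (hφ : ContMDiff (I.prod 𝓘(ℝ, F)) (I.prod 𝓘(ℝ, F')) ∞ (fibredMap F' φ))
    {e p : TotalSpace F V} (hp : p.proj ∈ jetBase (HB := HB) F V e.proj)
    (hW : p.proj ∈ (trivializationAt F' W e.proj).baseSet) :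
    ContDiffAt ℝ ∞ (fibreRep I F' e φ) (extChartAt (I.prod 𝓘(ℝ, F)) e p) := by
  have h2 := (((trivializationAt F' W e.proj).contMDiffAt_iff (f := fibredMap F' φ)
    ((Trivialization.mem_source _).2 hW)).1 (hφ p)).2
  have hsrc : p ∈ (extChartAt (I.prod 𝓘(ℝ, F)) e).source := by
    rw [extChartAt_source]
    exact (mem_chartAt_source_totalSpace e p).2 hp
  have h3 : ContMDiffAt 𝓘(ℝ, EB × F) (I.prod 𝓘(ℝ, F)) ∞ (extChartAt (I.prod 𝓘(ℝ, F)) e).symm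
      (extChartAt (I.prod 𝓘(ℝ, F)) e p) :=
    (contMDiffOn_extChartAt_symm e).contMDiffAt
      ((isOpen_extChartAt_target e).mem_nhds ((extChartAt (I.prod 𝓘(ℝ, F)) e).map_source hsrc))
  rw [← contMDiffAt_iff_contDiffAt]
  exact ContMDiffAt.comp_of_eq
    (g := fun y => (trivializationAt F' W e.proj (fibredMap F' φ y)).2) h2 h3
    ((extChartAt (I.prod 𝓘(ℝ, F)) e).left_inv hsrc)

/-- This replaces the tangent map definition of the fibre derivative by `d/ds φ(a + s b)` at `s =
0`. The index `i` is free because a derivative inside one fibre can be taken in any trivialization.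
-/
theorem hasDerivAt_fibreLine {φ : ∀ p : TotalSpace F V, W p.proj}
    (hφ : ContMDiff (I.prod 𝓘(ℝ, F)) (I.prod 𝓘(ℝ, F')) ∞ (fibredMap F' φ))
    (p : TotalSpace F V) (b : V p.proj) {i : B} (hi : p.proj ∈ (trivializationAt F' W i).baseSet) :
    HasDerivAt (fun s => (trivializationAt F' W i ⟨p.proj, φ (fibreLine p b s)⟩).2)
      (trivializationAt F' W i ⟨p.proj, fibreDerivSnd I F' φ p b⟩).2 0 := by
  have hm := mem_baseSet_trivializationAt F' W p.proj
  refine hasDerivAt_trivializationAt_change hm hi (c := fun s => φ (fibreLine p b s)) ?_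
  rw [trivializationAt_fibreDerivSnd_self I ((hφ p).mdifferentiableAt (by simp))]
  exact hasDerivAt_fibreLine_of_fibreRep I (mem_jetBase_self p.proj) φ
    ((contDiffAt_fibreRep I hφ (mem_jetBase_self p.proj) hm).differentiableAt (by simp)) b

/-- The index `e` stays fixed while `p` varies, as smoothness in `p` requires. Both sides are
derivatives of the same curve, hence equal by uniqueness. -/
theorem trivializationAt_fibreDerivSnd {φ : ∀ p : TotalSpace F V, W p.proj}
    (hφ : ContMDiff (I.prod 𝓘(ℝ, F)) (I.prod 𝓘(ℝ, F')) ∞ (fibredMap F' φ))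
    {e p : TotalSpace F V} (hp : p.proj ∈ jetBase (HB := HB) F V e.proj)
    (hW : p.proj ∈ (trivializationAt F' W e.proj).baseSet) (b : V p.proj) :
    (trivializationAt F' W e.proj ⟨p.proj, fibreDerivSnd I F' φ p b⟩).2 =
      fderiv ℝ (fibreRep I F' e φ) (extChartAt (I.prod 𝓘(ℝ, F)) e p)
        (0, (trivializationAt F V e.proj ⟨p.proj, b⟩).2) :=
  (hasDerivAt_fibreLine I hφ p b hW).unique (hasDerivAt_fibreLine_of_fibreRep I hp φ
    ((contDiffAt_fibreRep I hφ hp hW).differentiableAt (by simp)) b)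

theorem vertVelocity_fibredMap_fibreLine {φ : ∀ p : TotalSpace F V, W p.proj}
    (hφ : ContMDiff (I.prod 𝓘(ℝ, F)) (I.prod 𝓘(ℝ, F')) ∞ (fibredMap F' φ))
    (p : TotalSpace F V) (b : V p.proj) :
    vertVelocity I (fun s => TotalSpace.mk' F' p.proj (φ (fibreLine p b s))) (fun _ => rfl) =
      ⟨⟨p.proj, φ p⟩, vertLift I F' W ⟨p.proj, φ p⟩ (fibreDerivSnd I F' φ p b)⟩ := by
  have hm := mem_baseSet_trivializationAt F' W p.proj
  refine vertVelocity_eq I hm (c := fun s => φ (fibreLine p b s)) ?_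
    (hasDerivAt_fibreLine I hφ p b hm)
  -- The line starts at `p.2 + 0 • b`; abstracting this vector keeps the fibre `W p.proj` fixed
  -- while it is identified with `p.2`.
  have h : ∀ a : V p.proj, a = p.2 → φ ⟨p.proj, a⟩ = φ p := by
    rintro a rfl
    rfl
  exact h _ (by rw [zero_smul, add_zero])

variable (F') in
/-- The fibre derivative is linear in the fibre. -/
noncomputable def fibreDerivLin (φ : ∀ p : TotalSpace F V, W p.proj)
    (p : TotalSpace F V) : V p.proj →ₗ[ℝ] W p.proj where
  toFun := fibreDerivSnd I F' φ p
  map_add' b c := by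
    have h : tangentVert I (F' := F') (W := W) φ p (vertLift I F V p (b + c)) =
        tangentVert I (F' := F') (W := W) φ p (vertLift I F V p b) +
          tangentVert I (F' := F') (W := W) φ p (vertLift I F V p c) := by
      rw [map_add]
      exact Subtype.ext (map_add (mfderiv (I.prod 𝓘(ℝ, F)) (I.prod 𝓘(ℝ, F')) (fibredMap F' φ) p)
        _ _)
    exact (congrArg (vertLift I F' W (fibredMap F' φ p)).symm h).trans
        (map_add (vertLift I F' W (fibredMap F' φ p)).symm _ _)
  map_smul' r b := by
    have h : tangentVert I (F' := F') (W := W) φ p (vertLift I F V p (r • b)) =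
        r • tangentVert I (F' := F') (W := W) φ p (vertLift I F V p b) := by
      rw [map_smul]
      exact Subtype.ext (map_smul (mfderiv (I.prod 𝓘(ℝ, F)) (I.prod 𝓘(ℝ, F')) (fibredMap F' φ) p)
        r _)
    exact (congrArg (vertLift I F' W (fibredMap F' φ p)).symm h).trans
        (map_smul (vertLift I F' W (fibredMap F' φ p)).symm r _)

end FibreDerivatives

/-! ### The linear connections `h̄` and `h̄_V` -/

section LinearConnections

variable {EB : Type*} [NormedAddCommGroup EB] [NormedSpace ℝ EB]
  {HB : Type*} [TopologicalSpace HB] (I : ModelWithCorners ℝ EB HB) [I.Boundaryless]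
  {B : Type*} [TopologicalSpace B] [ChartedSpace HB B] [IsManifold I ∞ B]
  {F : Type*} [NormedAddCommGroup F] [NormedSpace ℝ F]
  {V : B → Type*} [∀ x, AddCommGroup (V x)] [∀ x, Module ℝ (V x)] [∀ x, TopologicalSpace (V x)]
  [TopologicalSpace (TotalSpace F V)] [FiberBundle F V] [VectorBundle ℝ F V]
  [ContMDiffVectorBundle ∞ F V I]

theorem contMDiff_fibredMap_connection (h : Connection I F V) :
    ContMDiff (I.prod 𝓘(ℝ, F)) (I.prod 𝓘(ℝ, F × (EB →L[ℝ] F))) ∞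
      (fibredMap (F × (EB →L[ℝ] F)) h.toFun) := h.contMDiff_toFun

theorem target_upsilon (p : TotalSpace F V) (j : J1 I F V p.proj) :
    target (I.prod 𝓘(ℝ, F)) F (PB I F V) p (upsilon I F V p j) = target I F V p.proj j := by
  obtain ⟨s, rfl⟩ := jetMk_surjective I p.proj j
  rfl

/-- The target is the first jet coordinate, so it commutes with `d/ds`; differentiating `target (h(a
+ s b)) = a + s b` gives `b`. -/
theorem target_fibreDerivSnd (h : Connection I F V) (p : TotalSpace F V) (b : V p.proj) :
    target I F V p.proj (fibreDerivSnd I (F × (EB →L[ℝ] F)) h.toFun p b) = b := by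
  have hm := mem_jetBase_self (HB := HB) (F := F) (V := V) p.proj
  apply trivializationAt_injective hm.1
  have h1 := hasDerivAt_fibreLine I (contMDiff_fibredMap_connection I h) p b (i := p.proj) hm
  simp only [trivializationAt_J1 I F V p.proj p.proj hm] at h1
  have h2 := (ContinuousLinearMap.fst ℝ F (EB →L[ℝ] F)).hasFDerivAt.comp_hasDerivAt (0 : ℝ) h1
  have h3 : HasDerivAt (fun s : ℝ => (trivializationAt F V p.proj ⟨p.proj, p.2 + s • b⟩).2)
      (trivializationAt F V p.proj ⟨p.proj, b⟩).2 0 := by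
    simp only [trivializationAt_smul_add p.proj p.proj hm.1]
    have h := ((hasDerivAt_id (0 : ℝ)).smul_const
      (trivializationAt F V p.proj ⟨p.proj, b⟩).2).const_add
        (trivializationAt F V p.proj ⟨p.proj, p.2⟩).2
    rw [one_smul] at h
    exact h
  rw [trivializationAt_target I hm]
  refine h2.unique (h3.congr_of_eventuallyEq (Filter.Eventually.of_forall fun s => ?_))
  refine (congrArg Prod.fst (trivializationAt_J1 I F V p.proj p.proj hm
    (h.toFun (fibreLine p b s)))).trans ?_
  refine (trivializationAt_target I hm (h.toFun (fibreLine p b s))).symm.trans ?_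
  exact congrArg (fun v => (trivializationAt F V p.proj ⟨p.proj, v⟩).2)
    (h.target_toFun (fibreLine p b s))

variable (F V) in
/-- The prolongation of `ξ_π` on the fibres of the jet bundles. -/
noncomputable def jetVertLift (p : TotalSpace F V) :
    J1 (I.prod 𝓘(ℝ, F)) F (PB I F V) p →ₗ[ℝ] J1 (I.prod 𝓘(ℝ, F)) F (Vert I F V) p :=
  jetProlong (I.prod 𝓘(ℝ, F)) (V := PB I F V) (W := Vert I F V)
    (fun a => (vertLift I F V a).toLinearMap) (contMDiff_vertLift I F V) p

theorem target_jetVertLift (p : TotalSpace F V) (j : J1 (I.prod 𝓘(ℝ, F)) F (PB I F V) p) :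
    target (I.prod 𝓘(ℝ, F)) F (Vert I F V) p (jetVertLift I F V p j) =
      vertLift I F V p (target (I.prod 𝓘(ℝ, F)) F (PB I F V) p j) := by
  obtain ⟨s, rfl⟩ := jetMk_surjective (I.prod 𝓘(ℝ, F)) p j
  rfl

variable {I}

/-- The linearization of a connection, as a connection on the pullback bundle. -/
noncomputable def linearizedConnection (h : Connection I F V) : Connection (I.prod 𝓘(ℝ, F)) F (PB I F V) where
  toFun q := upsilon I F V q.proj (fibreDerivSnd I (F × (EB →L[ℝ] F)) h.toFun q.proj q.2)
  target_toFun q := (target_upsilon I q.proj _).trans (target_fibreDerivSnd I h q.proj q.2)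
  contMDiff_toFun := by
    intro q₀
    have hφ := contMDiff_fibredMap_connection I h
    have hm := mem_jetBase_self (HB := HB) (F := F) (V := V) q₀.proj.proj
    rw [contMDiffAt_totalSpace]
    refine ⟨contMDiffAt_proj (PB I F V), ?_⟩
    have hq := (contMDiffAt_totalSpace (F := F)).1
      (contMDiffAt_id (x := q₀) (I := (I.prod 𝓘(ℝ, F)).prod 𝓘(ℝ, F)) (n := ∞))
    have hext : ContMDiffAt ((I.prod 𝓘(ℝ, F)).prod 𝓘(ℝ, F)) 𝓘(ℝ, EB × F) ∞
        (fun q : TotalSpace F (PB I F V) => extChartAt (I.prod 𝓘(ℝ, F)) q₀.proj q.proj) q₀ :=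
      (contMDiffAt_extChartAt (I := I.prod 𝓘(ℝ, F)) (x := q₀.proj)).comp q₀
        (contMDiffAt_proj (PB I F V))
    have hrep := (contDiffAt_fibreRep I hφ (e := q₀.proj) (p := q₀.proj) hm hm).fderiv_right
      (m := ∞) (by simp)
    -- In fixed coordinates the fibre derivative is the derivative of the representative of `h` at
    -- the point `a`, applied to `(0, b)`; both the operator and the vector depend smoothly on `(a,
    -- b)`.
    have hk : ContMDiffAt ((I.prod 𝓘(ℝ, F)).prod 𝓘(ℝ, F)) 𝓘(ℝ, F × (EB →L[ℝ] F)) ∞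
        (fun q : TotalSpace F (PB I F V) =>
          fderiv ℝ (fibreRep I (F × (EB →L[ℝ] F)) q₀.proj h.toFun)
            (extChartAt (I.prod 𝓘(ℝ, F)) q₀.proj q.proj)
            ((0 : EB), (trivializationAt F (PB I F V) q₀.proj q).2)) q₀ :=
      (hrep.contMDiffAt.comp q₀ hext).clm_apply
        ((contDiff_prodMk_right (0 : EB)).contMDiff.contMDiffAt.comp q₀ hq.2)
    have hL : ContDiff ℝ ∞ (fun y : F × (EB →L[ℝ] F) =>
        (y.1, y.2.comp (ContinuousLinearMap.fst ℝ EB F))) := by fun_prop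
    refine (hL.contMDiff.contMDiffAt.comp q₀ hk).congr_of_eventuallyEq ?_
    have ho : IsOpen (jetBase (HB := HB) F V q₀.proj.proj) :=
      (trivializationAt F V q₀.proj.proj).open_baseSet.inter
        (chartAt HB q₀.proj.proj).open_source
    have hc : ContinuousAt (fun q : TotalSpace F (PB I F V) => q.proj.proj) q₀ :=
      ((FiberBundle.continuous_proj F V).comp
        (FiberBundle.continuous_proj F (PB I F V))).continuousAt
    filter_upwards [hc.eventually (ho.mem_nhds hm)] with q hq'
    refine (trivializationAt_J1 (I.prod 𝓘(ℝ, F)) F (PB I F V) q₀.proj q.proj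
      (mem_jetBase_PB I hq') _).trans ?_
    rw [jetEquiv_upsilon I hq', ← trivializationAt_J1 I F V q₀.proj.proj q.proj.proj hq']
    exact congrArg (fun y : F × (EB →L[ℝ] F) =>
      (y.1, y.2.comp (ContinuousLinearMap.fst ℝ EB F)))
      (trivializationAt_fibreDerivSnd I hφ (e := q₀.proj) (p := q.proj) hq' hq' q.2)

/-- `hbar` attaches its jet at the target of `h(a)`, which equals `a` only by the section property.
The comparison is therefore made in the total space, moving the base point along that equation. -/
theorem linearizedConnection_mk (h : Connection I F V) (q : TotalSpace F (PB I F V)) :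
    (⟨q.proj, (linearizedConnection h).toFun q⟩ :
      TotalSpace (F × (EB × F →L[ℝ] F)) (J1 (I.prod 𝓘(ℝ, F)) F (PB I F V))) = hbar h q := by
  have key : ∀ (m : B) (a a' : V m) (_ : a = a') (j : J1 I F V m),
      (⟨⟨m, a⟩, upsilon I F V ⟨m, a⟩ j⟩ :
        TotalSpace (F × (EB × F →L[ℝ] F)) (J1 (I.prod 𝓘(ℝ, F)) F (PB I F V))) =
      ⟨⟨m, a'⟩, upsilon I F V ⟨m, a'⟩ j⟩ := by
    rintro m a _ rfl j
    rfl
  exact key q.proj.proj q.proj.2 _ (h.target_toFun q.proj).symm _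

/-- A connection which is linear on the fibres is linear. -/
theorem Connection.isLinear_of_linearMap (h : Connection I F V)
    (hl : ∀ m, ∃ L : V m →ₗ[ℝ] J1 I F V m, ∀ b, h.toFun ⟨m, b⟩ = L b) : h.IsLinear := by
  intro m
  obtain ⟨L, hL⟩ := hl m
  refine ⟨⟨L, ?_⟩, hL⟩
  -- Continuity of the fibre map is inherited from smoothness of the connection, since fibres carry
  -- the topology induced from the total space.
  have h1 := h.contMDiff_toFun.continuous.comp
    (FiberBundle.totalSpaceMk_isInducing F V m).continuous
  refine (FiberBundle.totalSpaceMk_isInducing (F × (EB →L[ℝ] F)) (J1 I F V) m).continuous_iff.2 ?_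
  exact h1.congr fun b => congrArg (TotalSpace.mk m) (hL b)

theorem linearizedConnection_isLinear (h : Connection I F V) :
    (linearizedConnection h).IsLinear :=
  (linearizedConnection h).isLinear_of_linearMap fun p =>
    ⟨(upsilon I F V p).comp (fibreDerivLin I (F × (EB →L[ℝ] F)) h.toFun p), fun _ => rfl⟩

/-- The linearization of a connection, transported to the vertical bundle by the vertical lift. -/
noncomputable def verticalConnectionFun (h : Connection I F V) (z : TotalSpace F (Vert I F V)) :
    J1 (I.prod 𝓘(ℝ, F)) F (Vert I F V) z.proj :=
  jetVertLift I F V z.proj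
    ((linearizedConnection h).toFun ⟨z.proj, (vertLift I F V z.proj).symm z.2⟩)

theorem target_verticalConnectionFun (h : Connection I F V) (z : TotalSpace F (Vert I F V)) :
    target (I.prod 𝓘(ℝ, F)) F (Vert I F V) z.proj (verticalConnectionFun h z) = z.2 := by
  refine (target_jetVertLift I z.proj _).trans ?_
  have h1 := (linearizedConnection h).target_toFun ⟨z.proj, (vertLift I F V z.proj).symm z.2⟩
  exact (congrArg (vertLift I F V z.proj) h1).trans
    (LinearEquiv.apply_symm_apply (vertLift I F V z.proj) z.2)

/-- The prolonged vertical lift leaves jet coordinates unchanged, so the coordinates to be shown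
smooth are those of `linearizedConnection` composed with the smooth inverse of `ξ_π`. -/
theorem contMDiff_verticalConnectionFun (h : Connection I F V) :
    ContMDiff ((I.prod 𝓘(ℝ, F)).prod 𝓘(ℝ, F))
      ((I.prod 𝓘(ℝ, F)).prod 𝓘(ℝ, F × (EB × F →L[ℝ] F))) ∞
      (fun z : TotalSpace F (Vert I F V) => (⟨z.proj, verticalConnectionFun h z⟩ :
        TotalSpace (F × (EB × F →L[ℝ] F)) (J1 (I.prod 𝓘(ℝ, F)) F (Vert I F V)))) := by
  have h1 : ContMDiff ((I.prod 𝓘(ℝ, F)).prod 𝓘(ℝ, F)) ((I.prod 𝓘(ℝ, F)).prod 𝓘(ℝ, F)) ∞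
      (fun z : TotalSpace F (Vert I F V) =>
        (⟨z.proj, (vertLift I F V z.proj).symm z.2⟩ : TotalSpace F (PB I F V))) :=
    contMDiff_totalEquiv (I.prod 𝓘(ℝ, F)) (vertEquivPB I F V)
  have h2 := (linearizedConnection h).contMDiff_toFun.comp h1
  intro z₀
  have h3 := (contMDiffAt_totalSpace (F := F × (EB × F →L[ℝ] F))).1 (h2 z₀)
  rw [contMDiffAt_totalSpace]
  refine ⟨contMDiffAt_proj (Vert I F V), h3.2.congr_of_eventuallyEq ?_⟩
  have hm := mem_jetBase_self (HB := HB) (F := F) (V := V) z₀.proj.proj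
  have ho : IsOpen (jetBase (HB := HB) F V z₀.proj.proj) :=
    (trivializationAt F V z₀.proj.proj).open_baseSet.inter
      (chartAt HB z₀.proj.proj).open_source
  have hc : ContinuousAt (fun z : TotalSpace F (Vert I F V) => z.proj.proj) z₀ :=
    ((FiberBundle.continuous_proj F V).comp
      (FiberBundle.continuous_proj F (Vert I F V))).continuousAt
  filter_upwards [hc.eventually (ho.mem_nhds hm)] with z hz
  refine (trivializationAt_J1 (I.prod 𝓘(ℝ, F)) F (Vert I F V) z₀.proj z.proj
    (mem_jetBase_Vert I hz) _).trans ((jetEquiv_jetProlong_vertLift I hz _).trans ?_)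
  exact (trivializationAt_J1 (I.prod 𝓘(ℝ, F)) F (PB I F V) z₀.proj z.proj
    (mem_jetBase_PB I hz) _).symm

/-- The linearization of a connection, as a connection on the vertical bundle. -/
noncomputable def verticalConnection (h : Connection I F V) : Connection (I.prod 𝓘(ℝ, F)) F (Vert I F V) where
  toFun := verticalConnectionFun h
  target_toFun := target_verticalConnectionFun h
  contMDiff_toFun := contMDiff_verticalConnectionFun h

theorem verticalConnection_isLinear (h : Connection I F V) : (verticalConnection h).IsLinear := by
  refine (verticalConnection h).isLinear_of_linearMap fun p => ?_
  obtain ⟨L, hL⟩ := linearizedConnection_isLinear h p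
  exact ⟨(jetVertLift I F V p).comp
      (L.toLinearMap.comp (vertLift I F V p).symm.toLinearMap), fun b => congrArg _ (hL _)⟩

/-- For `z = ξ_π(a, b)`, the jet `𝓥h(z)` has components `h(a)` and the fibre derivative `k`. The
first contributes to `Ψ_V` only its target `a`; the second passes through `Υ` and `j^1 ξ_π`, as in
the definition of `verticalConnection`. -/
theorem verticalConnection_mk (h : Connection I F V) (z : TotalSpace F (Vert I F V)) :
    (⟨z.proj, (verticalConnection h).toFun z⟩ :
      TotalSpace (F × (EB × F →L[ℝ] F)) (J1 (I.prod 𝓘(ℝ, F)) F (Vert I F V))) = hbarVert h z := by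
  have hφ := contMDiff_fibredMap_connection I h
  set b := (vertLift I F V z.proj).symm z.2 with hb
  set k := fibreDerivSnd I (F × (EB →L[ℝ] F)) h.toFun z.proj b with hk
  -- The value of `vj` is guessed as the pair `(h(a), k)` and confirmed by applying `vj` to its
  -- image under `vjInv`; no family of sections has to be produced.
  obtain ⟨ϑ, h1, h2⟩ := exists_jetProlong_vertM I (h.toFun z.proj) k
  have h3 : vertProlong h z = ⟨z.proj.proj, ϑ⟩ := by
    refine (congrArg (vj I F) (vertVelocity_fibredMap_fibreLine I hφ z.proj b)).trans ?_
    refine Eq.trans ?_ (vj_vjInv I ⟨z.proj.proj, ϑ⟩)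
    rw [vjInv, h1, h2]
  have h4 : (target I (F × F) (VertM I F V) z.proj.proj ϑ).1 = z.proj.2 := by
    refine (target_jetProlong I (vertMFst I F V) (contMDiff_vertMFst I F V) z.proj.proj ϑ).symm.trans ?_
    rw [h1, h.target_toFun]
  have key : ∀ (m : B) (a a' : V m) (_ : a = a') (j : J1 I (F × F) (VertM I F V) m),
      (⟨⟨m, a⟩, iotaVertJet I F V ⟨m, a⟩ j⟩ :
        TotalSpace (F × (EB × F →L[ℝ] F)) (J1 (I.prod 𝓘(ℝ, F)) F (Vert I F V))) =
      ⟨⟨m, a'⟩, iotaVertJet I F V ⟨m, a'⟩ j⟩ := by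
    rintro m a _ rfl j
    rfl
  rw [hbarVert, h3]
  refine Eq.trans ?_ (key z.proj.proj _ _ h4.symm ϑ)
  refine congrArg (TotalSpace.mk z.proj) ?_
  refine congrArg (fun j => jetVertLift I F V z.proj
      (upsilon I F V z.proj j)) h2.symm

theorem jetXi_hbar (h : Connection I F V) (q : TotalSpace F (PB I F V)) :
    jetXi I F V (hbar h q) = hbarVert h (xi I F V q) := by
  rw [← linearizedConnection_mk, ← verticalConnection_mk]
  refine congrArg (TotalSpace.mk q.proj) ?_
  refine congrArg (fun b => jetVertLift I F V q.proj
      ((linearizedConnection h).toFun ⟨q.proj, b⟩)) ?_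
  exact (LinearEquiv.symm_apply_apply (vertLift I F V q.proj) q.2).symm

end LinearConnections

/-! ### Velocities in preferred charts -/

section ChartVelocity

variable {EP : Type*} [NormedAddCommGroup EP] [NormedSpace ℝ EP]
  {HP : Type*} [TopologicalSpace HP] (J : ModelWithCorners ℝ EP HP)
  {P : Type*} [TopologicalSpace P] [ChartedSpace HP P]

/-- The velocity of a curve is computed in the preferred chart at its initial point. -/
theorem velocityPoint_eq_of_hasDerivAt {c : ℝ → P} {p : P} {u : EP} (h0 : c 0 = p)
    (hsrc : ∀ᶠ t in 𝓝 (0 : ℝ), c t ∈ (chartAt HP p).source)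
    (hd : HasDerivAt (fun t => extChartAt J p (c t)) u 0) :
    velocityPoint J c = (⟨p, u⟩ : TangentBundle J P) := by
  subst h0
  -- A manifold derivative includes continuity, recovered here from the chart expression because the
  -- curve stays in the chart domain near `0`.
  have hc : ContinuousAt c 0 := by
    have h1 : ContinuousAt (fun t => (extChartAt J (c 0)).symm (extChartAt J (c 0) (c t))) 0 :=
      ContinuousAt.comp (g := (extChartAt J (c 0)).symm) (continuousAt_extChartAt_symm (c 0))
        hd.continuousAt
    refine h1.congr ?_
    filter_upwards [hsrc] with t ht
    exact (extChartAt J (c 0)).left_inv (by rwa [extChartAt_source])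
  have hm : HasMFDerivAt 𝓘(ℝ, ℝ) J c 0 (ContinuousLinearMap.toSpanSingleton ℝ u) :=
    ⟨hc, hd.hasFDerivAt.hasFDerivWithinAt⟩
  refine congrArg (TotalSpace.mk (c 0)) ?_
  have h2 := congrArg (fun T : ℝ →L[ℝ] EP => T 1) hm.mfderiv
  exact h2.trans (one_smul ℝ u)

variable [IsManifold J 1 P]

/-- Tangent vectors at a point whose preferred chart is the one at `p` have the same coordinates
in the trivialization of the tangent bundle at `p`. -/
theorem trivializationAt_tangent_of_chartAt_eq {p q : P} (h : chartAt HP q = chartAt HP p)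
    (v : EP) :
    (trivializationAt EP (TangentSpace J) p (⟨q, v⟩ : TangentBundle J P)).2 = v := by
  have hq : q ∈ (chartAt HP p).source := h ▸ mem_chart_source HP q
  have h1 : achart HP q = achart HP p := Subtype.ext h
  change (tangentBundleCore J P).coordChange (achart HP q) (achart HP p) q v = v
  rw [h1]
  exact (tangentBundleCore J P).coordChange_self (achart HP p) q hq v

end ChartVelocity

/-! ### The horizontal lift of `h̄` and the linearization formula -/

section Linearizations

variable {EB : Type*} [NormedAddCommGroup EB] [NormedSpace ℝ EB]
  {HB : Type*} [TopologicalSpace HB] (I : ModelWithCorners ℝ EB HB) [I.Boundaryless]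
  {B : Type*} [TopologicalSpace B] [ChartedSpace HB B] [IsManifold I ∞ B]
  {F : Type*} [NormedAddCommGroup F] [NormedSpace ℝ F]
  {V : B → Type*} [∀ x, AddCommGroup (V x)] [∀ x, Module ℝ (V x)] [∀ x, TopologicalSpace (V x)]
  [TopologicalSpace (TotalSpace F V)] [FiberBundle F V] [VectorBundle ℝ F V]
  [ContMDiffVectorBundle ∞ F V I]

/-- The preferred chart depends only on the base point of its index. Hence tangent vectors along a
whole fibre are expressed in the same coordinates, and no transition map appears when a curve of
tangent vectors over a fibre line is differentiated. -/
theorem chartAt_totalSpace_fibre (m : B) (a b : V m) :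
    chartAt (ModelProd HB F) (⟨m, a⟩ : TotalSpace F V) =
      chartAt (ModelProd HB F) (⟨m, b⟩ : TotalSpace F V) := by
  rw [FiberBundle.chartedSpace_chartAt, FiberBundle.chartedSpace_chartAt]

theorem extChartAt_tangent_fibre (m : B) (a b : V m) (v w : EB × F) :
    extChartAt (I.prod 𝓘(ℝ, F)).tangent
      (⟨⟨m, a⟩, v⟩ : TangentBundle (I.prod 𝓘(ℝ, F)) (TotalSpace F V))
      (⟨⟨m, b⟩, w⟩ : TangentBundle (I.prod 𝓘(ℝ, F)) (TotalSpace F V)) =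
      ((extChartAt I m m, (trivializationAt F V m ⟨m, b⟩).2), w) := by
  haveI : IsManifold (I.prod 𝓘(ℝ, F)) 1 (TotalSpace F V) :=
    IsManifold.of_le (n := ∞) (by norm_cast)
  have hb : (⟨m, b⟩ : TotalSpace F V) ∈ (chartAt (ModelProd HB F) (⟨m, a⟩ : TotalSpace F V)).source :=
    (mem_chartAt_source_totalSpace (⟨m, a⟩ : TotalSpace F V) ⟨m, b⟩).2 (mem_jetBase_self m)
  refine (extChartAt_totalSpace_apply (I.prod 𝓘(ℝ, F)) (EB × F)
    (TangentSpace (I.prod 𝓘(ℝ, F)) : TotalSpace F V → Type _) ⟨⟨m, a⟩, v⟩ ⟨⟨m, b⟩, w⟩ hb).trans ?_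
  refine Prod.ext ?_ ?_
  · exact extChartAt_totalSpace_apply I F V ⟨m, a⟩ ⟨m, b⟩ (mem_baseSet_trivializationAt F V m)
  · exact trivializationAt_tangent_of_chartAt_eq (I.prod 𝓘(ℝ, F)) (p := (⟨m, a⟩ : TotalSpace F V))
      (q := ⟨m, b⟩) (chartAt_totalSpace_fibre m b a) w

/-- The velocity of a curve in `TE` over an affine curve in a fibre of `E`. -/
theorem velocityPoint_tangent_fibre (m : B) (a b : V m) {v : ℝ → EB × F} {u : EB × F}
    (hv : HasDerivAt v u 0) :
    velocityPoint (I.prod 𝓘(ℝ, F)).tangent (fun s : ℝ =>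
      (⟨⟨m, a + s • b⟩, v s⟩ : TangentBundle (I.prod 𝓘(ℝ, F)) (TotalSpace F V))) =
    ⟨⟨⟨m, a⟩, v 0⟩, ((0, (trivializationAt F V m ⟨m, b⟩).2), u)⟩ := by
  haveI : IsManifold (I.prod 𝓘(ℝ, F)) 1 (TotalSpace F V) :=
    IsManifold.of_le (n := ∞) (by norm_cast)
  have hm := mem_baseSet_trivializationAt F V m
  refine velocityPoint_eq_of_hasDerivAt (I.prod 𝓘(ℝ, F)).tangent ?_ ?_ ?_
  · rw [zero_smul, add_zero]
  · refine Filter.Eventually.of_forall fun s => ?_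
    refine (mem_chartAt_source_totalSpace (F := EB × F)
      (V := (TangentSpace (I.prod 𝓘(ℝ, F)) : TotalSpace F V → Type _)) _ _).2 ?_
    have hb : (⟨m, a + s • b⟩ : TotalSpace F V) ∈
        (chartAt (ModelProd HB F) (⟨m, a⟩ : TotalSpace F V)).source :=
      (mem_chartAt_source_totalSpace (⟨m, a⟩ : TotalSpace F V) ⟨m, a + s • b⟩).2
        (mem_jetBase_self m)
    exact ⟨hb, hb⟩
  · simp only [extChartAt_tangent_fibre]
    refine ((hasDerivAt_const (0 : ℝ) _).prodMk ?_).prodMk hv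
    simp only [trivializationAt_smul_add m m hm]
    have h := ((hasDerivAt_id (0 : ℝ)).smul_const (trivializationAt F V m ⟨m, b⟩).2).const_add
      (trivializationAt F V m ⟨m, a⟩).2
    rw [one_smul] at h
    exact h

/-- A jet, as a linear map in preferred charts. -/
theorem jetMap_apply (m : B) (j : J1 I F V m) (w : EB) :
    (jetMap I F V m j w : EB × F) =
      (w, (jetEquiv I (mem_jetBase_self (HB := HB) (F := F) (V := V) m) j).2 w) := by
  obtain ⟨s, rfl⟩ := jetMk_surjective I m j
  have h := (jetMap_jetMk I F V m s).trans (mfderiv_section I s.2)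
  exact congrArg (fun T : EB →L[ℝ] EB × F => T w) h

theorem horLift_eq (h : Connection I F V) (p : TotalSpace F V) (w : EB) :
    horLift h p w = (⟨p, (w, (jetEquiv I (mem_jetBase_self (HB := HB) (F := F) (V := V) p.proj)
      (h.toFun p)).2 w)⟩ : TangentBundle (I.prod 𝓘(ℝ, F)) (TotalSpace F V)) := by
  have key : ∀ (m : B) (a a' : V m) (_ : a = a') (v v' : EB × F) (_ : v = v'),
      (⟨⟨m, a⟩, v⟩ : TangentBundle (I.prod 𝓘(ℝ, F)) (TotalSpace F V)) = ⟨⟨m, a'⟩, v'⟩ := by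
    rintro m a _ rfl v _ rfl
    rfl
  exact key p.proj _ p.2 (h.target_toFun p) _ _ (jetMap_apply I p.proj (h.toFun p) w)

/-- The curve in `B` which is affine in the preferred chart at `m`. -/
noncomputable def chartCurve (m : B) (w : EB) (t : ℝ) : B :=
  (extChartAt I m).symm (extChartAt I m m + t • w)

variable (F V) in
/-- The lift of `chartCurve` to `E` which is affine in the preferred trivialization at `m`. -/
noncomputable def fibreCurve (m : B) (w : EB) (y u : F) (t : ℝ) : V (chartCurve I m w t) :=
  (trivializationAt F V m).symm (chartCurve I m w t) (y + t • u)

/-- The curve is affine in the chart only for small `t`; outside the chart target the inverse chart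
has no prescribed meaning. -/
theorem eventually_chartCurve (m : B) (w : EB) : ∀ᶠ t in 𝓝 (0 : ℝ),
    chartCurve I m w t ∈ jetBase (HB := HB) F V m ∧
      extChartAt I m (chartCurve I m w t) = extChartAt I m m + t • w := by
  have hc : ContinuousAt (fun t : ℝ => extChartAt I m m + t • w) 0 := by fun_prop
  have h := eventually_jetBase I (mem_jetBase_self (HB := HB) (F := F) (V := V) m)
  rw [show extChartAt I m m = extChartAt I m m + (0 : ℝ) • w by rw [zero_smul, add_zero]] at h
  have h2 := hc.eventually h
  exact h2.mono fun t ht => ⟨ht.1, (extChartAt I m).right_inv ht.2⟩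

theorem chartCurve_zero (m : B) (w : EB) : chartCurve I m w 0 = m := by
  rw [chartCurve, zero_smul, add_zero, extChartAt_to_inv]

theorem contMDiffAt_chartCurve (m : B) (w : EB) :
    ContMDiffAt 𝓘(ℝ, ℝ) I ∞ (chartCurve I m w) 0 := by
  have h1 : ContMDiffAt 𝓘(ℝ, EB) I ∞ (extChartAt I m).symm (extChartAt I m m) :=
    (contMDiffOn_extChartAt_symm m).contMDiffAt
      ((isOpen_extChartAt_target m).mem_nhds (mem_extChartAt_target m))
  have h2 : ContDiff ℝ ∞ (fun t : ℝ => extChartAt I m m + t • w) := by fun_prop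
  exact ContMDiffAt.comp_of_eq (g := (extChartAt I m).symm) h1 h2.contMDiff.contMDiffAt
    (by rw [zero_smul, add_zero])

theorem contMDiffAt_fibreCurve (m : B) (w : EB) (y u : F) :
    ContMDiffAt 𝓘(ℝ, ℝ) (I.prod 𝓘(ℝ, F)) ∞
      (fun t => TotalSpace.mk' F (chartCurve I m w t) (fibreCurve I F V m w y u t)) 0 := by
  have hm : chartCurve I m w 0 ∈ (trivializationAt F V m).baseSet := by
    rw [chartCurve_zero]
    exact mem_baseSet_trivializationAt F V m
  rw [(trivializationAt F V m).contMDiffAt_iff ((Trivialization.mem_source _).2 hm)]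
  have h2 : ContDiff ℝ ∞ (fun t : ℝ => y + t • u) := by fun_prop
  refine ⟨contMDiffAt_chartCurve I m w, h2.contMDiff.contMDiffAt.congr_of_eventuallyEq ?_⟩
  filter_upwards [eventually_chartCurve I (F := F) (V := V) m w] with t ht
  exact congrArg Prod.snd (Trivialization.apply_mk_symm _ ht.1.1 _)

/-- The velocity of a curve over `chartCurve` whose fibre coordinate is affine. -/
theorem velocityPoint_over_chartCurve (m : B) (w : EB) (u : F)
    {γ : ∀ t, V (chartCurve I m w t)} {a : V m}
    (hγ : ∀ᶠ t in 𝓝 (0 : ℝ), (trivializationAt F V m ⟨chartCurve I m w t, γ t⟩).2 =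
      (trivializationAt F V m ⟨m, a⟩).2 + t • u) :
    velocityPoint (I.prod 𝓘(ℝ, F)) (fun t => TotalSpace.mk' F (chartCurve I m w t) (γ t)) =
      (⟨⟨m, a⟩, (w, u)⟩ : TangentBundle (I.prod 𝓘(ℝ, F)) (TotalSpace F V)) := by
  have hm := mem_baseSet_trivializationAt F V m
  have hev := eventually_chartCurve I (F := F) (V := V) m w
  refine velocityPoint_eq_of_hasDerivAt (I.prod 𝓘(ℝ, F)) ?_ ?_ ?_
  · have h0 := hγ.self_of_nhds
    rw [zero_smul, add_zero] at h0
    -- The fibre at the start of the curve is that over `chartCurve I m w 0`, which is `m` only by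
    -- an equation; generalising over `x` allows the substitution.
    have h1 : ∀ (x : B) (_ : x = m) (v : V x), (trivializationAt F V m ⟨x, v⟩).2 =
        (trivializationAt F V m ⟨m, a⟩).2 → TotalSpace.mk' F x v = ⟨m, a⟩ := by
      rintro x rfl v hv
      exact congrArg (TotalSpace.mk x) (trivializationAt_injective hm hv)
    exact h1 _ (chartCurve_zero I m w) _ h0
  · filter_upwards [hev] with t ht
    exact (mem_chartAt_source_totalSpace (⟨m, a⟩ : TotalSpace F V) _).2 ht.1
  · have hline : ∀ {X : Type _} [NormedAddCommGroup X] [NormedSpace ℝ X] (x v : X),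
        HasDerivAt (fun t : ℝ => x + t • v) v 0 := by
      intro X _ _ x v
      have h := ((hasDerivAt_id (0 : ℝ)).smul_const v).const_add x
      rw [one_smul] at h
      exact h
    refine (hline (extChartAt I m m, (trivializationAt F V m ⟨m, a⟩).2) (w, u)).congr_of_eventuallyEq
      ?_
    filter_upwards [hev, hγ] with t ht htγ
    rw [extChartAt_totalSpace_apply I F V ⟨m, a⟩ _ ht.1.1]
    exact Prod.ext ht.2 htγ

/-- The map `(a, b) ↦ b` on the pullback bundle. -/
theorem contMDiff_pullback_snd : ContMDiff ((I.prod 𝓘(ℝ, F)).prod 𝓘(ℝ, F)) (I.prod 𝓘(ℝ, F)) ∞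
    (fun q : TotalSpace F (PB I F V) => TotalSpace.mk' F q.proj.proj q.2) := by
  intro q
  have hq := (contMDiffAt_totalSpace (F := F)).1
    (contMDiffAt_id (x := q) (I := (I.prod 𝓘(ℝ, F)).prod 𝓘(ℝ, F)) (n := ∞))
  rw [contMDiffAt_totalSpace]
  exact ⟨ContMDiffAt.comp (g := (TotalSpace.proj : TotalSpace F V → B))
    (f := (TotalSpace.proj : TotalSpace F (PB I F V) → TotalSpace F V)) q
    (contMDiffAt_proj V) (contMDiffAt_proj (PB I F V)), hq.2⟩

/-- The second component of the horizontal lift of the linearized connection. -/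
theorem tangentMap_horLift_linearizedConnection (h : Connection I F V)
    (q : TotalSpace F (PB I F V)) (w : EB × F) :
    tangentMap ((I.prod 𝓘(ℝ, F)).prod 𝓘(ℝ, F)) (I.prod 𝓘(ℝ, F))
        (fun q' : TotalSpace F (PB I F V) => TotalSpace.mk' F q'.proj.proj q'.2)
        (horLift (linearizedConnection h) q w) =
      (⟨⟨q.proj.proj, q.2⟩, (w.1,
        (jetEquiv I (mem_jetBase_self (HB := HB) (F := F) (V := V) q.proj.proj)
          (fibreDerivSnd I (F × (EB →L[ℝ] F)) h.toFun q.proj q.2)).2 w.1)⟩ :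
        TangentBundle (I.prod 𝓘(ℝ, F)) (TotalSpace F V)) := by
  have ht := target_fibreDerivSnd I h q.proj q.2
  -- A section `s` representing `k` turns the horizontal lift of `h̄` into the tangent map of `p ↦
  -- (p, s (π p))`.
  obtain ⟨s, hs⟩ := jetMk_surjective I q.proj.proj
    (fibreDerivSnd I (F × (EB →L[ℝ] F)) h.toFun q.proj q.2)
  have hsm : s.1 q.proj.proj = q.2 := by
    rw [← hs] at ht
    exact ht
  have hlift : horLift (linearizedConnection h) q w =
      (⟨⟨q.proj, s.1 q.proj.proj⟩, mfderiv (I.prod 𝓘(ℝ, F)) ((I.prod 𝓘(ℝ, F)).prod 𝓘(ℝ, F))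
        (fun p : TotalSpace F V => (⟨p, s.1 p.proj⟩ : TotalSpace F (PB I F V))) q.proj w⟩ :
        TangentBundle ((I.prod 𝓘(ℝ, F)).prod 𝓘(ℝ, F)) (TotalSpace F (PB I F V))) := by
    have h1 : (linearizedConnection h).toFun q =
        jetMk (I.prod 𝓘(ℝ, F)) F (PB I F V) q.proj (iotaSec I F V q.proj s) :=
      congrArg (upsilon I F V q.proj) hs.symm
    refine (congrArg (fun j : J1 (I.prod 𝓘(ℝ, F)) F (PB I F V) q.proj =>
      (⟨⟨q.proj, target (I.prod 𝓘(ℝ, F)) F (PB I F V) q.proj j⟩,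
        jetMap (I.prod 𝓘(ℝ, F)) F (PB I F V) q.proj j w⟩ :
        TangentBundle ((I.prod 𝓘(ℝ, F)).prod 𝓘(ℝ, F)) (TotalSpace F (PB I F V)))) h1).trans ?_
    exact congrArg (fun T : EB × F →L[ℝ] (EB × F) × F =>
      (⟨⟨q.proj, s.1 q.proj.proj⟩, T w⟩ :
        TangentBundle ((I.prod 𝓘(ℝ, F)).prod 𝓘(ℝ, F)) (TotalSpace F (PB I F V))))
      (jetMap_jetMk (I.prod 𝓘(ℝ, F)) F (PB I F V) q.proj (iotaSec I F V q.proj s))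
  rw [hlift]
  have hsec : ContMDiffAt (I.prod 𝓘(ℝ, F)) ((I.prod 𝓘(ℝ, F)).prod 𝓘(ℝ, F)) ∞
      (fun p : TotalSpace F V => (⟨p, s.1 p.proj⟩ : TotalSpace F (PB I F V))) q.proj :=
    (iotaSec I F V q.proj s).2.self_of_nhds
  have hsec' : ContMDiffAt I (I.prod 𝓘(ℝ, F)) ∞ (fun y => TotalSpace.mk' F y (s.1 y))
      q.proj.proj := s.2.self_of_nhds
  -- Following `p ↦ (p, s (π p))` by `(a, b) ↦ b` gives `s ∘ π`; the chain rule for the two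
  -- factorisations yields the tangent map of `s` applied to `Tπ w`.
  have hc1 := mfderiv_comp_apply (x := q.proj)
    ((contMDiff_pullback_snd I (F := F) (V := V)
      (⟨q.proj, s.1 q.proj.proj⟩ : TotalSpace F (PB I F V))).mdifferentiableAt (by simp))
    (hsec.mdifferentiableAt (by simp)) w
  have hc2 := mfderiv_comp_apply (x := q.proj) (hsec'.mdifferentiableAt (by simp))
    (mdifferentiableAt_proj V (p := q.proj) (IB := I)) w
  have hπ := congrArg (fun T : EB × F →L[ℝ] EB => T w) (mfderiv_bundleProj I F V q.proj)
  have hv : (mfderiv ((I.prod 𝓘(ℝ, F)).prod 𝓘(ℝ, F)) (I.prod 𝓘(ℝ, F))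
      (fun q' : TotalSpace F (PB I F V) => TotalSpace.mk' F q'.proj.proj q'.2)
      (⟨q.proj, s.1 q.proj.proj⟩ : TotalSpace F (PB I F V))
      (mfderiv (I.prod 𝓘(ℝ, F)) ((I.prod 𝓘(ℝ, F)).prod 𝓘(ℝ, F))
        (fun p : TotalSpace F V => (⟨p, s.1 p.proj⟩ : TotalSpace F (PB I F V))) q.proj w) :
        EB × F) = (w.1,
        (jetEquiv I (mem_jetBase_self (HB := HB) (F := F) (V := V) q.proj.proj)
          (fibreDerivSnd I (F × (EB →L[ℝ] F)) h.toFun q.proj q.2)).2 w.1) := by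
    refine hc1.symm.trans (hc2.trans ?_)
    rw [← hs]
    refine Eq.trans ?_ (jetMap_apply I q.proj.proj (jetMk I F V q.proj.proj s) w.1)
    refine Eq.trans ?_ (congrArg (fun T : EB →L[ℝ] EB × F => T w.1)
      (jetMap_jetMk I F V q.proj.proj s).symm)
    exact congrArg (mfderiv I (I.prod 𝓘(ℝ, F)) (fun y => TotalSpace.mk' F y (s.1 y)) q.proj.proj :
      EB →L[ℝ] EB × F) hπ
  have key : ∀ (m : B) (a a' : V m) (_ : a = a') (v v' : EB × F) (_ : v = v'),
      (⟨⟨m, a⟩, v⟩ : TangentBundle (I.prod 𝓘(ℝ, F)) (TotalSpace F V)) = ⟨⟨m, a'⟩, v'⟩ := by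
    rintro m a _ rfl v _ rfl
    rfl
  exact key q.proj.proj _ q.2 hsm _ _ hv

/-- In the preferred chart at `m` the lifts `ξ^H(a + s b, w₁)` and the vectors `v + s u` of the
fibre of `Tπ` are both curves over the line `a + s b`. They start at the same vector and have the
same derivative, so their velocities agree even though the curves differ when `h` is nonlinear. -/
theorem isLinearization_linearizedConnection (h : Connection I F V) :
    IsLinearization h (linearizedConnection h) := by
  intro q w
  have hπ : (mfderiv (I.prod 𝓘(ℝ, F)) I (TotalSpace.proj : TotalSpace F V → B) q.proj w : EB) =
      (w : EB × F).1 :=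
    congrArg (fun T : EB × F →L[ℝ] EB => T w) (mfderiv_bundleProj I F V q.proj)
  rw [tangentMap_horLift_linearizedConnection I h q w]
  obtain ⟨⟨m, a⟩, b⟩ := q
  obtain ⟨w₁, w₂⟩ := w
  change V m at b
  have hm := mem_jetBase_self (HB := HB) (F := F) (V := V) m
  have hlift : ∀ p : TotalSpace F V, ∀ w' : EB, w' = w₁ → horLift h p w' =
      (⟨p, (w₁, (jetEquiv I (mem_jetBase_self (HB := HB) (F := F) (V := V) p.proj)
      (h.toFun p)).2 w₁)⟩ : TangentBundle (I.prod 𝓘(ℝ, F)) (TotalSpace F V)) := by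
    rintro p _ rfl
    exact horLift_eq I h p _
  set k : J1 I F V m := fibreDerivSnd I (F × (EB →L[ℝ] F)) h.toFun ⟨m, a⟩ b with hk
  have hd := hasDerivAt_fibreLine I (contMDiff_fibredMap_connection I h) ⟨m, a⟩ b (i := m) hm
  have hd2 : HasDerivAt (fun s : ℝ => (w₁, (jetEquiv I hm (h.toFun ⟨m, a + s • b⟩)).2 w₁))
      ((0 : EB), (jetEquiv I hm k).2 w₁) 0 := by
    have e1 := (((ContinuousLinearMap.apply ℝ F w₁).comp
      (ContinuousLinearMap.snd ℝ F (EB →L[ℝ] F))).hasFDerivAt).comp_hasDerivAt (0 : ℝ) hd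
    rw [trivializationAt_J1 I F V m m hm] at e1
    refine (hasDerivAt_const (0 : ℝ) w₁).prodMk (e1.congr_of_eventuallyEq ?_)
    refine Filter.Eventually.of_forall fun s => ?_
    exact congrArg (fun y : F × (EB →L[ℝ] F) => y.2 w₁)
      (trivializationAt_J1 I F V m m hm (h.toFun ⟨m, a + s • b⟩)).symm
  -- `A` is the fibre coordinate of `ξ^H(a, w₁)`, and `K` is its derivative in the direction `b`.
  set A : F := (jetEquiv I hm (h.toFun ⟨m, a⟩)).2 w₁ with hA
  set K : F := (jetEquiv I hm k).2 w₁ with hK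
  -- The witnesses lie over one base curve with velocity `w₁`, with fibre coordinates `a + t A` and
  -- `b + t K`. Their combination then has fibre coordinate `(a + s b) + t (A + s K)`, hence
  -- velocity `(w₁, A + s K)` at `a + s b`.
  refine ⟨chartCurve I m w₁, fibreCurve I F V m w₁ (trivializationAt F V m ⟨m, a⟩).2 A,
    fibreCurve I F V m w₁ (trivializationAt F V m ⟨m, b⟩).2 K,
    contMDiffAt_fibreCurve I m w₁ _ _, contMDiffAt_fibreCurve I m w₁ _ _, ?_, ?_, ?_⟩
  · rw [hlift _ _ hπ]
    refine velocityPoint_over_chartCurve I m w₁ A (a := a) ?_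
    filter_upwards [eventually_chartCurve I (F := F) (V := V) m w₁] with t ht
    exact congrArg Prod.snd (Trivialization.apply_mk_symm _ ht.1.1 _)
  · refine velocityPoint_over_chartCurve I m w₁ K (a := b) ?_
    filter_upwards [eventually_chartCurve I (F := F) (V := V) m w₁] with t ht
    exact congrArg Prod.snd (Trivialization.apply_mk_symm _ ht.1.1 _)
  · have hsum : ∀ s : ℝ, velocityPoint (I.prod 𝓘(ℝ, F)) (fun t => TotalSpace.mk' F
        (chartCurve I m w₁ t) (fibreCurve I F V m w₁ (trivializationAt F V m ⟨m, a⟩).2 A t +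
          s • fibreCurve I F V m w₁ (trivializationAt F V m ⟨m, b⟩).2 K t)) =
        (⟨⟨m, a + s • b⟩, (w₁, A + s • K)⟩ :
          TangentBundle (I.prod 𝓘(ℝ, F)) (TotalSpace F V)) := by
      intro s
      refine velocityPoint_over_chartCurve I m w₁ (A + s • K) (a := a + s • b) ?_
      filter_upwards [eventually_chartCurve I (F := F) (V := V) m w₁] with t ht
      rw [trivializationAt_smul_add m _ ht.1.1, trivializationAt_smul_add m m hm.1]
      have e : ∀ y u : F, (trivializationAt F V m
          ⟨chartCurve I m w₁ t, fibreCurve I F V m w₁ y u t⟩).2 = y + t • u :=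
        fun y u => congrArg Prod.snd (Trivialization.apply_mk_symm _ ht.1.1 _)
      rw [e, e, smul_add, smul_add, smul_comm s t]
      abel
    have hl : ∀ s : ℝ, horLift h (fibreLine (⟨m, a⟩ : TotalSpace F V) b s)
        (mfderiv (I.prod 𝓘(ℝ, F)) I (TotalSpace.proj : TotalSpace F V → B)
          (⟨m, a⟩ : TotalSpace F V) ((w₁, w₂) : EB × F)) =
        (⟨⟨m, a + s • b⟩, (w₁, (jetEquiv I hm (h.toFun ⟨m, a + s • b⟩)).2 w₁)⟩ :
          TangentBundle (I.prod 𝓘(ℝ, F)) (TotalSpace F V)) := fun s =>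
      hlift (fibreLine (⟨m, a⟩ : TotalSpace F V) b s) _ hπ
    have hd1 : HasDerivAt (fun s : ℝ => (w₁, A + s • K)) ((0 : EB), K) 0 := by
      have e := ((hasDerivAt_id (0 : ℝ)).smul_const K).const_add A
      rw [one_smul] at e
      exact (hasDerivAt_const (0 : ℝ) w₁).prodMk e
    refine (congrArg (velocityPoint (I.prod 𝓘(ℝ, F)).tangent) (funext hsum)).trans
      (Eq.trans ?_ (congrArg (velocityPoint (I.prod 𝓘(ℝ, F)).tangent) (funext hl)).symm)
    refine (velocityPoint_tangent_fibre I m a b hd1).trans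
      (Eq.trans ?_ (velocityPoint_tangent_fibre I m a b hd2).symm)
    rw [zero_smul, add_zero, zero_smul, add_zero]

end Linearizations

/-! ### The main theorem -/

theorem theorem7p5
    {EM : Type*} [NormedAddCommGroup EM] [NormedSpace ℝ EM] [CompleteSpace EM]
    {HM : Type*} [TopologicalSpace HM] (I : ModelWithCorners ℝ EM HM) [I.Boundaryless]
    {M : Type*} [TopologicalSpace M] [ChartedSpace HM M] [IsManifold I ∞ M]
    {F : Type*} [NormedAddCommGroup F] [NormedSpace ℝ F] [CompleteSpace F]
    {V : M → Type*} [∀ x, AddCommGroup (V x)] [∀ x, Module ℝ (V x)] [∀ x, TopologicalSpace (V x)]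
    [TopologicalSpace (TotalSpace F V)] [FiberBundle F V] [VectorBundle ℝ F V]
    [ContMDiffVectorBundle ∞ F V I] (h : Connection I F V) :
    -- the canonical isomorphism `vj : Ver π_1 → J^1 𝔭_V` is well defined and bijective
    ((∀ ζ : TotalSpace (F × (EM →L[ℝ] F)) (Vert I (F × (EM →L[ℝ] F)) (J1 I F V)),
        ∃ (m : M) (σ : ℝ → ∀ x, V x), IsSmoothFamily I F m σ ∧ jetVelocity I F m σ = ζ) ∧
      (∀ (m : M) (σ : ℝ → ∀ x, V x), IsSmoothFamily I F m σ →
        vj I F (jetVelocity I F m σ) = jetVelocitySec I F m σ) ∧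
      Function.Bijective (vj I F (V := V))) ∧
    -- `h̄_V` is a linear connection on `Ver π → E`
    (∃ HV : Connection (I.prod 𝓘(ℝ, F)) F (Vert I F V), HV.IsLinear ∧
      ∀ z : TotalSpace F (Vert I F V),
        (⟨z.proj, HV.toFun z⟩ :
          TotalSpace (F × (EM × F →L[ℝ] F)) (J1 (I.prod 𝓘(ℝ, F)) F (Vert I F V))) =
        hbarVert h z) ∧
    -- `h̄` is the linear connection on `π^*E → E` which is the linearization of `h`
    (∃ HL : Connection (I.prod 𝓘(ℝ, F)) F (PB I F V), HL.IsLinear ∧ IsLinearization h HL ∧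
      ∀ q : TotalSpace F (PB I F V),
        (⟨q.proj, HL.toFun q⟩ :
          TotalSpace (F × (EM × F →L[ℝ] F)) (J1 (I.prod 𝓘(ℝ, F)) F (PB I F V))) =
        hbar h q) ∧
    -- `j^1 ξ_π ∘ h̄ = h̄_V ∘ ξ_π`
    ∀ q : TotalSpace F (PB I F V), jetXi I F V (hbar h q) = hbarVert h (xi I F V q) :=
  ⟨⟨exists_isSmoothFamily I, fun _ _ hσ => vj_jetVelocity I hσ, vj_bijective I⟩,
    ⟨verticalConnection h, verticalConnection_isLinear h, verticalConnection_mk h⟩,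
    ⟨linearizedConnection h, linearizedConnection_isLinear h, isLinearization_linearizedConnection I h,
      linearizedConnection_mk h⟩,
    jetXi_hbar h⟩
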